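/- **Setting.** Fix a horizon $T>0$, a claim intensity $\lambda>0$, $\beta>0$, loadings $0<\theta\le\eta$, risk aversions $\gamma_I,\gamma_{R1},\gamma_{R2}>0$ and deterministic, measurable, positive, bounded interest rates $\rho_I,\rho_{R1},\rho_{R2}$ on $[0,T]$. Claims arrive at the jump times $T_1\le T_2\le\dots$ of a Poisson process $(N(t))_{t\in[0,T]}$ of intensity $\lambda$, and the claim sizes $Y_1,Y_2,\dots$ are i.i.d. $\exp(\beta)$ with distribution function $F$, independent of $N$. Write $N(ds,dy)$ for the random measure $\sum_i\delta_{(T_i,Y_i)}$ and $v(dy)=\lambda\,dF(y)$. A reinsurance strategy is a pair of measurable functions $l_1,l_2\ge 0$ on $[0,T]\times[0,\infty)$ with $l_1(t,y)+l_2(t,y)\le y$; premium strategies are measurable functions $\xi_1:[0,T]\to[\theta\beta,\eta\beta]$ and $\xi_2:[0,T]\to[\theta,\eta]$. Put $c=(1+\theta)\int y\,v(dy)$, $p_1(t)=\int l_1(t,y)\,v(dy)+\xi_1(t)\int l_1(t,y)^2\,v(dy)$ and $p_2(t)=(1+\xi_2(t))\int l_2(t,y)\,v(dy)$. The surpluses,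 started from the value $x$ at time $t$, solve $$dX_I=[c-p_1-p_2+\rho_IX_I]\,ds-\int (y-l_1-l_2)\,N(ds,dy),\qquad dX_{Rj}=[p_j+\rho_{Rj}X_{Rj}]\,ds-\int l_j\,N(ds,dy),\quad j=1,2,$$ and the objectives are $J_k(t,x)=\mathbb E[X_k(T)]-\frac{\gamma_k}{2}\mathrm{Var}[X_k(T)]$ for $k=I,R1,R2$. For a strategy $f$ and an action $a$ let $f^{t,\epsilon,a}$ be the strategy that equals $a$ on $[t,t+\epsilon)$ and $f$ otherwise. Given $(\xi_1,\xi_2)$, an admissible pair $(l_1,l_2)$ is an equilibrium reinsurance strategy of the insurer if, for all $t\in[0,T]$, all $x$ and all functions $\tilde l_1,\tilde l_2$ of the claim size for which $(l_1^{t,\epsilon,\tilde l_1},l_2^{t,\epsilon,\tilde l_2})$ is admissible for every $\epsilon>0$, $$\liminf_{\epsilon\to0^+}\tfrac1\epsilon\Big[J_I(t,x;l_1,l_2,\xi_1,\xi_2)-J_I(t,x;l_1^{t,\epsilon,\tilde l_1},l_2^{t,\epsilon,\tilde l_2},\xi_1,\xi_2)\Big]\ge 0 .$$ A response of the insurer is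 a map $L=(L_1,L_2)$ that assigns such an equilibrium strategy to every admissible $(\xi_1,\xi_2)$. Given $L$, an admissible pair $(\xi_1,\xi_2)$ is a pair of equilibrium premium strategies if, for all $t\in[0,T]$, all $x$, all $a\in[\theta\beta,\eta\beta]$ and all $b\in[\theta,\eta]$, $$\liminf_{\epsilon\to0^+}\tfrac1\epsilon\Big[J_{R1}\big(t,x;L_1(\xi_1,\xi_2),\xi_1\big)-J_{R1}\big(t,x;L_1(\xi_1^{t,\epsilon,a},\xi_2),\xi_1^{t,\epsilon,a}\big)\Big]\ge0,$$ $$\liminf_{\epsilon\to0^+}\tfrac1\epsilon\Big[J_{R2}\big(t,x;L_2(\xi_1,\xi_2),\xi_2\big)-J_{R2}\big(t,x;L_2(\xi_1,\xi_2^{t,\epsilon,b}),\xi_2^{t,\epsilon,b}\big)\Big]\ge0 .$$ For $t\in[0,T]$ let $k_j=\gamma_je^{\int_t^T\rho_j(s)ds}$ for $j=I,R1,R2$, and $C_{R1}=k_{R1}/k_I$, $C_{R2}=k_{R2}/k_I$. For $x>0$ let $$e(x)=\tfrac{2}{x^2}e^x-\Big(1+\tfrac2x+\tfrac2{x^2}\Big),\qquad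 G(x)=g(e(x)),$$ $$g(x)=\tfrac12\Big(-[2C_{R1}-1+x(2C_{R1}+1)]+\sqrt{[2C_{R1}-1+x(2C_{R1}+1)]^2+8C_{R1}(x+1)}\Big),$$ and let $$h_1(\xi_1)=\frac{k_I\,G^{-1}(k_{R1}/\xi_1)}{\beta\left(\frac{k_I}{2\xi_1}+1\right)},\qquad h_2(\xi_1)=\frac{k_I}{\beta}\Big(1+C_{R2}-\frac{k_I}{k_I+2\xi_1}\Big),$$ where $h_1$ is defined for those $\xi_1>0$ for which $k_{R1}/\xi_1$ is a value of $G$ on $(0,\infty)$. **Proposition.** For every $t\in[0,T]$, $G$ is injective on $(0,\infty)$, $h_1$ is a bijection from its domain onto $(0,\infty)$, with inverse $h_1^{-1}$, and there is a unique positive solution $(\bar\xi_1(t),\bar\xi_2(t))$ of $\bar\xi_2=h_1(\bar\xi_1)=h_2(\bar\xi_1)$. A response of the insurer exists. For every response of the insurer, the pair $(\xi_1^*,\xi_2^*)$ given by $$\xi_1^*(t)=\max\{\theta\beta,\min\{h_1^{-1}(\xi_2^*(t)),\eta\beta\}\},$$ $$\xi_2^*(t)=\begin{cases}\max\{\theta,\min\{h_2(\theta\beta),\eta\}\},&\bar\xi_1(t)<\theta\beta,\\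 \max\{\theta,\min\{\bar\xi_2(t),\eta\}\},&\theta\beta\le\bar\xi_1(t)\le\eta\beta,\\ \max\{\theta,\min\{h_2(\eta\beta),\eta\}\},&\eta\beta<\bar\xi_1(t),\end{cases}$$ is a pair of equilibrium premium strategies, and every pair of equilibrium premium strategies coincides with it for almost every $t\in[0,T]$. -/

import Mathlib

open Set Filter Topology MeasureTheory ProbabilityTheory

/-- The constants of the reinsurance market together with their standing assumptions: horizon `T`,
claim intensity `lam`, rate `beta` of the exponential claims, insurer's safety loading `theta`,
largest loading `eta`, risk aversions and interest rates of the insurer (`I`), of reinsurer 1 and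
of reinsurer 2. -/
structure Market where
  T : ℝ
  lam : ℝ
  beta : ℝ
  theta : ℝ
  eta : ℝ
  gammaI : ℝ
  gamma1 : ℝ
  gamma2 : ℝ
  rhoI : ℝ → ℝ
  rho1 : ℝ → ℝ
  rho2 : ℝ → ℝ
  T_pos : 0 < T
  lam_pos : 0 < lam
  beta_pos : 0 < beta
  theta_pos : 0 < theta
  theta_le_eta : theta ≤ eta
  gammaI_pos : 0 < gammaI
  gamma1_pos : 0 < gamma1
  gamma2_pos : 0 < gamma2
  rhoI_meas : Measurable ((Icc 0 T).domRestrict rhoI)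
  rho1_meas : Measurable ((Icc 0 T).domRestrict rho1)
  rho2_meas : Measurable ((Icc 0 T).domRestrict rho2)
  rhoI_pos : ∀ s ∈ Icc 0 T, 0 < rhoI s
  rho1_pos : ∀ s ∈ Icc 0 T, 0 < rho1 s
  rho2_pos : ∀ s ∈ Icc 0 T, 0 < rho2 s
  rhoI_bdd : ∃ K, ∀ s ∈ Icc 0 T, rhoI s ≤ K
  rho1_bdd : ∃ K, ∀ s ∈ Icc 0 T, rho1 s ≤ K
  rho2_bdd : ∃ K, ∀ s ∈ Icc 0 T, rho2 s ≤ K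

/-- The claim arrivals and the claim sizes: `N` is a Poisson process of intensity `lam` on `[0, T]`,
the claim sizes `Y 0, Y 1, …` are i.i.d. exponential of rate `beta`, and `N` and `Y` are
independent. The claim `Y i` is the one that arrives when `N` reaches `i + 1`.
The paths of `N` are nondecreasing, so the truncated subtraction of its values is exact. -/
structure IsClaimModel (M : Market) {Ω : Type*} [MeasurableSpace Ω] (P : Measure Ω)
    (N : ℝ → Ω → ℕ) (Y : ℕ → Ω → ℝ) : Prop where
  count_meas : ∀ s ∈ Icc 0 M.T, Measurable (N s)
  count_zero : ∀ ω, N 0 ω = 0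
  count_mono : ∀ ω, MonotoneOn (fun s => N s ω) (Icc 0 M.T)
  count_rightCont : ∀ ω, ∀ s ∈ Icc 0 M.T, ContinuousWithinAt (fun u => N u ω) (Icc s M.T) s
  count_indep : HasIndepIncrements (fun (s : Icc (0 : ℝ) M.T) (ω : Ω) => N s ω) P
  count_law : ∀ s u : ℝ, 0 ≤ s → s ≤ u → u ≤ M.T →
    HasLaw (fun ω => N u ω - N s ω) (poissonMeasure (Real.toNNReal (M.lam * (u - s)))) P
  claim_meas : ∀ i, Measurable (Y i)
  claim_law : ∀ i, HasLaw (Y i) (expMeasure M.beta) P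
  claim_indep : iIndepFun Y P
  indep : IndepFun (fun ω (s : Icc (0 : ℝ) M.T) => N s ω) (fun ω i => Y i ω) P

/-- The time at which the counting process reaches `i`. -/
noncomputable def arrivalTime {Ω : Type*} (M : Market) (N : ℝ → Ω → ℕ) (i : ℕ) (ω : Ω) : ℝ :=
  sInf {s | s ∈ Icc 0 M.T ∧ i ≤ N s ω}

/-- The integral of `f` over `(t, s] × ℝ₊` against the Poisson random measure of the claims, i.e.
the sum of `f (arrival time) (claim size)` over the claims that arrive in `(t, s]`. -/
noncomputable def claimSum {Ω : Type*} (M : Market) (N : ℝ → Ω → ℕ) (Y : ℕ → Ω → ℝ)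
    (f : ℝ → ℝ → ℝ) (t s : ℝ) (ω : Ω) : ℝ :=
  ∑ i ∈ Finset.Ico (N t ω) (N s ω), f (arrivalTime M N (i + 1) ω) (Y i ω)

/-- `X` solves on `[t, T]`, from the value `x` at time `t`, the surplus equation
`dX(s) = [a(s) + rho(s) X(s)] ds - ∫ f(s, y) N(ds, dy)`. -/
def IsSurplus {Ω : Type*} [MeasurableSpace Ω] (M : Market) (P : Measure Ω)
    (N : ℝ → Ω → ℕ) (Y : ℕ → Ω → ℝ) (rho a : ℝ → ℝ) (f : ℝ → ℝ → ℝ) (t x : ℝ)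
    (X : ℝ → Ω → ℝ) : Prop :=
  ∀ᵐ ω ∂P, ∀ s ∈ Icc t M.T,
    IntervalIntegrable (fun u => a u + rho u * X u ω) volume t s ∧
    X s ω = x + (∫ u in t..s, (a u + rho u * X u ω)) - claimSum M N Y f t s ω

/-- The surplus process: the (almost surely unique) solution of the surplus equation. -/
noncomputable def surplus {Ω : Type*} [MeasurableSpace Ω] (M : Market) (P : Measure Ω)
    (N : ℝ → Ω → ℕ) (Y : ℕ → Ω → ℝ) (rho a : ℝ → ℝ) (f : ℝ → ℝ → ℝ) (t x : ℝ) : ℝ → Ω → ℝ :=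
  Classical.epsilon (IsSurplus M P N Y rho a f t x)

/-- The mean-variance objective `E[X(T)] - (gamma / 2) Var[X(T)]` of the surplus that starts from
the value `x` at time `t`. -/
noncomputable def meanVariance {Ω : Type*} [MeasurableSpace Ω] (M : Market) (P : Measure Ω)
    (N : ℝ → Ω → ℕ) (Y : ℕ → Ω → ℝ) (gamma : ℝ) (rho a : ℝ → ℝ) (f : ℝ → ℝ → ℝ)
    (t x : ℝ) : ℝ :=
  (∫ ω, surplus M P N Y rho a f t x M.T ω ∂P)
    - gamma / 2 * variance (surplus M P N Y rho a f t x M.T) P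

namespace Market

variable (M : Market)

/-- The compensator `v(dy) = lam dF(y)`, where `F` is the claim size distribution. -/
noncomputable def nu : Measure ℝ := ENNReal.ofReal M.lam • expMeasure M.beta

/-- Premium rate received by the insurer. -/
noncomputable def premiumI : ℝ := (1 + M.theta) * ∫ y, y ∂M.nu

/-- Premium rate of reinsurer 1 (variance principle). -/
noncomputable def premium1 (l1 : ℝ → ℝ → ℝ) (xi1 : ℝ → ℝ) (t : ℝ) : ℝ :=
  (∫ y, l1 t y ∂M.nu) + xi1 t * ∫ y, l1 t y ^ 2 ∂M.nu

/-- Premium rate of reinsurer 2 (expected value principle). -/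
noncomputable def premium2 (l2 : ℝ → ℝ → ℝ) (xi2 : ℝ → ℝ) (t : ℝ) : ℝ :=
  (1 + xi2 t) * ∫ y, l2 t y ∂M.nu

/-- Admissible reinsurance strategies `(l1, l2)`; `l j t y` is the part of a claim `y` at time `t`
that is ceded to reinsurer `j`. -/
def AdmissibleI (l : (ℝ → ℝ → ℝ) × (ℝ → ℝ → ℝ)) : Prop :=
  Measurable ((Icc 0 M.T ×ˢ Ici 0).domRestrict (Function.uncurry l.1)) ∧
  Measurable ((Icc 0 M.T ×ˢ Ici 0).domRestrict (Function.uncurry l.2)) ∧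
  ∀ t ∈ Icc 0 M.T, ∀ y, 0 ≤ y → 0 ≤ l.1 t y ∧ 0 ≤ l.2 t y ∧ l.1 t y + l.2 t y ≤ y

/-- Admissible premium strategies of reinsurer 1. -/
def Admissible1 (xi1 : ℝ → ℝ) : Prop :=
  Measurable ((Icc 0 M.T).domRestrict xi1) ∧
  ∀ t ∈ Icc 0 M.T, xi1 t ∈ Icc (M.theta * M.beta) (M.eta * M.beta)

/-- Admissible premium strategies of reinsurer 2. -/
def Admissible2 (xi2 : ℝ → ℝ) : Prop :=
  Measurable ((Icc 0 M.T).domRestrict xi2) ∧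
  ∀ t ∈ Icc 0 M.T, xi2 t ∈ Icc M.theta M.eta

end Market

/-- The strategy that uses the action `a` during `[t, t + ε)` and follows `f` otherwise. -/
noncomputable def perturb {α : Type*} (t ε : ℝ) (a : α) (f : ℝ → α) : ℝ → α :=
  fun s => if t ≤ s ∧ s < t + ε then a else f s

section Equilibrium

variable {Ω : Type*} [MeasurableSpace Ω] (M : Market) (P : Measure Ω)
  (N : ℝ → Ω → ℕ) (Y : ℕ → Ω → ℝ)

/-- The insurer's objective. -/
noncomputable def objectiveI (t x : ℝ) (l : (ℝ → ℝ → ℝ) × (ℝ → ℝ → ℝ)) (xi1 xi2 : ℝ → ℝ) : ℝ :=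
  meanVariance M P N Y M.gammaI M.rhoI
    (fun s => M.premiumI - M.premium1 l.1 xi1 s - M.premium2 l.2 xi2 s)
    (fun s y => y - l.1 s y - l.2 s y) t x

/-- The objective of reinsurer 1. -/
noncomputable def objective1 (t x : ℝ) (l1 : ℝ → ℝ → ℝ) (xi1 : ℝ → ℝ) : ℝ :=
  meanVariance M P N Y M.gamma1 M.rho1 (M.premium1 l1 xi1) l1 t x

/-- The objective of reinsurer 2. -/
noncomputable def objective2 (t x : ℝ) (l2 : ℝ → ℝ → ℝ) (xi2 : ℝ → ℝ) : ℝ :=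
  meanVariance M P N Y M.gamma2 M.rho2 (M.premium2 l2 xi2) l2 t x

/-- `l` is a (time-consistent) equilibrium reinsurance strategy of the insurer associated with the
premium strategies `xi1`, `xi2`. -/
def IsInsurerEquilibrium (xi1 xi2 : ℝ → ℝ) (l : (ℝ → ℝ → ℝ) × (ℝ → ℝ → ℝ)) : Prop :=
  M.AdmissibleI l ∧
  ∀ t ∈ Icc 0 M.T, ∀ x : ℝ, ∀ a1 a2 : ℝ → ℝ,
    (∀ ε > 0, M.AdmissibleI (perturb t ε a1 l.1, perturb t ε a2 l.2)) →
    0 ≤ liminf (fun ε : ℝ =>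
      ((1 / ε * (objectiveI M P N Y t x l xi1 xi2
        - objectiveI M P N Y t x (perturb t ε a1 l.1, perturb t ε a2 l.2) xi1 xi2) : ℝ) : EReal))
      (𝓝[>] 0)

/-- `L` is a response of the insurer: it selects, for every pair of admissible premium strategies,
an associated equilibrium reinsurance strategy. -/
def IsInsurerResponse (L : (ℝ → ℝ) → (ℝ → ℝ) → (ℝ → ℝ → ℝ) × (ℝ → ℝ → ℝ)) : Prop :=
  ∀ xi1 xi2, M.Admissible1 xi1 → M.Admissible2 xi2 →
    IsInsurerEquilibrium M P N Y xi1 xi2 (L xi1 xi2)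

/-- `xi1` is an equilibrium premium strategy for reinsurer 1 associated with `xi2`. -/
def IsEquilibrium1 (L : (ℝ → ℝ) → (ℝ → ℝ) → (ℝ → ℝ → ℝ) × (ℝ → ℝ → ℝ))
    (xi2 xi1 : ℝ → ℝ) : Prop :=
  M.Admissible1 xi1 ∧
  ∀ t ∈ Icc 0 M.T, ∀ x a : ℝ, (∀ ε > 0, M.Admissible1 (perturb t ε a xi1)) →
    0 ≤ liminf (fun ε : ℝ =>
      ((1 / ε * (objective1 M P N Y t x (L xi1 xi2).1 xi1
        - objective1 M P N Y t x (L (perturb t ε a xi1) xi2).1 (perturb t ε a xi1)) : ℝ) : EReal))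
      (𝓝[>] 0)

/-- `xi2` is an equilibrium premium strategy for reinsurer 2 associated with `xi1`. -/
def IsEquilibrium2 (L : (ℝ → ℝ) → (ℝ → ℝ) → (ℝ → ℝ → ℝ) × (ℝ → ℝ → ℝ))
    (xi1 xi2 : ℝ → ℝ) : Prop :=
  M.Admissible2 xi2 ∧
  ∀ t ∈ Icc 0 M.T, ∀ x a : ℝ, (∀ ε > 0, M.Admissible2 (perturb t ε a xi2)) →
    0 ≤ liminf (fun ε : ℝ =>
      ((1 / ε * (objective2 M P N Y t x (L xi1 xi2).2 xi2
        - objective2 M P N Y t x (L xi1 (perturb t ε a xi2)).2 (perturb t ε a xi2)) : ℝ) : EReal))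
      (𝓝[>] 0)

/-- `(xi1, xi2)` are equilibrium premium strategies of the competing reinsurers when the insurer
responds by `L`. -/
def IsPremiumEquilibrium (L : (ℝ → ℝ) → (ℝ → ℝ) → (ℝ → ℝ → ℝ) × (ℝ → ℝ → ℝ))
    (xi1 xi2 : ℝ → ℝ) : Prop :=
  IsEquilibrium1 M P N Y L xi2 xi1 ∧ IsEquilibrium2 M P N Y L xi1 xi2

end Equilibrium

/-- `e(x) = (2 / x²) exp x - (1 + 2 / x + 2 / x²)`. -/
noncomputable def eFun (x : ℝ) : ℝ :=
  2 / x ^ 2 * Real.exp x - (1 + 2 / x + 2 / x ^ 2)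

noncomputable def gFun (c x : ℝ) : ℝ :=
  1 / 2 * (-(2 * c - 1 + x * (2 * c + 1))
    + Real.sqrt ((2 * c - 1 + x * (2 * c + 1)) ^ 2 + 8 * c * (x + 1)))

namespace Market

variable (M : Market)

/-- `gamma_I exp (∫_t^T rho_I)`. -/
noncomputable def kI (t : ℝ) : ℝ := M.gammaI * Real.exp (∫ s in t..M.T, M.rhoI s)

/-- `gamma_{R1} exp (∫_t^T rho_{R1})`. -/
noncomputable def k1 (t : ℝ) : ℝ := M.gamma1 * Real.exp (∫ s in t..M.T, M.rho1 s)

/-- `gamma_{R2} exp (∫_t^T rho_{R2})`. -/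
noncomputable def k2 (t : ℝ) : ℝ := M.gamma2 * Real.exp (∫ s in t..M.T, M.rho2 s)

/-- The function `G = g ∘ e` on `(0, ∞)`, with constant `C_{R1}(t)`. -/
noncomputable def G (t x : ℝ) : ℝ := gFun (M.k1 t / M.kI t) (eFun x)

/-- The inverse of `G` on `(0, ∞)`. -/
noncomputable def GInv (t : ℝ) : ℝ → ℝ := Function.invFunOn (M.G t) (Ioi 0)

/-- The set on which `h1` is defined: the positive `xi1` for which `k1 / xi1` is a value of `G`. -/
def h1Domain (t : ℝ) : Set ℝ := {xi1 | 0 < xi1 ∧ M.k1 t / xi1 ∈ M.G t '' Ioi 0}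

noncomputable def h1 (t xi1 : ℝ) : ℝ :=
  M.kI t * M.GInv t (M.k1 t / xi1) / (M.beta * (M.kI t / (2 * xi1) + 1))

/-- The inverse of `h1` on its domain. -/
noncomputable def h1Inv (t : ℝ) : ℝ → ℝ := Function.invFunOn (M.h1 t) (M.h1Domain t)

noncomputable def h2 (t xi1 : ℝ) : ℝ :=
  M.kI t / M.beta * (1 + M.k2 t / M.kI t - M.kI t / (M.kI t + 2 * xi1))

/-- `(b1, b2)` is the unconstrained equilibrium at time `t`: a positive solution of
`b2 = h1(b1) = h2(b1)`. -/
def IsUnconstrainedEquilibrium (t b1 b2 : ℝ) : Prop :=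
  b1 ∈ M.h1Domain t ∧ 0 < b2 ∧ b2 = M.h1 t b1 ∧ b2 = M.h2 t b1

/-- The premium of reinsurer 2 in the constrained equilibrium, in terms of the unconstrained
equilibrium `(b1, b2)`. -/
noncomputable def xi2Star (b1 b2 : ℝ → ℝ) (t : ℝ) : ℝ :=
  if b1 t < M.theta * M.beta then max M.theta (min (M.h2 t (M.theta * M.beta)) M.eta)
  else if b1 t ≤ M.eta * M.beta then max M.theta (min (b2 t) M.eta)
  else max M.theta (min (M.h2 t (M.eta * M.beta)) M.eta)

/-- The premium of reinsurer 1 in the constrained equilibrium. -/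
noncomputable def xi1Star (b1 b2 : ℝ → ℝ) (t : ℝ) : ℝ :=
  max (M.theta * M.beta) (min (M.h1Inv t (M.xi2Star b1 b2 t)) (M.eta * M.beta))

end Market

/-! The game decouples in time. The terminal surplus is a deterministic number minus a sum over the
later claims of (share) × (accumulation factor). By Campbell's formulas its mean and variance are
integrals over time, so every mean-variance objective equals `x * growth` plus the integral over
`[t, T]` of a gain rate at time `s` (`IsClaimModel.meanVariance_eq`). The current wealth does not
enter the variance. A deviation on `[t, t + ε)` therefore changes the objective by an integral over
that window. If the strategy maximizes the rate at every time, this change is never a gain.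
Conversely, Lebesgue differentiation turns the liminf condition for one fixed action into an
inequality of rates at almost every time, and continuity in the action with a countable dense set
makes this hold for all actions at once.

For the insurer the rate is maximized claim by claim. A quadratic cost has as its unique minimizer a
quota share of `min y d` to reinsurer 1 and the excess `max (y - d) 0` to reinsurer 2
(`cedingCost_add_le`). So any response agrees almost everywhere with `Market.optimalShare`, and the
particular choice of `L` does not affect the reinsurers' objectives.

With exponential claims the rates of the reinsurers become, up to positive factors, the explicit
functions `payoff1` and `payoff2` of the two loadings. Each is strictly unimodal in the reinsurer's
own loading. The derivative of `payoff1` has the sign of a quadratic whose positive root is `gFun`,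
hence the sign of `slope1`. The peak of `payoff2` is `bestReply2`, which is `h2`. A best reply under
bounds is the truncated peak.

At each time there remains a game in two real variables. `slope1` strictly decreases in the first
loading and strictly increases in the second. Along the graph of `bestReply2` it still strictly
decreases, because the argument of `eFun` there is `1 + k2 * (1 / k + 1 / (2 * x))`. This gives one
unconstrained equilibrium, shows that the stated formula is a pair of mutual best replies
(`constrained_fixed_point`), and excludes any other pair (`constrained_fixed_point_unique`).
Measurability of the equilibrium loadings comes from describing them as roots of functions that
change sign. -/

/-! ### The auxiliary functions `e` and `g`. -/

theorem eFun_add_one_eq {x : ℝ} (hx : 0 < x) :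
    eFun x + 1 = 2 * (Real.exp x - 1 - x) / x ^ 2 := by
  unfold eFun; field_simp; ring

theorem continuousOn_eFun : ContinuousOn eFun (Ioi 0) := by
  unfold eFun
  intro x hx
  have : x ≠ 0 := ne_of_gt hx
  have h2 : x ^ 2 ≠ 0 := pow_ne_zero _ this
  apply ContinuousAt.continuousWithinAt
  fun_prop (disch := assumption)

theorem eFun_pos {x : ℝ} (hx : 0 < x) : 0 < eFun x := by
  have h3 : 1 + x + x ^ 2 / 2 + x ^ 3 / 6 ≤ Real.exp x := by
    have := Real.sum_le_exp_of_nonneg hx.le 4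
    simp [Finset.sum_range_succ, Nat.factorial] at this
    linarith
  have h4 : 1 < eFun x + 1 := by
    rw [eFun_add_one_eq hx, lt_div_iff₀ (by positivity)]
    have : 0 < x ^ 3 := by positivity
    linarith
  linarith

/-- Differentiate `2 * (exp x - 1 - x) / x ^ 2`: the numerator is `2 * x * w x` with `w x = x * exp
x + x - 2 * exp x + 2`. Here `w 0 = 0` and `w' x = x * exp x - (exp x - 1)`, which is positive for
`x > 0`. -/
theorem eFun_strictMonoOn : StrictMonoOn eFun (Ioi 0) := by
  have hA : ∀ x : ℝ, 0 < x → Real.exp x - 1 < x * Real.exp x := by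
    intro x hx
    have h := Real.add_one_lt_exp (x := -x) (by linarith)
    have h1 : Real.exp x * Real.exp (-x) = 1 := by rw [← Real.exp_add]; simp
    nlinarith [Real.exp_pos x]
  have hB : StrictMonoOn (fun x : ℝ => x * Real.exp x + x - 2 * Real.exp x + 2) (Ici 0) := by
    apply strictMonoOn_of_deriv_pos (convex_Ici 0) (by fun_prop)
    intro x hx
    rw [interior_Ici] at hx
    have hd : HasDerivAt (fun x : ℝ => x * Real.exp x + x - 2 * Real.exp x + 2)
        (1 * Real.exp x + x * Real.exp x + 1 - 2 * Real.exp x) x :=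
      ((((hasDerivAt_id x).mul (Real.hasDerivAt_exp x)).add (hasDerivAt_id x)).sub
        ((Real.hasDerivAt_exp x).const_mul 2)).add_const 2
    rw [hd.deriv]
    linarith [hA x hx]
  have hC : ∀ x : ℝ, 0 < x → 0 < x * Real.exp x + x - 2 * Real.exp x + 2 := by
    intro x hx
    have := hB (self_mem_Ici (a := (0 : ℝ))) (mem_Ici.2 hx.le) hx
    simpa using this
  have hD : StrictMonoOn (fun x : ℝ => 2 * (Real.exp x - 1 - x) / x ^ 2) (Ioi 0) := by
    apply strictMonoOn_of_deriv_pos (convex_Ioi 0)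
    · intro x hx
      have h2 : x ^ 2 ≠ 0 := pow_ne_zero _ (ne_of_gt hx)
      apply ContinuousAt.continuousWithinAt
      fun_prop (disch := assumption)
    · intro x hx
      rw [interior_Ioi] at hx
      have hx : 0 < x := hx
      have hd := (((((Real.hasDerivAt_exp x).sub_const 1).sub (hasDerivAt_id x)).const_mul 2).div
        (hasDerivAt_pow 2 x) (by positivity))
      have : deriv (fun x : ℝ => 2 * (Real.exp x - 1 - x) / x ^ 2) x = _ := hd.deriv
      rw [this]
      apply div_pos _ (by positivity)
      have := mul_pos hx (hC x hx)
      simp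
      nlinarith
  intro x hx y hy hxy
  have h := hD hx hy hxy
  simp only at h
  rw [← eFun_add_one_eq hx, ← eFun_add_one_eq hy] at h
  linarith

/-- The quadratic polynomial whose positive root is `gFun c E`. -/
def gPoly (c E u : ℝ) : ℝ := u ^ 2 + u * (2 * c - 1 + E * (2 * c + 1)) - 2 * c * (E + 1)

theorem gPoly_eq_mul {c E : ℝ} (hc : 0 < c) (hE : 0 < E) (u : ℝ) :
    gPoly c E u = (u - gFun c E) *
      (u + 1 / 2 * ((2 * c - 1 + E * (2 * c + 1))
        + Real.sqrt ((2 * c - 1 + E * (2 * c + 1)) ^ 2 + 8 * c * (E + 1)))) := by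
  unfold gPoly gFun
  have := Real.sq_sqrt (x := (2 * c - 1 + E * (2 * c + 1)) ^ 2 + 8 * c * (E + 1)) (by positivity)
  linear_combination (1/4) * this

/-- This is `-2` times the second root of `gPoly c E`. The constant term of the quadratic is
negative, so the roots have opposite signs. Consequently the sign of `gPoly` at a positive point
tells on which side of `gFun` the point lies. -/
theorem gFun_conj_pos {c E : ℝ} (hc : 0 < c) (hE : 0 < E) :
    0 < (2 * c - 1 + E * (2 * c + 1))
        + Real.sqrt ((2 * c - 1 + E * (2 * c + 1)) ^ 2 + 8 * c * (E + 1)) := by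
  set b := 2 * c - 1 + E * (2 * c + 1)
  have h : |b| < Real.sqrt (b ^ 2 + 8 * c * (E + 1)) := by
    rw [← Real.sqrt_sq_eq_abs]
    apply Real.sqrt_lt_sqrt (sq_nonneg _)
    have : 0 < 8 * c * (E + 1) := by positivity
    linarith
  have := neg_abs_le b
  linarith

theorem gPoly_pos_iff {c E u : ℝ} (hc : 0 < c) (hE : 0 < E) (hu : 0 < u) :
    0 < gPoly c E u ↔ gFun c E < u := by
  have := gFun_conj_pos hc hE
  rw [gPoly_eq_mul hc hE, mul_pos_iff_of_pos_right (by linarith), sub_pos]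

theorem gPoly_neg_iff {c E u : ℝ} (hc : 0 < c) (hE : 0 < E) (hu : 0 < u) :
    gPoly c E u < 0 ↔ u < gFun c E := by
  have := gFun_conj_pos hc hE
  rw [gPoly_eq_mul hc hE, ← neg_pos, ← neg_mul, mul_pos_iff_of_pos_right (by linarith), neg_sub,
    sub_pos]

/-- `gPoly c E 1 = E`. Together with `lt_gFun` this bounds `gFun` independently of `E`, which later
brackets the roots of `slope1`. -/
theorem gFun_lt_one {c E : ℝ} (hc : 0 < c) (hE : 0 < E) : gFun c E < 1 := by
  rw [← gPoly_pos_iff hc hE one_pos]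
  unfold gPoly; linarith

theorem lt_gFun {c E : ℝ} (hc : 0 < c) (hE : 0 < E) : 2 * c / (2 * c + 1) < gFun c E := by
  rw [← gPoly_neg_iff hc hE (by positivity)]
  unfold gPoly
  have h : 0 < 2 * c + 1 := by positivity
  have : (2 * c / (2 * c + 1)) ^ 2 + 2 * c / (2 * c + 1) * (2 * c - 1 + E * (2 * c + 1))
    - 2 * c * (E + 1) = - (4 * c * (c + 1) / (2 * c + 1) ^ 2) := by
    field_simp; ring
  rw [this, neg_lt_zero]; positivity

theorem gFun_pos {c E : ℝ} (hc : 0 < c) (hE : 0 < E) : 0 < gFun c E :=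
  lt_trans (by positivity) (lt_gFun hc hE)

/-- `gPoly c E u` is affine in `E` with slope `u * (2 * c + 1) - 2 * c`, positive at `u = gFun c E`
by `lt_gFun`. Raising `E` makes the polynomial positive at the old root, so the new root is smaller.
-/
theorem gFun_strictAntiOn {c : ℝ} (hc : 0 < c) : StrictAntiOn (gFun c) (Ioi 0) := by
  intro E hE F hF hEF
  have hE : 0 < E := hE
  have hF : 0 < F := hF
  rw [← gPoly_pos_iff hc hF (gFun_pos hc hE)]
  have h0 : gPoly c E (gFun c E) = 0 := by rw [gPoly_eq_mul hc hE]; simp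
  have h1 := lt_gFun hc hE
  rw [div_lt_iff₀ (by positivity)] at h1
  have : gPoly c F (gFun c E)
    = gPoly c E (gFun c E) + (F - E) * (gFun c E * (2 * c + 1) - 2 * c) := by
    unfold gPoly; ring
  rw [this, h0, zero_add]
  exact mul_pos (by linarith) (by linarith)

theorem continuous_gFun : Continuous (fun p : ℝ × ℝ => gFun p.1 p.2) := by
  unfold gFun; fun_prop

theorem gFun_eFun_strictAntiOn {c : ℝ} (hc : 0 < c) :
    StrictAntiOn (fun z => gFun c (eFun z)) (Ioi 0) := fun _ hx _ hy hxy =>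
  gFun_strictAntiOn hc (eFun_pos hx) (eFun_pos hy) (eFun_strictMonoOn hx hy hxy)

theorem continuousOn_gFun_eFun (c : ℝ) : ContinuousOn (fun z => gFun c (eFun z)) (Ioi 0) :=
  continuous_gFun.comp_continuousOn (continuousOn_const.prodMk continuousOn_eFun)

/-! ### Monotonicity and zeros of the marginal gain of reinsurer 1. -/

/-- The sign of the marginal gain of reinsurer 1 from raising the loading `x` when reinsurer 2
charges `y`, as an explicit function. -/
noncomputable def slope1 (k k1 β x y : ℝ) : ℝ :=
  k1 / x - gFun (k1 / k) (eFun (β * y * (1 / k + 1 / (2 * x))))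

/-- The unconstrained best response of reinsurer 2 to the loading `x` of reinsurer 1. -/
noncomputable def bestReply2 (k k2 β x : ℝ) : ℝ :=
  k / β * (1 + k2 / k - k / (k + 2 * x))

section Slope

variable {k k1 k2 β : ℝ}

/-- Both terms push the same way: a larger `x` lowers `k1 / x`, and it lowers the argument of
`eFun`, which raises `gFun`. -/
theorem slope1_lt_slope1_left (hk : 0 < k) (hk1 : 0 < k1) (hβ : 0 < β) {x x' y : ℝ} (hx : 0 < x)
    (hxx : x < x') (hy : 0 < y) : slope1 k k1 β x' y < slope1 k k1 β x y := by
  unfold slope1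
  have hx' : 0 < x' := hx.trans hxx
  have h1 : k1 / x' < k1 / x := div_lt_div_of_pos_left hk1 hx hxx
  have h2 : 1 / (2 * x') < 1 / (2 * x) := div_lt_div_of_pos_left one_pos (by linarith) (by linarith)
  have h3 : gFun (k1 / k) (eFun (β * y * (1 / k + 1 / (2 * x))))
      < gFun (k1 / k) (eFun (β * y * (1 / k + 1 / (2 * x')))) := by
    apply gFun_eFun_strictAntiOn (div_pos hk1 hk)
    · exact mem_Ioi.2 (by positivity)
    · exact mem_Ioi.2 (by positivity)
    · exact mul_lt_mul_of_pos_left (by linarith) (by positivity)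
  linarith

theorem slope1_strictAntiOn (hk : 0 < k) (hk1 : 0 < k1) (hβ : 0 < β) {y : ℝ} (hy : 0 < y) :
    StrictAntiOn (fun x => slope1 k k1 β x y) (Ioi 0) :=
  fun _ hx _ _ hxx => slope1_lt_slope1_left hk hk1 hβ hx hxx hy

theorem slope1_strictMonoOn (hk : 0 < k) (hk1 : 0 < k1) (hβ : 0 < β) {x : ℝ} (hx : 0 < x) :
    StrictMonoOn (fun y => slope1 k k1 β x y) (Ioi 0) := by
  intro y hy y' hy' hyy
  have hy : 0 < y := hy
  have hy' : 0 < y' := hy'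
  simp only [slope1]
  have h3 : gFun (k1 / k) (eFun (β * y' * (1 / k + 1 / (2 * x))))
      < gFun (k1 / k) (eFun (β * y * (1 / k + 1 / (2 * x)))) := by
    apply gFun_eFun_strictAntiOn (div_pos hk1 hk)
    · exact mem_Ioi.2 (by positivity)
    · exact mem_Ioi.2 (by positivity)
    · exact mul_lt_mul_of_pos_right (mul_lt_mul_of_pos_left hyy hβ) (by positivity)
  linarith

/-- At `x = k1` the quotient `k1 / x` equals the upper bound `1` of `gFun`. At `x = k1 + k / 2` it
equals the lower bound `2c / (2c + 1)` with `c = k1 / k`. So the interval between these two points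
contains the root for every `y`. -/
theorem slope1_pos_at_left (hk : 0 < k) (hk1 : 0 < k1) (hβ : 0 < β) {y : ℝ} (hy : 0 < y) :
    0 < slope1 k k1 β k1 y := by
  have := gFun_lt_one (div_pos hk1 hk)
    (eFun_pos (x := β * y * (1 / k + 1 / (2 * k1))) (by positivity))
  unfold slope1
  rw [div_self hk1.ne']
  linarith

theorem slope1_neg_at_right (hk : 0 < k) (hk1 : 0 < k1) (hβ : 0 < β) {y : ℝ} (hy : 0 < y) :
    slope1 k k1 β (k1 + k / 2) y < 0 := by
  have := lt_gFun (div_pos hk1 hk)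
    (eFun_pos (x := β * y * (1 / k + 1 / (2 * (k1 + k / 2)))) (by positivity))
  have h2 : k1 / (k1 + k / 2) = 2 * (k1 / k) / (2 * (k1 / k) + 1) := by field_simp
  unfold slope1
  linarith

theorem continuousOn_slope1_comp (hk : 0 < k) (hβ : 0 < β) {f : ℝ → ℝ}
    (hf : ContinuousOn f (Ioi 0)) (hpos : ∀ x, 0 < x → 0 < f x) :
    ContinuousOn (fun x => slope1 k k1 β x (f x)) (Ioi 0) := by
  unfold slope1
  have hinv : ContinuousOn (fun x : ℝ => 1 / (2 * x)) (Ioi 0) := by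
    intro x hx
    have : 2 * x ≠ 0 := by have : 0 < x := hx; positivity
    exact ContinuousAt.continuousWithinAt (by fun_prop (disch := assumption))
  have hdiv : ContinuousOn (fun x : ℝ => k1 / x) (Ioi 0) := by
    intro x hx
    have : x ≠ 0 := ne_of_gt hx
    exact ContinuousAt.continuousWithinAt (by fun_prop (disch := assumption))
  refine hdiv.sub ((continuousOn_gFun_eFun (k1 / k)).comp
    ((continuousOn_const.mul hf).mul (continuousOn_const.add hinv)) ?_)
  intro x hx
  have hx : 0 < x := hx
  have := hpos x hx
  exact mem_Ioi.2 (by positivity)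

theorem exists_root_of_antitone {s : ℝ → ℝ} {a b : ℝ} (ha : 0 < a) (hab : a < b)
    (hc : ContinuousOn s (Ioi 0)) (hsa : 0 < s a) (hsb : s b < 0) : ∃ x, 0 < x ∧ s x = 0 := by
  have := intermediate_value_Icc' hab.le (hc.mono fun x hx => mem_Ioi.2 (ha.trans_le hx.1))
  obtain ⟨x, hx, h⟩ := this ⟨hsb.le, hsa.le⟩
  exact ⟨x, ha.trans_le hx.1, h⟩

theorem exists_slope1_eq_zero (hk : 0 < k) (hk1 : 0 < k1) (hβ : 0 < β) {y : ℝ} (hy : 0 < y) :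
    ∃ x, 0 < x ∧ slope1 k k1 β x y = 0 :=
  exists_root_of_antitone (a := k1) (b := k1 + k / 2) hk1 (by linarith)
    (continuousOn_slope1_comp hk hβ continuousOn_const fun _ _ => hy)
    (slope1_pos_at_left hk hk1 hβ hy) (slope1_neg_at_right hk hk1 hβ hy)

theorem bestReply2_eq (hk : 0 < k) (hβ : 0 < β) {x : ℝ} (hx : 0 < x) :
    bestReply2 k k2 β x = k2 / β + 1 / (β * (1 / k + 1 / (2 * x))) := by
  unfold bestReply2; field_simp; ring

theorem bestReply2_pos (hk : 0 < k) (hk2 : 0 < k2) (hβ : 0 < β) {x : ℝ} (hx : 0 < x) :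
    0 < bestReply2 k k2 β x := by
  rw [bestReply2_eq hk hβ hx]; positivity

/-- With `m = 1 / k + 1 / (2 * x)` the best reply `y` satisfies `β * m * y = 1 + k2 * m`. The best
reply increases with `x`, yet the argument of `eFun` along its graph decreases. Thus `slope1` stays
strictly decreasing there, and this carries existence and uniqueness of the equilibrium. -/
theorem slope1_bestReply2 (hk : 0 < k) (hβ : 0 < β) {x : ℝ} (hx : 0 < x) :
    slope1 k k1 β x (bestReply2 k k2 β x)
      = k1 / x - gFun (k1 / k) (eFun (1 + k2 * (1 / k + 1 / (2 * x)))) := by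
  unfold slope1
  rw [bestReply2_eq hk hβ hx]
  congr 3
  field_simp
  ring

theorem slope1_bestReply2_strictAntiOn (hk : 0 < k) (hk1 : 0 < k1) (hk2 : 0 < k2) (hβ : 0 < β) :
    StrictAntiOn (fun x => slope1 k k1 β x (bestReply2 k k2 β x)) (Ioi 0) := by
  intro x hx x' hx' hxx
  have hx : 0 < x := hx
  have hx' : 0 < x' := hx'
  simp only
  rw [slope1_bestReply2 hk hβ hx, slope1_bestReply2 hk hβ hx']
  have h1 : k1 / x' < k1 / x := div_lt_div_of_pos_left hk1 hx hxx
  have h2 : 1 / (2 * x') < 1 / (2 * x) := div_lt_div_of_pos_left one_pos (by linarith) (by linarith)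
  have h3 : gFun (k1 / k) (eFun (1 + k2 * (1 / k + 1 / (2 * x))))
      < gFun (k1 / k) (eFun (1 + k2 * (1 / k + 1 / (2 * x')))) := by
    apply gFun_eFun_strictAntiOn (div_pos hk1 hk)
    · exact mem_Ioi.2 (by positivity)
    · exact mem_Ioi.2 (by positivity)
    · have := mul_lt_mul_of_pos_left h2 hk2
      linarith
  linarith

theorem exists_slope1_bestReply2_eq_zero (hk : 0 < k) (hk1 : 0 < k1) (hk2 : 0 < k2)
    (hβ : 0 < β) : ∃ x, 0 < x ∧ slope1 k k1 β x (bestReply2 k k2 β x) = 0 := by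
  refine exists_root_of_antitone (a := k1) (b := k1 + k / 2) hk1 (by linarith)
    (continuousOn_slope1_comp hk hβ ?_ fun x hx => bestReply2_pos hk hk2 hβ hx)
    (slope1_pos_at_left hk hk1 hβ (bestReply2_pos hk hk2 hβ hk1))
    (slope1_neg_at_right hk hk1 hβ (bestReply2_pos hk hk2 hβ (by positivity)))
  intro x hx
  have hx : 0 < x := hx
  have : k + 2 * x ≠ 0 := by positivity
  unfold bestReply2
  exact ContinuousAt.continuousWithinAt (by fun_prop (disch := assumption))

end Slope

/-! ### Mutual best replies under bounds on the loadings. -/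

section FixedPoint

variable {k k1 k2 β a b c d : ℝ} {X : ℝ → ℝ} {b1 : ℝ}

theorem le_root_iff (hk : 0 < k) (hk1 : 0 < k1) (hβ : 0 < β) {x x₀ y : ℝ} (hx : 0 < x)
    (hx₀ : 0 < x₀) (hy : 0 < y) (h₀ : slope1 k k1 β x₀ y = 0) :
    x ≤ x₀ ↔ 0 ≤ slope1 k k1 β x y := by
  rw [← h₀]
  exact ((slope1_strictAntiOn hk hk1 hβ hy).le_iff_ge hx₀ hx).symm

theorem root_le_iff (hk : 0 < k) (hk1 : 0 < k1) (hβ : 0 < β) {x x₀ y : ℝ} (hx : 0 < x)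
    (hx₀ : 0 < x₀) (hy : 0 < y) (h₀ : slope1 k k1 β x₀ y = 0) :
    x₀ ≤ x ↔ slope1 k k1 β x y ≤ 0 := by
  rw [← h₀]
  exact ((slope1_strictAntiOn hk hk1 hβ hy).le_iff_ge hx hx₀).symm

/-- The formula for the constrained equilibrium yields a pair of mutual best replies. -/
theorem constrained_fixed_point (hk : 0 < k) (hk1 : 0 < k1) (hk2 : 0 < k2) (hβ : 0 < β)
    (ha : 0 < a) (hab : a ≤ b) (hc : 0 < c) (hcd : c ≤ d)
    (hX : ∀ y, 0 < y → 0 < X y ∧ slope1 k k1 β (X y) y = 0)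
    (hb1 : 0 < b1) (hb1' : slope1 k k1 β b1 (bestReply2 k k2 β b1) = 0) {y : ℝ}
    (hy : y = if b1 < a then max c (min (bestReply2 k k2 β a) d)
      else if b1 ≤ b then max c (min (bestReply2 k k2 β b1) d)
      else max c (min (bestReply2 k k2 β b) d)) :
    y = max c (min (bestReply2 k k2 β (max a (min (X y) b))) d) := by
  set h := bestReply2 k k2 β with hh
  have hpos : ∀ x, 0 < x → 0 < h x := fun x hx => bestReply2_pos hk hk2 hβ hx
  have hr := slope1_bestReply2_strictAntiOn (k := k) (k1 := k1) (k2 := k2) (β := β) hk hk1 hk2 hβ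
  have hle : ∀ x, 0 < x → (x ≤ b1 ↔ 0 ≤ slope1 k k1 β x (h x)) := fun x hx => by
    rw [← hb1']; exact (hr.le_iff_ge hb1 hx).symm
  have hge : ∀ x, 0 < x → (b1 ≤ x ↔ slope1 k k1 β x (h x) ≤ 0) := fun x hx => by
    rw [← hb1']; exact (hr.le_iff_ge hx hb1).symm
  have hm : ∀ x y y', 0 < x → 0 < y → 0 < y' →
      (slope1 k k1 β x y ≤ slope1 k k1 β x y' ↔ y ≤ y') := fun x y y' hx hy hy' =>
    (slope1_strictMonoOn hk hk1 hβ hx).le_iff_le hy hy'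
  have hy0 : 0 < y := by
    rw [hy]; split_ifs <;> exact lt_of_lt_of_le hc (le_max_left _ _)
  obtain ⟨hX0, hX1⟩ := hX y hy0
  have hXle : ∀ x, 0 < x → (x ≤ X y ↔ 0 ≤ slope1 k k1 β x y) := fun x hx =>
    le_root_iff hk hk1 hβ hx hX0 hy0 hX1
  have hXge : ∀ x, 0 < x → (X y ≤ x ↔ slope1 k k1 β x y ≤ 0) := fun x hx =>
    root_le_iff hk hk1 hβ hx hX0 hy0 hX1
  -- `F1` to `F4` share one argument. The sign of `slope1` at `(x, h x)` is fixed by the position of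
  -- `x` relative to `b1`, the sign at `(x, y)` by its position relative to `X y`, and monotonicity
  -- in the second variable compares the two.
  have F1 : ∀ x, 0 < x → y ≤ h x → b1 ≤ x → X y ≤ x := fun x hx h1 h2 =>
    (hXge x hx).2 (((hm x y _ hx hy0 (hpos x hx)).2 h1).trans ((hge x hx).1 h2))
  have F2 : ∀ x, 0 < x → h x ≤ y → x ≤ b1 → x ≤ X y := fun x hx h1 h2 =>
    (hXle x hx).2 (((hle x hx).1 h2).trans ((hm x _ y hx (hpos x hx) hy0).2 h1))
  have F3 : ∀ x, 0 < x → x ≤ X y → b1 ≤ x → h x ≤ y := fun x hx h1 h2 =>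
    (hm x _ y hx (hpos x hx) hy0).1 (((hge x hx).1 h2).trans ((hXle x hx).1 h1))
  have F4 : ∀ x, 0 < x → X y ≤ x → x ≤ b1 → y ≤ h x := fun x hx h1 h2 =>
    (hm x y _ hx hy0 (hpos x hx)).1 (((hXge x hx).1 h1).trans ((hle x hx).1 h2))
  have hb : 0 < b := ha.trans_le hab
  set x := max a (min (X y) b) with hx
  have hx0 : 0 < x := ha.trans_le (le_max_left _ _)
  have hxb : x ≤ b := max_le hab (min_le_right _ _)
  have hax : a ≤ x := le_max_left _ _
  have hxX : x = a ∨ x ≤ X y := by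
    rcases le_total a (min (X y) b) with h' | h'
    · right; rw [hx, max_eq_right h']; exact min_le_left _ _
    · left; rw [hx, max_eq_left h']
  have hXx : x = b ∨ X y ≤ x := by
    rcases le_total (X y) b with h' | h'
    · right; rw [hx, min_eq_left h']; exact le_max_right _ _
    · left; rw [hx, min_eq_right h', max_eq_right hab]
  have clamp_of_le : ∀ u, u ≤ c → max c (min u d) = c := fun u hu =>
    max_eq_left ((min_le_left _ _).trans hu)
  have clamp_of_ge : ∀ u, d ≤ u → max c (min u d) = d := fun u hu => by
    rw [min_eq_right hu, max_eq_right hcd]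
  -- In each regime there are two possibilities. Either the truncation of `y` leaves `X y` on a side
  -- where `x` is known exactly, or `y` sits at the bound `c` or `d`, and then one inequality for `h
  -- x` suffices because the truncation absorbs the rest.
  split_ifs at hy with hlt hmid
  · rcases le_or_gt c (h a) with h1 | h1
    · have h2 : X y ≤ a :=
        F1 a ha (by rw [hy]; exact max_le h1 (min_le_left _ _)) hlt.le
      have h3 : x = a := by rw [hx]; exact max_eq_left ((min_le_left _ _).trans h2)
      rw [h3]; exact hy
    · have hyc : y = c := hy.trans (clamp_of_le _ h1.le)
      rcases hxX with h3 | h3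
      · rw [h3]; exact hy
      · have := F3 x hx0 h3 (hlt.le.trans hax)
        rw [clamp_of_le _ (this.trans_eq hyc), hyc]
  · rcases le_or_gt c (h b1) with h1 | h1
    · rcases le_or_gt (h b1) d with h2 | h2
      · have hyh : y = h b1 := by rw [hy, min_eq_left h2, max_eq_right h1]
        have h3 : X y = b1 := le_antisymm (F1 b1 hb1 hyh.le le_rfl) (F2 b1 hb1 hyh.ge le_rfl)
        have h4 : x = b1 := by rw [hx, h3, min_eq_left hmid, max_eq_right (not_lt.1 hlt)]
        rw [h4]; exact hy
      · have hyd : y = d := hy.trans (clamp_of_ge _ h2.le)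
        have h3 : X y ≤ b1 := F1 b1 hb1 (by rw [hyd]; exact h2.le) le_rfl
        have h4 : X y ≤ x := by rw [hx, min_eq_left (h3.trans hmid)]; exact le_max_right _ _
        have h5 : x ≤ b1 := by rw [hx]; exact max_le (not_lt.1 hlt) ((min_le_left _ _).trans h3)
        have := F4 x hx0 h4 h5
        rw [clamp_of_ge _ (hyd.symm.trans_le this), hyd]
    · have hyc : y = c := hy.trans (clamp_of_le _ h1.le)
      have h3 : b1 ≤ X y := F2 b1 hb1 (by rw [hyc]; exact h1.le) le_rfl
      have h4 : x ≤ X y := by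
        rw [hx]; exact max_le ((not_lt.1 hlt).trans h3) (min_le_left _ _)
      have h5 : b1 ≤ x := by rw [hx]; exact (le_min h3 hmid).trans (le_max_right _ _)
      have := F3 x hx0 h4 h5
      rw [clamp_of_le _ (this.trans_eq hyc), hyc]
  · have hbb : b ≤ b1 := (not_le.1 hmid).le
    rcases le_or_gt (h b) d with h1 | h1
    · have h2 : b ≤ X y :=
        F2 b hb (by rw [hy, min_eq_left h1]; exact le_max_right _ _) hbb
      have h3 : x = b := by rw [hx, min_eq_right h2, max_eq_right hab]
      rw [h3]; exact hy
    · have hyd : y = d := hy.trans (clamp_of_ge _ h1.le)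
      rcases hXx with h3 | h3
      · rw [h3]; exact hy
      · have := F4 x hx0 h3 (hxb.trans hbb)
        rw [clamp_of_ge _ (hyd.symm.trans_le this), hyd]

/-- Suppose `x < x'`. Then `x` is not cut off from above and `x'` not from below, so `slope1` is `≤
0` at `(x, y)` and `≥ 0` at `(x', y')`. This forces `y < y'`, hence `bestReply2` is at most `y` at
`x` and at least `y'` at `x'`. Along the graph of `bestReply2`, `slope1` would then fail to decrease
from `x` to `x'`. -/
theorem constrained_fixed_point_unique (hk : 0 < k) (hk1 : 0 < k1) (hk2 : 0 < k2) (hβ : 0 < β)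
    (ha : 0 < a) (hc : 0 < c) (hcd : c ≤ d)
    (hX : ∀ y, 0 < y → 0 < X y ∧ slope1 k k1 β (X y) y = 0) {x y x' y' : ℝ}
    (hx : x = max a (min (X y) b)) (hy : y = max c (min (bestReply2 k k2 β x) d))
    (hx' : x' = max a (min (X y') b)) (hy' : y' = max c (min (bestReply2 k k2 β x') d)) :
    x = x' ∧ y = y' := by
  have key : ∀ x y x' y', x = max a (min (X y) b) → y = max c (min (bestReply2 k k2 β x) d) →
      x' = max a (min (X y') b) → y' = max c (min (bestReply2 k k2 β x') d) → ¬ x < x' := by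
    intro x y x' y' hx hy hx' hy' hlt
    have hx0 : 0 < x := by rw [hx]; exact ha.trans_le (le_max_left _ _)
    have hx0' : 0 < x' := hx0.trans hlt
    have hy0 : 0 < y := by rw [hy]; exact hc.trans_le (le_max_left _ _)
    have hy0' : 0 < y' := by rw [hy']; exact hc.trans_le (le_max_left _ _)
    obtain ⟨p1, p2⟩ := hX y hy0
    obtain ⟨p1', p2'⟩ := hX y' hy0'
    have hXx : X y ≤ x := by grind
    have hXx' : x' ≤ X y' := by grind
    have s1 := (root_le_iff hk hk1 hβ hx0 p1 hy0 p2).1 hXx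
    have s2 := (le_root_iff hk hk1 hβ hx0' p1' hy0' p2').1 hXx'
    have s3 := slope1_lt_slope1_left hk hk1 hβ hx0 hlt hy0
    have hyy : y < y' := by
      rw [← (slope1_strictMonoOn hk hk1 hβ hx0').lt_iff_lt hy0 hy0']
      linarith
    have h1 : y' ≤ bestReply2 k k2 β x' := by grind
    have h2 : bestReply2 k k2 β x ≤ y := by grind
    have r1 := ((slope1_strictMonoOn hk hk1 hβ hx0').le_iff_le hy0'
      (bestReply2_pos hk hk2 hβ hx0')).2 h1
    have r2 := ((slope1_strictMonoOn hk hk1 hβ hx0).le_iff_le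
      (bestReply2_pos hk hk2 hβ hx0) hy0).2 h2
    have r3 := slope1_bestReply2_strictAntiOn hk hk1 hk2 hβ hx0 hx0' hlt
    simp only at r1 r2 r3
    linarith
  have hxx : x = x' := le_antisymm (not_lt.1 (key x' y' x y hx' hy' hx hy))
    (not_lt.1 (key x y x' y' hx hy hx' hy'))
  exact ⟨hxx, by rw [hy, hy', hxx]⟩

end FixedPoint

/-! ### Unimodality of the reinsurers' payoffs. -/

section Payoff

/-- A function that increases up to `m` and decreases afterwards is maximal on `[a, b]` exactly at
the truncation of `m`. -/
theorem lt_of_unimodal {f : ℝ → ℝ} {m a b x : ℝ} (hmono : StrictMonoOn f (Ioc 0 m))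
    (hanti : StrictAntiOn f (Ici m)) (ha : 0 < a) (hx : x ∈ Icc a b)
    (hne : x ≠ max a (min m b)) : f x < f (max a (min m b)) := by
  obtain ⟨h1, h2⟩ := hx
  rcases le_total m a with h | h
  · have e : max a (min m b) = a := max_eq_left ((min_le_left _ _).trans h)
    rw [e] at hne ⊢
    exact hanti (mem_Ici.2 h) (mem_Ici.2 (h.trans h1)) (lt_of_le_of_ne h1 (Ne.symm hne))
  rcases le_total m b with h' | h'
  · have e : max a (min m b) = m := by rw [min_eq_left h', max_eq_right h]
    rw [e] at hne ⊢
    rcases lt_or_gt_of_ne hne with h3 | h3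
    · exact hmono ⟨ha.trans_le h1, h3.le⟩ ⟨ha.trans_le h, le_rfl⟩ h3
    · exact hanti self_mem_Ici (mem_Ici.2 h3.le) h3
  · have e : max a (min m b) = b := by rw [min_eq_right h', max_eq_right (h1.trans h2)]
    rw [e] at hne ⊢
    exact hmono ⟨ha.trans_le h1, h2.trans h'⟩ ⟨ha.trans_le (h1.trans h2), h'⟩
      (lt_of_le_of_ne h2 hne)

theorem unimodal_of_hasDerivAt {f f' : ℝ → ℝ} {m : ℝ} (hm : 0 < m)
    (hf : ∀ x, 0 < x → HasDerivAt f (f' x) x) (hpos : ∀ x, 0 < x → x < m → 0 < f' x)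
    (hneg : ∀ x, m < x → f' x < 0) : StrictMonoOn f (Ioc 0 m) ∧ StrictAntiOn f (Ici m) := by
  constructor
  · apply strictMonoOn_of_deriv_pos (convex_Ioc 0 m)
      fun x hx => (hf x hx.1).continuousAt.continuousWithinAt
    intro x hx
    rw [interior_Ioc] at hx
    rw [(hf x hx.1).deriv]; exact hpos x hx.1 hx.2
  · apply strictAntiOn_of_deriv_neg (convex_Ici m)
      fun x hx => (hf x (hm.trans_le hx)).continuousAt.continuousWithinAt
    intro x hx
    rw [interior_Ici] at hx
    rw [(hf x (hm.trans hx)).deriv]; exact hneg x hx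

/-- The payoff rate of reinsurer 1, up to a constant factor. -/
noncomputable def payoff1 (k k1 β x y : ℝ) : ℝ :=
  (x - k1 / 2) * (k / (k + 2 * x)) ^ 2 *
    (1 - Real.exp (-(β * y * (1 / k + 1 / (2 * x)))) * (1 + β * y * (1 / k + 1 / (2 * x))))

/-- The payoff rate of reinsurer 2, up to a constant factor. -/
noncomputable def payoff2 (k k2 β x y : ℝ) : ℝ :=
  Real.exp (-(β * (1 / k + 1 / (2 * x)) * y)) * (y - k2 / β)

variable {k k1 k2 β : ℝ}

/-- The origin of `e` and `g`: apart from a positive factor the derivative is a quadratic in `k1 /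
x` with coefficients depending on `eFun z`, and `gFun` is its positive root. The derivative
therefore has the sign of `slope1`. -/
theorem hasDerivAt_payoff1 (hk : 0 < k) (hk1 : 0 < k1) (hβ : 0 < β) {x y : ℝ} (hx : 0 < x)
    (hy : 0 < y) :
    HasDerivAt (fun x => payoff1 k k1 β x y)
      (Real.exp (-(β * y * (1 / k + 1 / (2 * x)))) * (β * y * (1 / k + 1 / (2 * x))) ^ 2 * x
        * k ^ 3 / (2 * k1 * (k + 2 * x) ^ 3)
        * gPoly (k1 / k) (eFun (β * y * (1 / k + 1 / (2 * x)))) (k1 / x)) x := by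
  set z := β * y * (1 / k + 1 / (2 * x)) with hz
  have hz0 : 0 < z := by positivity
  have d1 : HasDerivAt (fun x : ℝ => x - k1 / 2) 1 x := (hasDerivAt_id x).sub_const _
  have d2 : HasDerivAt (fun x : ℝ => (k / (k + 2 * x)) ^ 2) (-(4 * k ^ 2 / (k + 2 * x) ^ 3)) x := by
    have h1 : HasDerivAt (fun x : ℝ => k + 2 * x) (2 * 1) x :=
      ((hasDerivAt_id x).const_mul 2).const_add k
    have h2 := ((hasDerivAt_const x k).div h1 (by positivity)).pow 2
    convert! h2 using 1
    simp; field_simp; ring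
  have d3 : HasDerivAt (fun x : ℝ => β * y * (1 / k + 1 / (2 * x))) (-(β * y / (2 * x ^ 2))) x := by
    have h1 : HasDerivAt (fun x : ℝ => 2 * x) (2 * 1) x := (hasDerivAt_id x).const_mul 2
    have h2 := (((hasDerivAt_const x (1 : ℝ)).div h1 (by positivity)).const_add (1 / k)).const_mul
      (β * y)
    convert! h2 using 1
    field_simp; ring
  have d4 := ((d3.neg.exp.mul (d3.const_add 1)).const_sub 1)
  have d5 := (d1.mul d2).mul d4
  convert! d5 using 1
  simp only [← hz, Pi.neg_apply, Pi.mul_apply]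
  -- The definition of `eFun`, solved for the exponential. It pulls `exp (-z)` out of `1 - exp (-z)
  -- * (1 + z)` as a factor, and `hy2` eliminates `β * y`. With `exp (-z)`, `eFun z` and `z` as free
  -- variables a rational identity remains.
  have hE : Real.exp z = 1 + z + z ^ 2 * (eFun z + 1) / 2 := by
    rw [eFun_add_one_eq hz0]; field_simp; ring
  have hE2 : (1 : ℝ) = Real.exp (-z) * (1 + z + z ^ 2 * (eFun z + 1) / 2) := by
    rw [← hE, ← Real.exp_add]; simp
  have hy2 : β * y = 2 * k * x * z / (k + 2 * x) := by rw [hz]; field_simp; ring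
  rw [hy2]
  have h1 : 1 - Real.exp (-z) * (1 + z) = Real.exp (-z) * (z ^ 2 * (eFun z + 1) / 2) := by
    linear_combination hE2
  rw [h1]
  unfold gPoly
  generalize Real.exp (-z) = w
  generalize eFun z = E
  clear_value z
  field_simp
  ring

theorem payoff1_unimodal (hk : 0 < k) (hk1 : 0 < k1) (hβ : 0 < β) {x₀ y : ℝ} (hx₀ : 0 < x₀)
    (hy : 0 < y) (h₀ : slope1 k k1 β x₀ y = 0) :
    StrictMonoOn (fun x => payoff1 k k1 β x y) (Ioc 0 x₀) ∧
      StrictAntiOn (fun x => payoff1 k k1 β x y) (Ici x₀) := by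
  refine unimodal_of_hasDerivAt hx₀ (fun x hx => hasDerivAt_payoff1 hk hk1 hβ hx hy) ?_ ?_
  · intro x hx hlt
    have h1 : 0 < slope1 k k1 β x y := h₀ ▸ slope1_lt_slope1_left hk hk1 hβ hx hlt hy
    apply mul_pos (by positivity)
    rw [gPoly_pos_iff (by positivity) (eFun_pos (by positivity)) (by positivity)]
    unfold slope1 at h1; linarith
  · intro x hlt
    have hx : 0 < x := hx₀.trans hlt
    have h1 : slope1 k k1 β x y < 0 := h₀ ▸ slope1_lt_slope1_left hk hk1 hβ hx₀ hlt hy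
    apply mul_neg_of_pos_of_neg (by positivity)
    rw [gPoly_neg_iff (by positivity) (eFun_pos (by positivity)) (by positivity)]
    unfold slope1 at h1; linarith

/-- The derivative in `y` is a positive multiple of `bestReply2 k k2 β x - y`. -/
theorem payoff2_unimodal (hk : 0 < k) (hk2 : 0 < k2) (hβ : 0 < β) {x : ℝ} (hx : 0 < x) :
    StrictMonoOn (payoff2 k k2 β x) (Ioc 0 (bestReply2 k k2 β x)) ∧
      StrictAntiOn (payoff2 k k2 β x) (Ici (bestReply2 k k2 β x)) := by
  set m := 1 / k + 1 / (2 * x) with hm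
  have hm0 : 0 < m := by positivity
  have hroot := bestReply2_eq (k2 := k2) hk hβ hx
  rw [← hm] at hroot
  have heq : ∀ y, 1 - β * m * (y - k2 / β) = β * m * (bestReply2 k k2 β x - y) := by
    intro y; rw [hroot]; field_simp; ring
  refine unimodal_of_hasDerivAt
    (f' := fun y => Real.exp (-(β * m * y)) * (1 - β * m * (y - k2 / β)))
    (bestReply2_pos hk hk2 hβ hx) ?_ ?_ ?_
  · intro y _
    have d1 : HasDerivAt (fun y : ℝ => -(β * m * y)) (-(β * m * 1)) y :=
      ((hasDerivAt_id y).const_mul (β * m)).neg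
    have d2 := d1.exp.mul ((hasDerivAt_id y).sub_const (k2 / β))
    convert! d2 using 1
    simp; ring
  · intro y _ h
    rw [heq]; exact mul_pos (Real.exp_pos _) (mul_pos (by positivity) (by linarith))
  · intro y h
    rw [heq]
    exact mul_neg_of_pos_of_neg (Real.exp_pos _) (mul_neg_of_pos_of_neg (by positivity) (by linarith))

end Payoff

/-! ### Moments of exponential claims and of their layers. -/

section Exponential

variable {β : ℝ}

theorem expMeasure_eq_withDensity (β : ℝ) : expMeasure β =
    (volume.restrict (Ioi 0)).withDensity (fun y => ENNReal.ofReal (β * Real.exp (-(β * y)))) := by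
  rw [← withDensity_indicator measurableSet_Ioi]
  refine withDensity_congr_ae ?_
  have : ∀ᵐ y : ℝ, y ≠ 0 := by simp [ae_iff, measure_singleton]
  filter_upwards [this] with y hy
  change exponentialPDF β y = _
  rw [exponentialPDF_eq]
  rcases lt_or_gt_of_ne hy with h | h
  · simp [h.not_gt, h.not_ge]
  · simp [h, h.le]

theorem integrable_expMeasure_iff (hβ : 0 < β) {f : ℝ → ℝ} : Integrable f (expMeasure β) ↔
    IntegrableOn (fun y => β * Real.exp (-(β * y)) * f y) (Ioi 0) := by
  rw [expMeasure_eq_withDensity, integrable_withDensity_iff_integrable_smul' (by fun_prop)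
    (by simp)]
  refine integrable_congr (ae_of_all _ fun y => ?_)
  simp only [smul_eq_mul]
  rw [ENNReal.toReal_ofReal (by positivity)]

theorem integral_expMeasure (hβ : 0 < β) (f : ℝ → ℝ) : ∫ y, f y ∂(expMeasure β) =
    ∫ y in Ioi 0, β * Real.exp (-(β * y)) * f y := by
  rw [expMeasure_eq_withDensity, integral_withDensity_eq_integral_toReal_smul₀ (by fun_prop)
    (by simp)]
  refine integral_congr_ae (ae_of_all _ fun y => ?_)
  simp only [smul_eq_mul]
  rw [ENNReal.toReal_ofReal (by positivity)]

theorem ae_expMeasure_pos (β : ℝ) : ∀ᵐ y ∂(expMeasure β), 0 < y := by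
  rw [expMeasure_eq_withDensity]
  exact (withDensity_absolutelyContinuous _ _).ae_le (ae_restrict_mem measurableSet_Ioi)

theorem tendsto_pow_mul_exp_neg_mul (hβ : 0 < β) (n : ℕ) :
    Tendsto (fun y : ℝ => y ^ n * Real.exp (-(β * y))) atTop (𝓝 0) := by
  have := (isLittleO_pow_exp_pos_mul_atTop n hβ).tendsto_div_nhds_zero
  refine this.congr fun y => ?_
  rw [Real.exp_neg, div_eq_mul_inv]

theorem excess_indicator (d : ℝ) (n : ℕ) (hn : n ≠ 0) (y : ℝ) :
    β * Real.exp (-(β * y)) * max (y - d) 0 ^ n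
      = (Ioi d).indicator (fun y => β * Real.exp (-(β * y)) * (y - d) ^ n) y := by
  by_cases h : d < y
  · rw [indicator_of_mem (mem_Ioi.2 h), max_eq_left (by linarith)]
  · rw [indicator_of_notMem (by simpa using h), max_eq_right (by linarith), zero_pow hn, mul_zero]

/-- `F` is the primitive of the integrand that vanishes at infinity, so the integral over `(d, ∞)`
is `-F d`. The integrand is nonnegative there, so convergence of `F` gives integrability as well.
For `n = 0` the convention `0 ^ 0 = 1` would spoil the indicator form. -/
theorem excess_moment (hβ : 0 < β) {d : ℝ} (hd : 0 ≤ d) {n : ℕ} (hn : n ≠ 0) {F : ℝ → ℝ}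
    (hF : ∀ y, HasDerivAt F (β * Real.exp (-(β * y)) * (y - d) ^ n) y)
    (hlim : Tendsto F atTop (𝓝 0)) :
    Integrable (fun y => max (y - d) 0 ^ n) (expMeasure β) ∧
      ∫ y, max (y - d) 0 ^ n ∂(expMeasure β) = - F d := by
  have hI : (Ioi 0 ∩ Ioi d : Set ℝ) = Ioi d := by rw [Ioi_inter_Ioi, max_eq_right hd]
  have hnn : ∀ y ∈ Ioi d, 0 ≤ β * Real.exp (-(β * y)) * (y - d) ^ n := by
    intro y hy
    have : 0 < y - d := sub_pos.2 hy
    positivity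
  constructor
  · rw [integrable_expMeasure_iff hβ]
    simp_rw [excess_indicator (β := β) d n hn]
    rw [IntegrableOn, integrable_indicator_iff measurableSet_Ioi, IntegrableOn,
      Measure.restrict_restrict measurableSet_Ioi, inter_comm, hI]
    exact integrableOn_Ioi_deriv_of_nonneg' (fun y _ => hF y) hnn hlim
  · rw [integral_expMeasure hβ]
    simp_rw [excess_indicator (β := β) d n hn]
    rw [setIntegral_indicator measurableSet_Ioi, hI,
      integral_Ioi_of_hasDerivAt_of_nonneg' (fun y _ => hF y) hnn hlim, zero_sub]

theorem excess_moment_one (hβ : 0 < β) {d : ℝ} (hd : 0 ≤ d) :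
    Integrable (fun y => max (y - d) 0) (expMeasure β) ∧
      ∫ y, max (y - d) 0 ∂(expMeasure β) = Real.exp (-(β * d)) / β := by
  have h := excess_moment hβ hd one_ne_zero
    (F := fun y => -((y - d + 1 / β) * Real.exp (-(β * y)))) ?_ ?_
  · simp only [pow_one] at h
    refine ⟨h.1, h.2.trans ?_⟩
    field_simp; ring
  · intro y
    have d1 : HasDerivAt (fun y : ℝ => -(β * y)) (-(β * 1)) y :=
      ((hasDerivAt_id y).const_mul β).neg
    have d2 := ((((hasDerivAt_id y).sub_const d).add_const (1 / β)).mul d1.exp).neg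
    convert! d2 using 1
    simp; field_simp; ring
  · have h0 := tendsto_pow_mul_exp_neg_mul hβ 0
    have h1 := tendsto_pow_mul_exp_neg_mul hβ 1
    have := (h1.add (h0.const_mul (-d + 1 / β))).neg
    simp only [mul_zero, add_zero, neg_zero] at this
    refine this.congr fun y => ?_
    ring

theorem excess_moment_two (hβ : 0 < β) {d : ℝ} (hd : 0 ≤ d) :
    Integrable (fun y => max (y - d) 0 ^ 2) (expMeasure β) ∧
      ∫ y, max (y - d) 0 ^ 2 ∂(expMeasure β) = 2 * Real.exp (-(β * d)) / β ^ 2 := by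
  have h := excess_moment hβ hd two_ne_zero
    (F := fun y => -(((y - d) ^ 2 + 2 / β * (y - d) + 2 / β ^ 2) * Real.exp (-(β * y)))) ?_ ?_
  · refine ⟨h.1, h.2.trans ?_⟩
    field_simp; ring
  · intro y
    have d1 : HasDerivAt (fun y : ℝ => -(β * y)) (-(β * 1)) y :=
      ((hasDerivAt_id y).const_mul β).neg
    have d0 : HasDerivAt (fun y : ℝ => y - d) 1 y := (hasDerivAt_id y).sub_const d
    have d2 := (((((d0.pow 2).add (d0.const_mul (2 / β))).add_const (2 / β ^ 2)).mul d1.exp)).neg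
    convert! d2 using 1
    simp; field_simp; ring
  · have h0 := tendsto_pow_mul_exp_neg_mul hβ 0
    have h1 := tendsto_pow_mul_exp_neg_mul hβ 1
    have h2 := tendsto_pow_mul_exp_neg_mul hβ 2
    have := ((h2.add (h1.const_mul (-2 * d + 2 / β))).add
      (h0.const_mul (d ^ 2 - 2 / β * d + 2 / β ^ 2))).neg
    simp only [mul_zero, add_zero, neg_zero] at this
    refine this.congr fun y => ?_
    ring

end Exponential

namespace Market

variable (M : Market)

instance : IsFiniteMeasure M.nu := by
  have := isProbabilityMeasure_expMeasure M.beta_pos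
  unfold nu
  exact Measure.smul_finite _ ENNReal.ofReal_ne_top

theorem integrable_nu {f : ℝ → ℝ} (hf : Integrable f (expMeasure M.beta)) : Integrable f M.nu :=
  hf.smul_measure ENNReal.ofReal_ne_top

theorem integral_nu (f : ℝ → ℝ) : ∫ y, f y ∂M.nu = M.lam * ∫ y, f y ∂(expMeasure M.beta) := by
  unfold nu
  rw [integral_smul_measure, ENNReal.toReal_ofReal M.lam_pos.le, smul_eq_mul]

theorem ae_nu_pos : ∀ᵐ y ∂M.nu, 0 < y :=
  (ae_expMeasure_pos M.beta).filter_mono (Measure.ae_smul_measure_le _)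

theorem integrable_excess {d : ℝ} (hd : 0 ≤ d) : Integrable (fun y => max (y - d) 0) M.nu :=
  M.integrable_nu (excess_moment_one M.beta_pos hd).1

theorem integrable_excess_sq {d : ℝ} (hd : 0 ≤ d) :
    Integrable (fun y => max (y - d) 0 ^ 2) M.nu :=
  M.integrable_nu (excess_moment_two M.beta_pos hd).1

theorem integral_excess {d : ℝ} (hd : 0 ≤ d) :
    ∫ y, max (y - d) 0 ∂M.nu = M.lam * (Real.exp (-(M.beta * d)) / M.beta) := by
  rw [integral_nu, (excess_moment_one M.beta_pos hd).2]

theorem integral_excess_sq {d : ℝ} (hd : 0 ≤ d) :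
    ∫ y, max (y - d) 0 ^ 2 ∂M.nu = M.lam * (2 * Real.exp (-(M.beta * d)) / M.beta ^ 2) := by
  rw [integral_nu, (excess_moment_two M.beta_pos hd).2]

theorem integrable_id_nu : Integrable (fun y => y) M.nu :=
  (M.integrable_excess le_rfl).congr (M.ae_nu_pos.mono fun y hy => by simp [hy.le])

theorem integrable_sq_nu : Integrable (fun y => y ^ 2) M.nu :=
  (M.integrable_excess_sq le_rfl).congr (M.ae_nu_pos.mono fun y hy => by simp [hy.le])

theorem integral_sq_nu : ∫ y, y ^ 2 ∂M.nu = M.lam * (2 / M.beta ^ 2) := by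
  have := M.integral_excess_sq le_rfl
  simp only [mul_zero, neg_zero, Real.exp_zero, mul_one, sub_zero] at this
  rw [← this]
  exact integral_congr_ae (M.ae_nu_pos.mono fun y hy => by simp [hy.le])

theorem integral_min_sq {d : ℝ} (hd : 0 ≤ d) :
    ∫ y, min y d ^ 2 ∂M.nu = M.lam * (2 / M.beta ^ 2) *
      (1 - Real.exp (-(M.beta * d)) * (1 + M.beta * d)) := by
  have h : ∀ y, min y d ^ 2 = y ^ 2 - max (y - d) 0 ^ 2 - 2 * d * max (y - d) 0 := by
    intro y
    rcases le_total y d with h | h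
    · rw [min_eq_left h, max_eq_right (by linarith)]; ring
    · rw [min_eq_right h, max_eq_left (by linarith)]; ring
  simp_rw [h]
  have e : Integrable (fun y => y ^ 2 - max (y - d) 0 ^ 2) M.nu :=
    M.integrable_sq_nu.sub (M.integrable_excess_sq hd)
  rw [integral_sub e ((M.integrable_excess hd).const_mul _), integral_sub M.integrable_sq_nu
    (M.integrable_excess_sq hd), integral_const_mul, integral_excess M hd, integral_excess_sq M hd,
    integral_sq_nu]
  have := M.beta_pos
  field_simp; ring

theorem integrable_of_le_id {f : ℝ → ℝ} (hf : AEStronglyMeasurable f M.nu)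
    (h : ∀ y, 0 ≤ y → 0 ≤ f y ∧ f y ≤ y) : Integrable f M.nu :=
  M.integrable_id_nu.mono' hf (M.ae_nu_pos.mono fun y hy => by
    rw [Real.norm_of_nonneg (h y hy.le).1]; exact (h y hy.le).2)

theorem integrable_sq_of_le_id {f : ℝ → ℝ} (hf : AEStronglyMeasurable f M.nu)
    (h : ∀ y, 0 ≤ y → 0 ≤ f y ∧ f y ≤ y) : Integrable (fun y => f y ^ 2) M.nu :=
  M.integrable_sq_nu.mono' (hf.pow 2) (M.ae_nu_pos.mono fun y hy => by
    rw [Real.norm_of_nonneg (sq_nonneg _)]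
    exact pow_le_pow_left₀ (h y hy.le).1 (h y hy.le).2 2)

end Market

/-! ### Splitting a single claim at least cost. -/

section Cost

/-- The loss rate of the insurer from a claim `y` of which `l1`, `l2` are ceded at the loadings
`x1`, `x2`. -/
noncomputable def cedingCost (k x1 x2 y l1 l2 : ℝ) : ℝ :=
  x1 * l1 ^ 2 + x2 * l2 + k / 2 * (y - l1 - l2) ^ 2

/-- The claim size above which reinsurer 2 is used. -/
noncomputable def retentionLevel (k x1 x2 : ℝ) : ℝ := x2 * (1 / k + 1 / (2 * x1))

/-- Quadratic expansion of the cost around the candidate. For `y ≥ d` the gradient vanishes and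
equality holds. For `y ≤ d` the candidate has `l2 = 0`, and the first-order term is a nonnegative
multiple of `l2`. The squares kept on the left make the minimizer unique. -/
theorem cedingCost_add_le {k x1 x2 y l1 l2 : ℝ} (hk : 0 < k) (h1 : 0 < x1)
    (hl2 : 0 ≤ l2) :
    cedingCost k x1 x2 y (k / (k + 2 * x1) * min y (retentionLevel k x1 x2))
        (max (y - retentionLevel k x1 x2) 0)
      + (x1 * (l1 - k / (k + 2 * x1) * min y (retentionLevel k x1 x2)) ^ 2
        + k / 2 * (l1 + l2 - k / (k + 2 * x1) * min y (retentionLevel k x1 x2)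
          - max (y - retentionLevel k x1 x2) 0) ^ 2)
      ≤ cedingCost k x1 x2 y l1 l2 := by
  set d := retentionLevel k x1 x2 with hd
  -- When only reinsurer 1 is used, optimally, the marginal cost of a claim of size `y` is `2 * x1 *
  -- k / (k + 2 * x1) * y`. The level `d` is where it reaches the price `x2` of reinsurer 2.
  have hd' : x2 = 2 * x1 * k / (k + 2 * x1) * d := by
    rw [hd, retentionLevel]; field_simp; ring
  rcases le_total y d with h | h
  · rw [min_eq_left h, max_eq_right (by linarith)]
    unfold cedingCost
    have hg : 0 ≤ (x2 - 2 * x1 * k / (k + 2 * x1) * y) * l2 := by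
      apply mul_nonneg _ hl2
      rw [hd', ← mul_sub]
      exact mul_nonneg (by positivity) (by linarith)
    rw [← sub_nonneg]
    refine hg.trans_eq ?_
    clear_value d
    field_simp; ring
  · rw [min_eq_right h, max_eq_left (by linarith), hd']
    unfold cedingCost
    apply le_of_eq
    clear_value d
    field_simp; ring

theorem cedingCost_le {k x1 x2 y l1 l2 : ℝ} (hk : 0 < k) (h1 : 0 < x1) (hl2 : 0 ≤ l2) :
    cedingCost k x1 x2 y (k / (k + 2 * x1) * min y (retentionLevel k x1 x2))
        (max (y - retentionLevel k x1 x2) 0) ≤ cedingCost k x1 x2 y l1 l2 := by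
  have := cedingCost_add_le (x2 := x2) (y := y) (l1 := l1) hk h1 hl2
  refine le_trans (le_add_of_nonneg_right ?_) this
  positivity

theorem eq_of_cedingCost_le {k x1 x2 y l1 l2 : ℝ} (hk : 0 < k) (h1 : 0 < x1) (hl2 : 0 ≤ l2)
    (h : cedingCost k x1 x2 y l1 l2 ≤
      cedingCost k x1 x2 y (k / (k + 2 * x1) * min y (retentionLevel k x1 x2))
        (max (y - retentionLevel k x1 x2) 0)) :
    l1 = k / (k + 2 * x1) * min y (retentionLevel k x1 x2) ∧
      l2 = max (y - retentionLevel k x1 x2) 0 := by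
  have := cedingCost_add_le (x2 := x2) (y := y) (l1 := l1) hk h1 hl2
  set o1 := k / (k + 2 * x1) * min y (retentionLevel k x1 x2)
  set o2 := max (y - retentionLevel k x1 x2) 0
  have e1 : 0 ≤ x1 * (l1 - o1) ^ 2 := by positivity
  have e2 : 0 ≤ k / 2 * (l1 + l2 - o1 - o2) ^ 2 := by positivity
  have f1 : x1 * (l1 - o1) ^ 2 = 0 := by linarith
  have f2 : k / 2 * (l1 + l2 - o1 - o2) ^ 2 = 0 := by linarith
  have g1 : l1 - o1 = 0 := by
    rcases mul_eq_zero.1 f1 with h | h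
    · linarith
    · exact pow_eq_zero_iff two_ne_zero |>.1 h
  have g2 : l1 + l2 - o1 - o2 = 0 := by
    rcases mul_eq_zero.1 f2 with h | h
    · linarith
    · exact pow_eq_zero_iff two_ne_zero |>.1 h
  exact ⟨by linarith, by linarith⟩

end Cost

open scoped ENNReal NNReal

/-! ### Poisson moments and arrival times. -/

section Poisson

theorem poissonMeasure_singleton_succ (r : ℝ≥0) (n : ℕ) :
    ((n + 1 : ℕ) : ℝ≥0∞) * poissonMeasure r {n + 1} = r * poissonMeasure r {n} := by
  rw [poissonMeasure_singleton, poissonMeasure_singleton, ← ENNReal.ofReal_natCast,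
    ← ENNReal.ofReal_coe_nnreal, ← ENNReal.ofReal_mul (by positivity),
    ← ENNReal.ofReal_mul (by positivity)]
  congr 1
  rw [Nat.factorial_succ]
  push_cast
  field_simp
  ring

/-- Size biasing, from `(n + 1) p(n + 1) = r p(n)`. Taking `f = 1` and `f n = n` gives the first two
moments. -/
theorem lintegral_poissonMeasure_mul (r : ℝ≥0) (f : ℕ → ℝ≥0∞) :
    ∫⁻ n, (n : ℝ≥0∞) * f n ∂(poissonMeasure r) = r * ∫⁻ n, f (n + 1) ∂(poissonMeasure r) := by
  rw [lintegral_countable', lintegral_countable', tsum_eq_zero_add' ENNReal.summable,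
    ← ENNReal.tsum_mul_left]
  simp only [Nat.cast_zero, zero_mul, zero_add]
  refine tsum_congr fun n => ?_
  rw [mul_right_comm, poissonMeasure_singleton_succ]
  ring

theorem lintegral_poissonMeasure (r : ℝ≥0) : ∫⁻ n, (n : ℝ≥0∞) ∂(poissonMeasure r) = r := by
  have := lintegral_poissonMeasure_mul r 1
  simpa using this

theorem lintegral_poissonMeasure_sq (r : ℝ≥0) :
    ∫⁻ n, (n : ℝ≥0∞) * n ∂(poissonMeasure r) = r * r + r := by
  rw [lintegral_poissonMeasure_mul]
  push_cast
  rw [lintegral_add_right _ measurable_const, lintegral_poissonMeasure]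
  simp [mul_add]

end Poisson

theorem tsum_indicator_lt (n : ℕ) :
    ∑' i : ℕ, (if i < n then (1 : ℝ≥0∞) else 0) = n := by
  rw [tsum_eq_sum (s := Finset.range n) fun i hi => by
    rw [if_neg (by simpa using hi)]]
  rw [Finset.sum_congr rfl fun i hi => if_pos (Finset.mem_range.1 hi)]
  simp

namespace IsClaimModel

variable {M : Market} {Ω : Type*} [MeasurableSpace Ω] {P : Measure Ω} {N : ℝ → Ω → ℕ}
  {Y : ℕ → Ω → ℝ}

/-- Right continuity makes the infimum attained: the set lies to the right of its infimum and
accumulates there, so the bound `i + 1 ≤ N` passes to the limit. -/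
theorem arrivalTime_mem (h : IsClaimModel M P N Y) {i : ℕ} {ω : Ω} (hi : i < N M.T ω) :
    arrivalTime M N (i + 1) ω ∈ Icc 0 M.T ∧ i < N (arrivalTime M N (i + 1) ω) ω := by
  set S := {s | s ∈ Icc 0 M.T ∧ i + 1 ≤ N s ω} with hS
  have hne : S.Nonempty := ⟨M.T, ⟨⟨M.T_pos.le, le_rfl⟩, hi⟩⟩
  have hbdd : BddBelow S := ⟨0, fun s hs => hs.1.1⟩
  have hmem : sInf S ∈ Icc 0 M.T :=
    ⟨le_csInf hne fun s hs => hs.1.1, (csInf_le hbdd ⟨⟨M.T_pos.le, le_rfl⟩, hi⟩)⟩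
  have hcl : (𝓝[S] (sInf S)).NeBot := mem_closure_iff_nhdsWithin_neBot.1 (csInf_mem_closure hne hbdd)
  have hsub : S ⊆ Icc (sInf S) M.T := fun s hs => ⟨csInf_le hbdd hs, hs.1.2⟩
  have hc := (h.count_rightCont ω _ hmem).mono hsub
  refine ⟨hmem, Nat.lt_of_succ_le (ge_of_tendsto hc ?_)⟩
  filter_upwards [self_mem_nhdsWithin] with s hs using hs.2

theorem arrivalTime_le_iff (h : IsClaimModel M P N Y) {i : ℕ} {ω : Ω} (hi : i < N M.T ω) {s : ℝ}
    (hs : s ∈ Icc 0 M.T) : arrivalTime M N (i + 1) ω ≤ s ↔ i < N s ω := by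
  obtain ⟨h1, h2⟩ := h.arrivalTime_mem hi
  constructor
  · intro hle
    exact h2.trans_le (h.count_mono ω h1 hs hle)
  · intro hlt
    exact csInf_le ⟨0, fun s hs => hs.1.1⟩ ⟨hs, hlt⟩

theorem arrivalTime_pos (h : IsClaimModel M P N Y) {i : ℕ} {ω : Ω} (hi : i < N M.T ω) :
    0 < arrivalTime M N (i + 1) ω := by
  obtain ⟨h1, h2⟩ := h.arrivalTime_mem hi
  refine lt_of_le_of_ne h1.1 fun h0 => ?_
  rw [← h0, h.count_zero] at h2
  exact absurd h2 (by simp)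

/-- The projection of a time onto the horizon. -/
noncomputable def _root_.Market.clampTime (M : Market) (s : ℝ) : ℝ := max 0 (min s M.T)

theorem _root_.Market.clampTime_mem (M : Market) (s : ℝ) : M.clampTime s ∈ Icc 0 M.T :=
  ⟨le_max_left _ _, max_le M.T_pos.le (min_le_right _ _)⟩

theorem arrivalTime_le_iff_clampTime (h : IsClaimModel M P N Y) {i : ℕ} {ω : Ω}
    (hi : i < N M.T ω) (s : ℝ) :
    arrivalTime M N (i + 1) ω ≤ s ↔ i < N (M.clampTime s) ω := by
  rw [← h.arrivalTime_le_iff hi (M.clampTime_mem s)]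
  have h1 := (h.arrivalTime_mem hi).1.2
  have h0 := h.arrivalTime_pos hi
  unfold Market.clampTime
  constructor
  · intro hs
    exact le_max_of_le_right (le_min hs h1)
  · intro hs
    rcases le_max_iff.1 hs with h2 | h2
    · linarith
    · exact h2.trans (min_le_left _ _)

/-- Expresses "claim `i + 1` has arrived by `s`" through the value of `N` at one time of the
horizon. All real `s` occur in the generating rectangles, hence the projection. For `s < 0` both
sides fail because `N 0 = 0` and arrivals are positive. -/
theorem lt_count_iff_clampTime (h : IsClaimModel M P N Y) {i : ℕ} {ω : Ω} (s : ℝ) :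
    (i < N M.T ω ∧ arrivalTime M N (i + 1) ω ≤ s) ↔ i < N (M.clampTime s) ω := by
  constructor
  · rintro ⟨hi, hs⟩; exact (h.arrivalTime_le_iff_clampTime hi s).1 hs
  · intro hs
    have hi : i < N M.T ω := hs.trans_le
      (h.count_mono ω (M.clampTime_mem s) ⟨M.T_pos.le, le_rfl⟩ (M.clampTime_mem s).2)
    exact ⟨hi, (h.arrivalTime_le_iff_clampTime hi s).2 hs⟩

theorem measurableSet_lt_count (h : IsClaimModel M P N Y) {s : ℝ} (hs : s ∈ Icc 0 M.T) (i : ℕ) :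
    MeasurableSet {ω | i < N s ω} :=
  h.count_meas s hs (measurableSet_Ioi (a := i))

theorem T_mem (M : Market) : M.T ∈ Icc 0 M.T := ⟨M.T_pos.le, le_rfl⟩

theorem measurable_arrivalTime (h : IsClaimModel M P N Y) (i : ℕ) :
    Measurable (arrivalTime M N (i + 1)) := by
  apply measurable_of_Iic
  intro s
  -- If the claim does not arrive by `T`, the defining set is empty and `sInf ∅ = 0`. These paths
  -- belong to the preimage exactly when `0 ≤ s`, which is the second set of the union.
  have : arrivalTime M N (i + 1) ⁻¹' Iic s
      = {ω | i < N (M.clampTime s) ω} ∪ ({ω | i < N M.T ω}ᶜ ∩ {_ω | 0 ≤ s}) := by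
    ext ω
    by_cases hi : i < N M.T ω
    · simp [hi, h.arrivalTime_le_iff_clampTime hi s]
    · have hS : {s | s ∈ Icc 0 M.T ∧ i + 1 ≤ N s ω} = ∅ := by
        ext u
        simp only [mem_ofPred_eq, mem_empty_iff_false, iff_false, not_and, not_le]
        intro hu
        have := h.count_mono ω hu (T_mem M) hu.2
        simp only at this
        omega
      have h1 : arrivalTime M N (i + 1) ω = 0 := by
        unfold arrivalTime; rw [hS, Real.sInf_empty]
      have h2 : ¬ i < N (M.clampTime s) ω := fun hs => hi ((h.lt_count_iff_clampTime s).2 hs).1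
      simp [hi, h1, h2]
  rw [this]
  exact (h.measurableSet_lt_count (M.clampTime_mem s) i).union
    ((h.measurableSet_lt_count (T_mem M) i).compl.inter (MeasurableSet.const _))

/-- Arrival time and size of the claim number `i + 1`. -/
noncomputable def _root_.claimPoint (M : Market) (N : ℝ → Ω → ℕ) (Y : ℕ → Ω → ℝ) (i : ℕ) (ω : Ω) :
    ℝ × ℝ := (arrivalTime M N (i + 1) ω, Y i ω)

theorem measurable_claimPoint (h : IsClaimModel M P N Y) (i : ℕ) :
    Measurable (claimPoint M N Y i) := (h.measurable_arrivalTime i).prodMk (h.claim_meas i)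

theorem hasLaw_count (h : IsClaimModel M P N Y) {s : ℝ} (hs : s ∈ Icc 0 M.T) :
    HasLaw (N s) (poissonMeasure (Real.toNNReal (M.lam * s))) P := by
  have := h.count_law 0 s le_rfl hs.1 hs.2
  simpa [h.count_zero] using this

theorem lintegral_count (h : IsClaimModel M P N Y) {s : ℝ} (hs : s ∈ Icc 0 M.T) :
    ∫⁻ ω, (N s ω : ℝ≥0∞) ∂P = ENNReal.ofReal (M.lam * s) := by
  rw [(h.hasLaw_count hs).lintegral_comp (f := fun n : ℕ => (n : ℝ≥0∞))
    (Measurable.of_discrete).aemeasurable, lintegral_poissonMeasure]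
  rfl

/-- Write `N u = N s + (N u - N s)`: the increment is independent of `N s`, and the square of `N s`
is a Poisson second moment. -/
theorem lintegral_count_mul_of_le (h : IsClaimModel M P N Y) {s u : ℝ} (hs : s ∈ Icc 0 M.T)
    (hu : u ∈ Icc 0 M.T) (hsu : s ≤ u) :
    ∫⁻ ω, (N s ω : ℝ≥0∞) * N u ω ∂P
      = ENNReal.ofReal (M.lam * s) * ENNReal.ofReal (M.lam * u) + ENNReal.ofReal (M.lam * s) := by
  have h1 : ∀ ω, (N s ω : ℝ≥0∞) * N u ω
      = (N s ω : ℝ≥0∞) * N s ω + (N s ω : ℝ≥0∞) * ((N u ω - N s ω : ℕ) : ℝ≥0∞) := by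
    intro ω
    rw [← mul_add, ← Nat.cast_add, Nat.add_sub_cancel' (h.count_mono ω hs hu hsu)]
  have hc : ∀ {v}, v ∈ Icc 0 M.T → Measurable (fun ω => (N v ω : ℝ≥0∞)) := fun hv =>
    (Measurable.of_discrete (f := fun n : ℕ => (n : ℝ≥0∞))).comp (h.count_meas _ hv)
  have hd : Measurable (fun ω => N u ω - N s ω) := (h.count_meas u hu).sub (h.count_meas s hs)
  have hind : IndepFun (N s) (fun ω => N u ω - N s ω) P := by
    have := h.count_indep.indepFun_sub_sub (r := ⟨0, le_rfl, M.T_pos.le⟩) (s := ⟨s, hs⟩)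
      (t := ⟨u, hu⟩) (Subtype.mk_le_mk.2 hs.1) (Subtype.mk_le_mk.2 hsu)
    convert! this using 1
    ext ω
    simp [h.count_zero]
  have hind' := hind.comp (Measurable.of_discrete (f := fun n : ℕ => (n : ℝ≥0∞)))
    (Measurable.of_discrete (f := fun n : ℕ => (n : ℝ≥0∞)))
  have h2 : ∫⁻ ω, (N s ω : ℝ≥0∞) * ((N u ω - N s ω : ℕ) : ℝ≥0∞) ∂P
      = ENNReal.ofReal (M.lam * s) * ENNReal.ofReal (M.lam * (u - s)) := by
    have := lintegral_mul_eq_lintegral_mul_lintegral_of_indepFun (hc hs)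
      ((Measurable.of_discrete (f := fun n : ℕ => (n : ℝ≥0∞))).comp hd) hind'
    simp only [Pi.mul_apply, Function.comp_apply] at this
    rw [this, h.lintegral_count hs]
    congr 1
    rw [(h.count_law s u hs.1 hsu hu.2).lintegral_comp (f := fun n : ℕ => (n : ℝ≥0∞))
      (Measurable.of_discrete).aemeasurable, lintegral_poissonMeasure]
    rfl
  have h3 : ∫⁻ ω, (N s ω : ℝ≥0∞) * N s ω ∂P
      = ENNReal.ofReal (M.lam * s) * ENNReal.ofReal (M.lam * s) + ENNReal.ofReal (M.lam * s) := by
    rw [(h.hasLaw_count hs).lintegral_comp (f := fun n : ℕ => (n : ℝ≥0∞) * n)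
      (Measurable.of_discrete).aemeasurable, lintegral_poissonMeasure_sq]
    rfl
  simp_rw [h1]
  rw [lintegral_add_left (show Measurable fun ω => (N s ω : ℝ≥0∞) * N s ω from
    (hc hs).mul (hc hs)), h2, h3, add_right_comm, ← mul_add,
    ← ENNReal.ofReal_add (mul_nonneg M.lam_pos.le hs.1)
      (mul_nonneg M.lam_pos.le (sub_nonneg.2 hsu))]
  congr 3
  ring

theorem lintegral_count_mul (h : IsClaimModel M P N Y) {s u : ℝ} (hs : s ∈ Icc 0 M.T)
    (hu : u ∈ Icc 0 M.T) :
    ∫⁻ ω, (N s ω : ℝ≥0∞) * N u ω ∂P = ENNReal.ofReal (M.lam * s) * ENNReal.ofReal (M.lam * u)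
      + ENNReal.ofReal (M.lam * min s u) := by
  rcases le_total s u with hsu | hsu
  · rw [min_eq_left hsu, h.lintegral_count_mul_of_le hs hu hsu]
  · rw [min_eq_right hsu, mul_comm (ENNReal.ofReal _), ← h.lintegral_count_mul_of_le hu hs hsu]
    simp_rw [mul_comm]

theorem tsum_measure_lt_count (h : IsClaimModel M P N Y) {s : ℝ} (hs : s ∈ Icc 0 M.T) :
    ∑' i : ℕ, P {ω | i < N s ω} = ENNReal.ofReal (M.lam * s) := by
  rw [← h.lintegral_count hs]
  simp_rw [← tsum_indicator_lt]
  rw [lintegral_tsum fun i => (Measurable.ite (h.measurableSet_lt_count hs i) measurable_const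
    measurable_const).aemeasurable]
  refine tsum_congr fun i => ?_
  rw [← lintegral_indicator_one (h.measurableSet_lt_count hs i)]
  simp [indicator]

/-- The product `N s * N u` counts the pairs `(i, j)` with `i < N s` and `j < N u`; take
expectations. -/
theorem tsum_measure_lt_count_pair (h : IsClaimModel M P N Y) {s u : ℝ} (hs : s ∈ Icc 0 M.T)
    (hu : u ∈ Icc 0 M.T) :
    ∑' p : ℕ × ℕ, P ({ω | p.1 < N s ω} ∩ {ω | p.2 < N u ω})
      = ENNReal.ofReal (M.lam * s) * ENNReal.ofReal (M.lam * u)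
      + ENNReal.ofReal (M.lam * min s u) := by
  rw [← h.lintegral_count_mul hs hu]
  have : ∀ ω, (N s ω : ℝ≥0∞) * N u ω = ∑' p : ℕ × ℕ,
      ({ω | p.1 < N s ω} ∩ {ω | p.2 < N u ω}).indicator (1 : Ω → ℝ≥0∞) ω := by
    intro ω
    rw [ENNReal.tsum_prod', ← tsum_indicator_lt, ← tsum_indicator_lt, ← ENNReal.tsum_mul_right]
    refine tsum_congr fun i => ?_
    rw [← ENNReal.tsum_mul_left]
    refine tsum_congr fun j => ?_
    rw [Set.inter_indicator_one]
    simp [indicator]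
  simp_rw [this]
  have hm : ∀ p : ℕ × ℕ, MeasurableSet ({ω | p.1 < N s ω} ∩ {ω | p.2 < N u ω}) := fun p =>
    (h.measurableSet_lt_count hs p.1).inter (h.measurableSet_lt_count hu p.2)
  rw [lintegral_tsum fun p => (measurable_one.indicator (hm p)).aemeasurable]
  refine tsum_congr fun p => ?_
  rw [lintegral_indicator_one (hm p)]

theorem tsum_measure_lt_count_diag (h : IsClaimModel M P N Y) {s u : ℝ} (hs : s ∈ Icc 0 M.T)
    (hu : u ∈ Icc 0 M.T) :
    ∑' i : ℕ, P ({ω | i < N s ω} ∩ {ω | i < N u ω}) = ENNReal.ofReal (M.lam * min s u) := by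
  have : ∀ i, {ω | i < N s ω} ∩ {ω | i < N u ω} = {ω | i < N (min s u) ω} := by
    intro i
    ext ω
    rcases le_total s u with hsu | hsu
    · rw [min_eq_left hsu]
      exact ⟨fun h => h.1, fun h' => ⟨h', h'.out.trans_le (h.count_mono ω hs hu hsu)⟩⟩
    · rw [min_eq_right hsu]
      exact ⟨fun h => h.2, fun h' => ⟨h'.out.trans_le (h.count_mono ω hu hs hsu), h'⟩⟩
  simp_rw [this]
  exact h.tsum_measure_lt_count ⟨le_min hs.1 hu.1, (min_le_left _ _).trans hs.2⟩

end IsClaimModel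

/-! ### Moment measures of the marked point process and Campbell's formulas. -/

/-- The intensity measure of the claims on `[0, T] × ℝ`. -/
noncomputable def Market.intensity (M : Market) : Measure (ℝ × ℝ) :=
  (volume.restrict (Icc 0 M.T)).prod M.nu

instance (M : Market) : IsFiniteMeasure M.intensity := by unfold Market.intensity; infer_instance

theorem Market.intensity_Iic_prod (M : Market) (s : ℝ) (B : Set ℝ) :
    M.intensity (Iic s ×ˢ B) = ENNReal.ofReal (M.lam * M.clampTime s) * expMeasure M.beta B := by
  unfold Market.intensity
  rw [Measure.prod_prod, Measure.restrict_apply measurableSet_Iic]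
  have h1 : Iic s ∩ Icc 0 M.T = Icc 0 (min s M.T) := by
    ext u; simp only [mem_inter_iff, mem_Iic, mem_Icc, le_min_iff]; tauto
  have h2 : ENNReal.ofReal (min s M.T - 0) = ENNReal.ofReal (M.clampTime s) := by
    unfold Market.clampTime
    rw [sub_zero]
    rcases le_total 0 (min s M.T) with h | h
    · rw [max_eq_right h]
    · rw [max_eq_left h, ENNReal.ofReal_of_nonpos h, ENNReal.ofReal_zero]
  rw [h1, Real.volume_Icc, h2, ENNReal.ofReal_mul M.lam_pos.le, Market.nu,
    Measure.smul_apply, smul_eq_mul]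
  ring

/-- The rectangles `(-∞, s] × B`. -/
def lowerRectangles : Set (Set (ℝ × ℝ)) :=
  image2 (· ×ˢ ·) (range Iic) {B : Set ℝ | MeasurableSet B}

theorem isCountablySpanning_range_Iic : IsCountablySpanning (range (Iic : ℝ → Set ℝ)) :=
  ⟨fun n => Iic (n : ℝ), fun _ => mem_range_self _, iUnion_eq_univ_iff.2 fun x =>
    (exists_nat_ge x).imp fun _ h => h⟩

theorem isCountablySpanning_lowerRectangles : IsCountablySpanning lowerRectangles :=
  isCountablySpanning_range_Iic.prod isCountablySpanning_measurableSet

theorem generateFrom_lowerRectangles :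
    MeasurableSpace.generateFrom lowerRectangles = Prod.instMeasurableSpace :=
  generateFrom_eq_prod ((borel_eq_generateFrom_Iic ℝ).symm.trans
    (BorelSpace.measurable_eq (α := ℝ)).symm) MeasurableSpace.generateFrom_measurableSet
    isCountablySpanning_range_Iic isCountablySpanning_measurableSet

theorem isPiSystem_lowerRectangles : IsPiSystem lowerRectangles :=
  isPiSystem_Iic.prod MeasurableSpace.isPiSystem_measurableSet

section

variable {M : Market} {Ω : Type*} {N : ℝ → Ω → ℕ} {Y : ℕ → Ω → ℝ}

/-- The sum of `g (arrival time, claim size)` over all claims in `[0, T]`. -/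
noncomputable def claimTotal (M : Market) (N : ℝ → Ω → ℕ) (Y : ℕ → Ω → ℝ) (g : ℝ × ℝ → ℝ)
    (ω : Ω) : ℝ := ∑ i ∈ Finset.range (N M.T ω), g (claimPoint M N Y i ω)

theorem ofReal_claimTotal {g : ℝ × ℝ → ℝ} (hg0 : ∀ z, 0 ≤ g z) (ω : Ω) :
    ENNReal.ofReal (claimTotal M N Y g ω) = ∑' i, {ω | i < N M.T ω}.indicator
      (fun ω => ENNReal.ofReal (g (claimPoint M N Y i ω))) ω := by
  unfold claimTotal
  rw [ENNReal.ofReal_sum_of_nonneg fun i _ => hg0 _,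
    tsum_eq_sum (s := Finset.range (N M.T ω)) fun i hi => by
      rw [indicator_of_notMem]; simpa using hi]
  refine Finset.sum_congr rfl fun i hi => ?_
  rw [indicator_of_mem]; simpa using hi

end

namespace IsClaimModel

variable {M : Market} {Ω : Type*} [MeasurableSpace Ω] {P : Measure Ω} {N : ℝ → Ω → ℕ}
  {Y : ℕ → Ω → ℝ}

theorem measure_claim (h : IsClaimModel M P N Y) (i : ℕ) {B : Set ℝ} (hB : MeasurableSet B) :
    P (Y i ⁻¹' B) = expMeasure M.beta B := by
  rw [← (h.claim_law i).map_eq, Measure.map_apply (h.claim_meas i) hB]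

theorem measure_count_claim (h : IsClaimModel M P N Y) {s : ℝ} (hs : s ∈ Icc 0 M.T) (i : ℕ)
    {B : Set ℝ} (hB : MeasurableSet B) :
    P ({ω | i < N s ω} ∩ Y i ⁻¹' B) = P {ω | i < N s ω} * expMeasure M.beta B := by
  have := h.indep.measure_inter_preimage_eq_mul
    {n | i < n ⟨s, hs⟩} {y | y i ∈ B}
    (measurable_pi_apply (⟨s, hs⟩ : Icc (0 : ℝ) M.T) (measurableSet_Ioi (a := i)))
    (measurable_pi_apply i hB)
  rw [← h.measure_claim i hB]
  exact this

theorem measure_count_claim_pair (h : IsClaimModel M P N Y) {s u : ℝ} (hs : s ∈ Icc 0 M.T)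
    (hu : u ∈ Icc 0 M.T) (i j : ℕ) {B C : Set ℝ} (hB : MeasurableSet B) (hC : MeasurableSet C) :
    P (({ω | i < N s ω} ∩ {ω | j < N u ω}) ∩ (Y i ⁻¹' B ∩ Y j ⁻¹' C))
      = P ({ω | i < N s ω} ∩ {ω | j < N u ω}) * P (Y i ⁻¹' B ∩ Y j ⁻¹' C) :=
  h.indep.measure_inter_preimage_eq_mul
    ({n | i < n ⟨s, hs⟩} ∩ {n | j < n ⟨u, hu⟩}) ({y | y i ∈ B} ∩ {y | y j ∈ C})
    ((measurable_pi_apply (⟨s, hs⟩ : Icc (0 : ℝ) M.T) (measurableSet_Ioi (a := i))).inter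
      (measurable_pi_apply (⟨u, hu⟩ : Icc (0 : ℝ) M.T) (measurableSet_Ioi (a := j))))
    ((measurable_pi_apply i hB).inter (measurable_pi_apply j hC))

/-- First moment measure of the marked point process of the claims. -/
theorem sum_map_claimPoint (h : IsClaimModel M P N Y) :
    Measure.sum (fun i => (P.restrict {ω | i < N M.T ω}).map (claimPoint M N Y i))
      = M.intensity := by
  -- On `(-∞, s] × B` the `i`-th term is the probability of `{i < N s} ∩ {Y i ∈ B}` with `s`
  -- projected onto the horizon. Independence of `N` and `Y` factors it, and the sum over `i` is the
  -- mean of the count.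
  have hrect : ∀ R ∈ lowerRectangles,
      Measure.sum (fun i => (P.restrict {ω | i < N M.T ω}).map (claimPoint M N Y i)) R
      = M.intensity R := by
    rintro _ ⟨_, ⟨s, rfl⟩, B, hB, rfl⟩
    have hR : MeasurableSet (Iic s ×ˢ B) := measurableSet_Iic.prod hB
    rw [Measure.sum_apply _ hR, M.intensity_Iic_prod,
      ← h.tsum_measure_lt_count (M.clampTime_mem s), ← ENNReal.tsum_mul_right]
    refine tsum_congr fun i => ?_
    rw [Measure.map_apply (h.measurable_claimPoint i) hR,
      Measure.restrict_apply (h.measurable_claimPoint i hR),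
      ← h.measure_count_claim (M.clampTime_mem s) i hB]
    congr 1
    ext ω
    have := h.lt_count_iff_clampTime (i := i) (ω := ω) s
    simp only [claimPoint, mem_inter_iff, mem_preimage, mem_prod, mem_Iic, mem_ofPred_eq, ← this]
    tauto
  obtain ⟨R, hR, hU⟩ := isCountablySpanning_lowerRectangles
  refine Measure.ext_of_generateFrom_of_iUnion lowerRectangles R
    generateFrom_lowerRectangles.symm isPiSystem_lowerRectangles hU hR (fun n => ?_) hrect
  rw [hrect _ (hR n)]
  exact measure_ne_top _ _

/-- Second moment measure of the marked point process of the claims. -/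
theorem sum_map_claimPoint_pair [IsProbabilityMeasure P] (h : IsClaimModel M P N Y) :
    Measure.sum (fun p : ℕ × ℕ => (P.restrict ({ω | p.1 < N M.T ω} ∩ {ω | p.2 < N M.T ω})).map
        (fun ω => (claimPoint M N Y p.1 ω, claimPoint M N Y p.2 ω)))
      = M.intensity.prod M.intensity + M.intensity.map (fun z => (z, z)) := by
  have hprob := isProbabilityMeasure_expMeasure M.beta_pos
  have hdm : Measurable (fun z : ℝ × ℝ => (z, z)) := measurable_id.prodMk measurable_id
  have hrect : ∀ R ∈ image2 (· ×ˢ ·) lowerRectangles lowerRectangles,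
      Measure.sum (fun p : ℕ × ℕ => (P.restrict ({ω | p.1 < N M.T ω} ∩ {ω | p.2 < N M.T ω})).map
        (fun ω => (claimPoint M N Y p.1 ω, claimPoint M N Y p.2 ω))) R
      = (M.intensity.prod M.intensity + M.intensity.map (fun z => (z, z))) R := by
    rintro _ ⟨_, ⟨_, ⟨s, rfl⟩, B, hB, rfl⟩, _, ⟨_, ⟨u, rfl⟩, C, hC, rfl⟩, rfl⟩
    have hB : MeasurableSet B := hB
    have hC : MeasurableSet C := hC
    simp only
    have hR1 : MeasurableSet (Iic s ×ˢ B) := measurableSet_Iic.prod hB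
    have hR2 : MeasurableSet (Iic u ×ˢ C) := measurableSet_Iic.prod hC
    have hR : MeasurableSet ((Iic s ×ˢ B) ×ˢ (Iic u ×ˢ C)) := hR1.prod hR2
    have hs := M.clampTime_mem s
    have hu := M.clampTime_mem u
    have hdiag : M.intensity.map (fun z => (z, z)) ((Iic s ×ˢ B) ×ˢ (Iic u ×ˢ C))
        = ENNReal.ofReal (M.lam * min (M.clampTime s) (M.clampTime u))
          * expMeasure M.beta (B ∩ C) := by
      rw [Measure.map_apply hdm hR]
      have : (fun z : ℝ × ℝ => (z, z)) ⁻¹' ((Iic s ×ˢ B) ×ˢ (Iic u ×ˢ C))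
          = Iic (min s u) ×ˢ (B ∩ C) := by
        ext z
        simp only [mem_preimage, mem_prod, mem_Iic, mem_inter_iff, le_min_iff]
        tauto
      rw [this, M.intensity_Iic_prod]
      congr 3
      unfold Market.clampTime
      rw [← max_min_distrib_left, ← inf_inf_distrib_right]
    rw [Measure.add_apply, hdiag, Measure.prod_prod, M.intensity_Iic_prod, M.intensity_Iic_prod,
      Measure.sum_apply _ hR]
    have hterm : ∀ p : ℕ × ℕ, (P.restrict ({ω | p.1 < N M.T ω} ∩ {ω | p.2 < N M.T ω})).map
        (fun ω => (claimPoint M N Y p.1 ω, claimPoint M N Y p.2 ω))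
          ((Iic s ×ˢ B) ×ˢ (Iic u ×ˢ C))
        = P ({ω | p.1 < N (M.clampTime s) ω} ∩ {ω | p.2 < N (M.clampTime u) ω})
          * P (Y p.1 ⁻¹' B ∩ Y p.2 ⁻¹' C) := by
      intro p
      have hm := (h.measurable_claimPoint p.1).prodMk (h.measurable_claimPoint p.2)
      rw [Measure.map_apply hm hR, Measure.restrict_apply (hm hR),
        ← h.measure_count_claim_pair hs hu p.1 p.2 hB hC]
      congr 1
      ext ω
      have h1 := h.lt_count_iff_clampTime (i := p.1) (ω := ω) s
      have h2 := h.lt_count_iff_clampTime (i := p.2) (ω := ω) u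
      simp only [claimPoint, mem_inter_iff, mem_preimage, mem_prod, mem_Iic, mem_ofPred_eq, ← h1,
        ← h2]
      tauto
    simp_rw [hterm]
    -- Off the diagonal two claim sizes are independent; on it the product is replaced by the law of
    -- `B ∩ C`. The correction is added on both sides since subtraction in `ℝ≥0∞` truncates; being
    -- finite, it is cancelled at the end.
    have hpair : ∀ p : ℕ × ℕ, P (Y p.1 ⁻¹' B ∩ Y p.2 ⁻¹' C)
        + (if p.1 = p.2 then expMeasure M.beta B * expMeasure M.beta C else 0)
        = expMeasure M.beta B * expMeasure M.beta C
          + (if p.1 = p.2 then expMeasure M.beta (B ∩ C) else 0) := by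
      rintro ⟨i, j⟩
      by_cases hij : i = j
      · subst hij
        simp only [if_true]
        rw [← preimage_inter, h.measure_claim i (hB.inter hC), add_comm]
      · simp only [hij, if_false, add_zero]
        rw [(h.claim_indep.indepFun hij).measure_inter_preimage_eq_mul _ _ hB hC,
          h.measure_claim i hB, h.measure_claim j hC]
    set a : ℕ × ℕ → ℝ≥0∞ := fun p =>
      P ({ω | p.1 < N (M.clampTime s) ω} ∩ {ω | p.2 < N (M.clampTime u) ω}) with ha
    have hd : ∀ c : ℝ≥0∞, ∑' p : ℕ × ℕ, a p * (if p.1 = p.2 then c else 0)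
        = ENNReal.ofReal (M.lam * min (M.clampTime s) (M.clampTime u)) * c := by
      intro c
      rw [← h.tsum_measure_lt_count_diag hs hu, ENNReal.tsum_prod', ← ENNReal.tsum_mul_right]
      refine tsum_congr fun i => ?_
      rw [tsum_eq_single i fun j hj => by simp [Ne.symm hj]]
      simp [ha]
    have hsum : ∑' p, a p * P (Y p.1 ⁻¹' B ∩ Y p.2 ⁻¹' C)
        + ENNReal.ofReal (M.lam * min (M.clampTime s) (M.clampTime u))
          * (expMeasure M.beta B * expMeasure M.beta C)
        = (ENNReal.ofReal (M.lam * M.clampTime s) * ENNReal.ofReal (M.lam * M.clampTime u)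
          + ENNReal.ofReal (M.lam * min (M.clampTime s) (M.clampTime u)))
          * (expMeasure M.beta B * expMeasure M.beta C)
        + ENNReal.ofReal (M.lam * min (M.clampTime s) (M.clampTime u))
          * expMeasure M.beta (B ∩ C) := by
      rw [← hd, ← hd, ← ENNReal.tsum_add, ← h.tsum_measure_lt_count_pair hs hu,
        ← ENNReal.tsum_mul_right, ← ENNReal.tsum_add]
      refine tsum_congr fun p => ?_
      rw [← mul_add, hpair, mul_add]
    have hfin : ENNReal.ofReal (M.lam * min (M.clampTime s) (M.clampTime u))
          * (expMeasure M.beta B * expMeasure M.beta C) ≠ ⊤ := by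
      exact ENNReal.mul_ne_top ENNReal.ofReal_ne_top
        (ENNReal.mul_ne_top (measure_ne_top _ _) (measure_ne_top _ _))
    rw [← ENNReal.add_left_inj hfin, hsum]
    ring
  obtain ⟨R, hR, hU⟩ :=
    isCountablySpanning_lowerRectangles.prod isCountablySpanning_lowerRectangles
  have hfm : IsFiniteMeasure (M.intensity.map (fun z => (z, z))) :=
    Measure.isFiniteMeasure_map _ _
  refine Measure.ext_of_generateFrom_of_iUnion _ R
    (generateFrom_eq_prod generateFrom_lowerRectangles generateFrom_lowerRectangles
      isCountablySpanning_lowerRectangles isCountablySpanning_lowerRectangles).symm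
    (isPiSystem_lowerRectangles.prod isPiSystem_lowerRectangles) hU hR (fun n => ?_) hrect
  rw [hrect _ (hR n)]
  exact measure_ne_top _ _

theorem measurable_indicator_claimPoint (h : IsClaimModel M P N Y) {g : ℝ × ℝ → ℝ}
    (hg : Measurable g) (i : ℕ) : Measurable ({ω | i < N M.T ω}.indicator
      (fun ω => ENNReal.ofReal (g (claimPoint M N Y i ω)))) :=
  (ENNReal.measurable_ofReal.comp (hg.comp (h.measurable_claimPoint i))).indicator
    (h.measurableSet_lt_count (T_mem M) i)

theorem measurable_claimTotal (h : IsClaimModel M P N Y) {g : ℝ × ℝ → ℝ}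
    (hg : Measurable g) (hg0 : ∀ z, 0 ≤ g z) : Measurable (claimTotal M N Y g) := by
  have h1 : Measurable fun ω => ENNReal.ofReal (claimTotal M N Y g ω) := by
    simp_rw [ofReal_claimTotal hg0]
    exact Measurable.tsum fun i => h.measurable_indicator_claimPoint hg i
  have h2 := h1.ennreal_toReal
  have h3 : ∀ ω, (ENNReal.ofReal (claimTotal M N Y g ω)).toReal = claimTotal M N Y g ω := fun ω =>
    ENNReal.toReal_ofReal (Finset.sum_nonneg fun i _ => hg0 _)
  simpa only [h3] using h2

theorem lintegral_claimTotal (h : IsClaimModel M P N Y) {g : ℝ × ℝ → ℝ} (hg : Measurable g)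
    (hg0 : ∀ z, 0 ≤ g z) : ∫⁻ ω, ENNReal.ofReal (claimTotal M N Y g ω) ∂P
      = ∫⁻ z, ENNReal.ofReal (g z) ∂M.intensity := by
  simp_rw [ofReal_claimTotal hg0]
  rw [lintegral_tsum fun i => (h.measurable_indicator_claimPoint hg i).aemeasurable,
    ← h.sum_map_claimPoint, lintegral_sum_measure]
  refine tsum_congr fun i => ?_
  rw [lintegral_indicator (h.measurableSet_lt_count (T_mem M) i),
    lintegral_map hg.ennreal_ofReal (h.measurable_claimPoint i)]

theorem lintegral_claimTotal_sq [IsProbabilityMeasure P] (h : IsClaimModel M P N Y)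
    {g : ℝ × ℝ → ℝ} (hg : Measurable g) (hg0 : ∀ z, 0 ≤ g z) :
    ∫⁻ ω, ENNReal.ofReal (claimTotal M N Y g ω) * ENNReal.ofReal (claimTotal M N Y g ω) ∂P
      = (∫⁻ z, ENNReal.ofReal (g z) ∂M.intensity) * (∫⁻ z, ENNReal.ofReal (g z) ∂M.intensity)
        + ∫⁻ z, ENNReal.ofReal (g z) * ENNReal.ofReal (g z) ∂M.intensity := by
  have hprod : ∀ ω, ENNReal.ofReal (claimTotal M N Y g ω) * ENNReal.ofReal (claimTotal M N Y g ω)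
      = ∑' p : ℕ × ℕ, ({ω | p.1 < N M.T ω} ∩ {ω | p.2 < N M.T ω}).indicator
        (fun ω => ENNReal.ofReal (g (claimPoint M N Y p.1 ω))
          * ENNReal.ofReal (g (claimPoint M N Y p.2 ω))) ω := by
    intro ω
    rw [ENNReal.tsum_prod', ofReal_claimTotal hg0, ← ENNReal.tsum_mul_right]
    refine tsum_congr fun i => ?_
    rw [← ENNReal.tsum_mul_left]
    refine tsum_congr fun j => ?_
    rw [Set.inter_indicator_mul]
  have hgm := hg.ennreal_ofReal
  have hgg : Measurable fun z : (ℝ × ℝ) × (ℝ × ℝ) =>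
      ENNReal.ofReal (g z.1) * ENNReal.ofReal (g z.2) :=
    (hgm.comp measurable_fst).mul (hgm.comp measurable_snd)
  have hms : ∀ p : ℕ × ℕ, MeasurableSet ({ω | p.1 < N M.T ω} ∩ {ω | p.2 < N M.T ω}) := fun p =>
    (h.measurableSet_lt_count (T_mem M) _).inter (h.measurableSet_lt_count (T_mem M) _)
  have hmp : ∀ p : ℕ × ℕ, Measurable fun ω => (claimPoint M N Y p.1 ω, claimPoint M N Y p.2 ω) :=
    fun p => (h.measurable_claimPoint p.1).prodMk (h.measurable_claimPoint p.2)
  simp_rw [hprod]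
  have hmi : ∀ p : ℕ × ℕ, Measurable (({ω | p.1 < N M.T ω} ∩ {ω | p.2 < N M.T ω}).indicator
      (fun ω => ENNReal.ofReal (g (claimPoint M N Y p.1 ω))
        * ENNReal.ofReal (g (claimPoint M N Y p.2 ω)))) := fun p =>
    (hgg.comp (hmp p)).indicator (hms p)
  rw [lintegral_tsum fun p => (hmi p).aemeasurable]
  have key := lintegral_sum_measure (fun z : (ℝ × ℝ) × (ℝ × ℝ) =>
      ENNReal.ofReal (g z.1) * ENNReal.ofReal (g z.2))
    (fun p : ℕ × ℕ => (P.restrict ({ω | p.1 < N M.T ω} ∩ {ω | p.2 < N M.T ω})).map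
        (fun ω => (claimPoint M N Y p.1 ω, claimPoint M N Y p.2 ω)))
  rw [h.sum_map_claimPoint_pair, lintegral_add_measure,
    lintegral_map hgg (show Measurable fun z : ℝ × ℝ => (z, z) from measurable_id.prodMk measurable_id),
    lintegral_prod_mul hgm.aemeasurable hgm.aemeasurable] at key
  rw [key]
  refine tsum_congr fun p => ?_
  rw [lintegral_indicator (hms p), lintegral_map hgg (hmp p)]

/-- Campbell's formulas for the mean and the variance of a sum over the claims. -/
theorem campbell [IsProbabilityMeasure P] (h : IsClaimModel M P N Y) {g : ℝ × ℝ → ℝ}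
    (hg : Measurable g) (hg0 : ∀ z, 0 ≤ g z) (hi : Integrable g M.intensity)
    (hi2 : Integrable (fun z => g z ^ 2) M.intensity) :
    MemLp (claimTotal M N Y g) 2 P ∧ ∫ ω, claimTotal M N Y g ω ∂P = ∫ z, g z ∂M.intensity ∧
      variance (claimTotal M N Y g) P = ∫ z, g z ^ 2 ∂M.intensity := by
  have hm := h.measurable_claimTotal hg hg0
  have hS0 : ∀ ω, 0 ≤ claimTotal M N Y g ω := fun ω => Finset.sum_nonneg fun i _ => hg0 _
  have e1 : ∫⁻ z, ENNReal.ofReal (g z) ∂M.intensity = ENNReal.ofReal (∫ z, g z ∂M.intensity) :=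
    (ofReal_integral_eq_lintegral_ofReal hi (ae_of_all _ hg0)).symm
  have e2 : ∫⁻ z, ENNReal.ofReal (g z) * ENNReal.ofReal (g z) ∂M.intensity
      = ENNReal.ofReal (∫ z, g z ^ 2 ∂M.intensity) := by
    rw [ofReal_integral_eq_lintegral_ofReal hi2 (ae_of_all _ fun z => sq_nonneg _)]
    refine lintegral_congr fun z => ?_
    rw [← ENNReal.ofReal_mul (hg0 z), sq]
  have n1 : 0 ≤ ∫ z, g z ∂M.intensity := integral_nonneg hg0
  have n2 : 0 ≤ ∫ z, g z ^ 2 ∂M.intensity := integral_nonneg fun z => sq_nonneg _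
  have m1 : ∫ ω, claimTotal M N Y g ω ∂P = ∫ z, g z ∂M.intensity := by
    rw [integral_eq_lintegral_of_nonneg_ae (ae_of_all _ hS0) hm.aestronglyMeasurable,
      h.lintegral_claimTotal hg hg0, e1, ENNReal.toReal_ofReal n1]
  have q : ∫⁻ ω, ENNReal.ofReal (claimTotal M N Y g ω ^ 2) ∂P
      = ENNReal.ofReal ((∫ z, g z ∂M.intensity) ^ 2 + ∫ z, g z ^ 2 ∂M.intensity) := by
    have := h.lintegral_claimTotal_sq hg hg0
    rw [e1, e2, ← ENNReal.ofReal_mul n1, ← ENNReal.ofReal_add (mul_nonneg n1 n1) n2] at this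
    rw [sq, ← this]
    refine lintegral_congr fun ω => ?_
    rw [← ENNReal.ofReal_mul (hS0 ω), sq]
  have m2 : ∫ ω, claimTotal M N Y g ω ^ 2 ∂P
      = (∫ z, g z ∂M.intensity) ^ 2 + ∫ z, g z ^ 2 ∂M.intensity := by
    rw [integral_eq_lintegral_of_nonneg_ae (ae_of_all _ fun ω => sq_nonneg _)
      (hm.pow_const 2).aestronglyMeasurable, q, ENNReal.toReal_ofReal (by positivity)]
  have hL : MemLp (claimTotal M N Y g) 2 P := by
    rw [memLp_two_iff_integrable_sq hm.aestronglyMeasurable]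
    refine ⟨(hm.pow_const 2).aestronglyMeasurable, ?_⟩
    rw [hasFiniteIntegral_iff_ofReal (ae_of_all _ fun ω => sq_nonneg _), q]
    exact ENNReal.ofReal_lt_top
  refine ⟨hL, m1, ?_⟩
  rw [variance_eq_sub hL]
  simp only [Pi.pow_apply]
  rw [m2, m1]; ring

end IsClaimModel

/-! ### Linear equations with bounded measurable coefficients. -/

section LinearODE

variable {rho b : ℝ → ℝ} {t T K : ℝ}

/-- The rate is only integrable and bounded, so the integrating factor need not be differentiable
everywhere. Its Lipschitz property yields absolute continuity, under which an almost everywhere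
product rule and the fundamental theorem suffice. -/
theorem lipschitzOnWith_exp_integral (htT : t ≤ T) (c : ℝ)
    (hr : IntervalIntegrable rho volume t T) (hK : ∀ s ∈ Icc t T, |rho s| ≤ K) :
    ∃ C, LipschitzOnWith C (fun s => Real.exp (c * ∫ u in t..s, rho u)) (Icc t T) := by
  have hK0 : 0 ≤ K := (abs_nonneg _).trans (hK t ⟨le_rfl, htT⟩)
  have hint : ∀ {s u}, s ∈ Icc t T → u ∈ Icc t T → IntervalIntegrable rho volume s u :=
    fun hs hu => hr.mono_set (by
      rw [uIcc_of_le htT]; exact uIcc_subset_Icc hs hu)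
  have h1 : LipschitzOnWith (K.toNNReal) (fun s => ∫ u in t..s, rho u) (Icc t T) := by
    refine LipschitzOnWith.of_dist_le_mul fun s hs u hu => ?_
    rw [Real.coe_toNNReal _ hK0, Real.dist_eq, Real.dist_eq,
      intervalIntegral.integral_interval_sub_left (hint ⟨le_rfl, htT⟩ hs) (hint ⟨le_rfl, htT⟩ hu)]
    have := intervalIntegral.norm_integral_le_of_norm_le_const (a := u) (b := s) (f := rho) (C := K)
      fun v hv => by
        rw [Real.norm_eq_abs]
        exact hK v (uIcc_subset_Icc hu hs (uIoc_subset_uIcc hv))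
    simpa using this
  have hb : ∀ s ∈ Icc t T, ∫ u in t..s, rho u ∈ Icc (-(K * (T - t))) (K * (T - t)) := by
    intro s hs
    have := intervalIntegral.norm_integral_le_of_norm_le_const (a := t) (b := s) (f := rho) (C := K)
      fun v hv => by
        rw [Real.norm_eq_abs]
        exact hK v (uIcc_subset_Icc ⟨le_rfl, htT⟩ hs (uIoc_subset_uIcc hv))
    rw [Real.norm_eq_abs, abs_of_nonneg (sub_nonneg.2 hs.1)] at this
    have h2 : K * (s - t) ≤ K * (T - t) := mul_le_mul_of_nonneg_left (by linarith [hs.2]) hK0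
    exact abs_le.1 (this.trans h2)
  have hcd : ContDiff ℝ 1 (fun v : ℝ => Real.exp (c * v)) := by fun_prop
  obtain ⟨C, hC⟩ := hcd.contDiffOn.exists_lipschitzOnWith (s := Icc (-(K * (T - t))) (K * (T - t)))
    one_ne_zero (convex_Icc _ _) isCompact_Icc
  exact ⟨_, hC.comp h1 hb⟩

theorem absolutelyContinuous_exp_integral (htT : t ≤ T) (c : ℝ)
    (hr : IntervalIntegrable rho volume t T) (hK : ∀ s ∈ Icc t T, |rho s| ≤ K) :
    AbsolutelyContinuousOnInterval (fun s => Real.exp (c * ∫ u in t..s, rho u)) t T := by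
  obtain ⟨C, hC⟩ := lipschitzOnWith_exp_integral htT c hr hK
  rw [← uIcc_of_le htT] at hC
  exact hC.absolutelyContinuousOnInterval

theorem ae_hasDerivAt_exp_integral (c : ℝ) (hr : IntervalIntegrable rho volume t T) :
    ∀ᵐ s, s ∈ uIcc t T → HasDerivAt (fun s => Real.exp (c * ∫ u in t..s, rho u))
      (Real.exp (c * ∫ u in t..s, rho u) * (c * rho s)) s := by
  filter_upwards [hr.ae_hasDerivAt_integral] with s hs hst
  exact ((hs hst t left_mem_uIcc).const_mul c).exp

theorem intervalIntegrable_exp_mul (htT : t ≤ T) (c : ℝ)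
    (hr : IntervalIntegrable rho volume t T) (hK : ∀ s ∈ Icc t T, |rho s| ≤ K)
    (hb : IntervalIntegrable b volume t T) :
    IntervalIntegrable (fun s => Real.exp (c * ∫ u in t..s, rho u) * b s) volume t T :=
  hb.continuousOn_mul (absolutelyContinuous_exp_integral htT c hr hK).continuousOn

/-- The linear equation `z' = b + rho z`, `z t = 0`, has a solution. -/
theorem exists_linear_solution (htT : t ≤ T)
    (hr : IntervalIntegrable rho volume t T) (hK : ∀ s ∈ Icc t T, |rho s| ≤ K)
    (hb : IntervalIntegrable b volume t T) :
    ∃ z : ℝ → ℝ, ∀ s ∈ Icc t T, IntervalIntegrable (fun u => b u + rho u * z u) volume t s ∧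
      z s = ∫ u in t..s, (b u + rho u * z u) := by
  set E := fun s => Real.exp (1 * ∫ u in t..s, rho u) with hE
  set e := fun s => Real.exp (-1 * ∫ u in t..s, rho u) with he
  have hEe : ∀ s, E s * e s = 1 := fun s => by
    simp only [hE, he]; rw [← Real.exp_add]; simp
  -- Variation of constants: the solution is `E * V`.
  set V := fun s => ∫ u in t..s, e u * b u with hV
  have hib := intervalIntegrable_exp_mul htT (-1) hr hK hb
  have acE := absolutelyContinuous_exp_integral htT 1 hr hK
  have acV : AbsolutelyContinuousOnInterval V t T :=
    hib.absolutelyContinuousOnInterval_intervalIntegral left_mem_uIcc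
  have acz : AbsolutelyContinuousOnInterval (fun s => E s * V s) t T := acE.fun_mul acV
  have hder : ∀ᵐ s, s ∈ uIcc t T → deriv (fun s => E s * V s) s = b s + rho s * (E s * V s) := by
    filter_upwards [ae_hasDerivAt_exp_integral 1 hr, hib.ae_hasDerivAt_integral] with s h1 h2 hs
    have h3 := (h1 hs).mul (h2 hs t left_mem_uIcc)
    have h4 : deriv (fun s => E s * V s) s = _ := h3.deriv
    rw [h4]
    change E s * (1 * rho s) * V s + E s * (e s * b s) = _
    linear_combination b s * hEe s
  have hint : IntervalIntegrable (fun u => b u + rho u * (E u * V u)) volume t T :=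
    hb.add (hr.mul_continuousOn acz.continuousOn)
  refine ⟨fun s => E s * V s, fun s hs => ?_⟩
  have hsub : uIcc t s ⊆ uIcc t T := uIcc_subset_uIcc left_mem_uIcc (by rwa [uIcc_of_le htT])
  refine ⟨hint.mono_set hsub, ?_⟩
  have h := (acz.mono hsub).integral_deriv_eq_sub
  have h0 : V t = 0 := by simp [hV]
  rw [h0, mul_zero, sub_zero] at h
  refine h.symm.trans (intervalIntegral.integral_congr_ae ?_)
  filter_upwards [hder] with u hu hus
  exact hu (hsub (uIoc_subset_uIcc hus))

/-- Variation of constants: the value at `T` of a solution of `z' = b + rho z`, `z t = 0`. -/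
theorem linear_solution_eq (htT : t ≤ T)
    (hr : IntervalIntegrable rho volume t T) (hK : ∀ s ∈ Icc t T, |rho s| ≤ K) {z : ℝ → ℝ}
    (hz : IntervalIntegrable (fun u => b u + rho u * z u) volume t T)
    (hz' : ∀ s ∈ Icc t T, z s = ∫ u in t..s, (b u + rho u * z u)) :
    z T = ∫ s in t..T, Real.exp (∫ u in s..T, rho u) * b s := by
  set E := fun s => Real.exp (1 * ∫ u in t..s, rho u) with hE
  set e := fun s => Real.exp (-1 * ∫ u in t..s, rho u) with he
  have hEe : ∀ s, E s * e s = 1 := fun s => by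
    simp only [hE, he]; rw [← Real.exp_add]; simp
  set V := fun s => ∫ u in t..s, (b u + rho u * z u) with hV
  have ace := absolutelyContinuous_exp_integral htT (-1) hr hK
  have acV : AbsolutelyContinuousOnInterval V t T :=
    hz.absolutelyContinuousOnInterval_intervalIntegral left_mem_uIcc
  have acz : AbsolutelyContinuousOnInterval (fun s => e s * V s) t T := ace.fun_mul acV
  -- The integrating factor `e` cancels the terms with `rho`. Here `V` agrees with `z` on `[t, T]`
  -- and is an integral, so it is absolutely continuous.
  have hder : ∀ᵐ s, s ∈ uIcc t T → deriv (fun s => e s * V s) s = e s * b s := by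
    filter_upwards [ae_hasDerivAt_exp_integral (-1) hr, hz.ae_hasDerivAt_integral] with s h1 h2 hs
    have h3 := (h1 hs).mul (h2 hs t left_mem_uIcc)
    have h4 : deriv (fun s => e s * V s) s = _ := h3.deriv
    rw [h4]
    change e s * (-1 * rho s) * V s + e s * (b s + rho s * z s) = _
    rw [hz' s (by rwa [uIcc_of_le htT] at hs)]
    change e s * (-1 * rho s) * V s + e s * (b s + rho s * V s) = _
    ring
  have h := acz.integral_deriv_eq_sub
  have h0 : V t = 0 := by simp [hV]
  rw [h0, mul_zero, sub_zero] at h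
  have hT : z T = E T * (e T * V T) := by
    rw [← mul_assoc, hEe, one_mul]; exact hz' T ⟨htT, le_rfl⟩
  rw [hT, ← h, ← intervalIntegral.integral_const_mul]
  refine intervalIntegral.integral_congr_ae ?_
  filter_upwards [hder] with s hs hst
  rw [hs (uIoc_subset_uIcc hst), ← mul_assoc]
  congr 1
  simp only [hE, he]
  rw [← Real.exp_add]
  congr 1
  have hsI : s ∈ uIcc t T := uIoc_subset_uIcc hst
  have := intervalIntegral.integral_add_adjacent_intervals
    (hr.mono_set (uIcc_subset_uIcc left_mem_uIcc hsI))
    (hr.mono_set (uIcc_subset_uIcc hsI right_mem_uIcc))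
  linarith

/-- The integral of `rho` weighted by the accumulation factor. -/
theorem integral_exp_mul_rho (htT : t ≤ T)
    (hr : IntervalIntegrable rho volume t T) (hK : ∀ s ∈ Icc t T, |rho s| ≤ K) :
    ∫ s in t..T, Real.exp (∫ u in s..T, rho u) * rho s = Real.exp (∫ u in t..T, rho u) - 1 := by
  have ace := absolutelyContinuous_exp_integral htT 1 hr hK
  -- This function solves the linear equation with `b = rho`, so `linear_solution_eq` evaluates the
  -- weighted integral.
  have hz : ∀ s ∈ Icc t T, Real.exp (1 * ∫ u in t..s, rho u) - 1
      = ∫ u in t..s, (rho u + rho u * (Real.exp (1 * ∫ v in t..u, rho v) - 1)) := by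
    intro s hs
    have hsub : uIcc t s ⊆ uIcc t T := uIcc_subset_uIcc left_mem_uIcc (by rwa [uIcc_of_le htT])
    have h := (ace.mono hsub).integral_deriv_eq_sub
    simp only [intervalIntegral.integral_same, mul_zero, Real.exp_zero] at h
    rw [← h]
    refine intervalIntegral.integral_congr_ae ?_
    filter_upwards [ae_hasDerivAt_exp_integral 1 hr] with u hu hus
    rw [(hu (hsub (uIoc_subset_uIcc hus))).deriv]
    ring
  have := linear_solution_eq htT hr hK (b := rho)
    (hr.add (hr.mul_continuousOn (ace.continuousOn.sub continuousOn_const))) hz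
  rw [← this]
  change Real.exp (1 * _) - 1 = _
  rw [one_mul]

end LinearODE

/-! ### The surplus equation along a single path. -/

section JumpODE

variable {rho a : ℝ → ℝ} {t T K : ℝ} {ι : Type*}

/-- The jumps at the times `τ i`, of sizes `f i`, that have occurred up to time `s`. -/
noncomputable def jumpSum (I : Finset ι) (τ f : ι → ℝ) (s : ℝ) : ℝ :=
  ∑ i ∈ I, if τ i ≤ s then f i else 0

theorem intervalIntegrable_mul_step (hr : IntervalIntegrable rho volume t T) (τ c : ℝ) :
    IntervalIntegrable (fun s => rho s * (if τ ≤ s then c else 0)) volume t T := by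
  have h : (fun s => rho s * (if τ ≤ s then c else 0))
      = (Ici τ).indicator (fun s => rho s * c) := by
    ext s
    by_cases hs : τ ≤ s <;> simp [hs]
  rw [h]
  exact ⟨(hr.mul_const c).1.indicator measurableSet_Ici,
    (hr.mul_const c).2.indicator measurableSet_Ici⟩

theorem intervalIntegrable_mul_jumpSum (hr : IntervalIntegrable rho volume t T) (I : Finset ι)
    (τ f : ι → ℝ) : IntervalIntegrable (fun s => rho s * jumpSum I τ f s) volume t T := by
  unfold jumpSum
  simp_rw [Finset.mul_sum]
  have := IntervalIntegrable.sum I fun i _ => intervalIntegrable_mul_step hr (τ i) (f i)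
  convert! this using 1
  ext s
  simp

/-- Put `X = x + z - J` with `J` the jumps so far. Then `z` has no jumps and solves the linear
equation with inhomogeneity `a + rho * x - rho * J`. -/
theorem exists_jump_solution (htT : t ≤ T)
    (hr : IntervalIntegrable rho volume t T) (hK : ∀ s ∈ Icc t T, |rho s| ≤ K)
    (ha : IntervalIntegrable a volume t T) (I : Finset ι) (τ f : ι → ℝ) (x : ℝ) :
    ∃ X : ℝ → ℝ, ∀ s ∈ Icc t T, IntervalIntegrable (fun u => a u + rho u * X u) volume t s ∧
      X s = x + (∫ u in t..s, (a u + rho u * X u)) - jumpSum I τ f s := by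
  obtain ⟨z, hz⟩ := exists_linear_solution (b := fun s => a s + rho s * x
    - rho s * jumpSum I τ f s) htT hr hK
    ((ha.add (hr.mul_const x)).sub (intervalIntegrable_mul_jumpSum hr I τ f))
  refine ⟨fun s => x + z s - jumpSum I τ f s, fun s hs => ?_⟩
  have heq : (fun u => a u + rho u * (x + z u - jumpSum I τ f u))
      = fun u => a u + rho u * x - rho u * jumpSum I τ f u + rho u * z u := by
    ext u; ring
  rw [heq]
  exact ⟨(hz s hs).1, by rw [← (hz s hs).2]⟩

theorem jump_solution_eq (htT : t ≤ T)
    (hr : IntervalIntegrable rho volume t T) (hK : ∀ s ∈ Icc t T, |rho s| ≤ K)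
    (ha : IntervalIntegrable a volume t T) (I : Finset ι) (τ f : ι → ℝ)
    (hτ : ∀ i ∈ I, τ i ∈ Icc t T) (x : ℝ) {X : ℝ → ℝ}
    (hX : ∀ s ∈ Icc t T, IntervalIntegrable (fun u => a u + rho u * X u) volume t s ∧
      X s = x + (∫ u in t..s, (a u + rho u * X u)) - jumpSum I τ f s) :
    X T = x * Real.exp (∫ u in t..T, rho u) + (∫ s in t..T, Real.exp (∫ u in s..T, rho u) * a s)
      - ∑ i ∈ I, Real.exp (∫ u in τ i..T, rho u) * f i := by
  set z := fun s => ∫ u in t..s, (a u + rho u * X u) with hz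
  set b := fun s => a s + rho s * x - rho s * jumpSum I τ f s with hb
  have hTm : T ∈ Icc t T := ⟨htT, le_rfl⟩
  have hXz : ∀ s ∈ Icc t T, a s + rho s * X s = b s + rho s * z s := by
    intro s hs
    rw [(hX s hs).2, hb, hz]; ring
  have hz1 : IntervalIntegrable (fun u => b u + rho u * z u) volume t T := by
    refine (hX T hTm).1.congr ?_
    rw [uIoc_of_le htT]
    exact fun s hs => hXz s (Ioc_subset_Icc_self hs)
  have hz2 : ∀ s ∈ Icc t T, z s = ∫ u in t..s, (b u + rho u * z u) := by
    intro s hs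
    refine intervalIntegral.integral_congr fun u hu => ?_
    rw [uIcc_of_le hs.1] at hu
    exact hXz u ⟨hu.1, hu.2.trans hs.2⟩
  have key := linear_solution_eq htT hr hK hz1 hz2
  have hexp : ContinuousOn (fun s => Real.exp (∫ u in s..T, rho u)) (uIcc t T) := by
    have h1 := (absolutelyContinuous_exp_integral htT (-1) hr hK).continuousOn
    refine (h1.const_mul (Real.exp (∫ u in t..T, rho u))).congr fun s hs => ?_
    simp only
    rw [← Real.exp_add]
    congr 1
    have := intervalIntegral.integral_add_adjacent_intervals
      (hr.mono_set (uIcc_subset_uIcc left_mem_uIcc hs))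
      (hr.mono_set (uIcc_subset_uIcc hs right_mem_uIcc))
    linarith
  -- A jump at `τ i` also loses the interest on its amount from then on, worth `f i * (growth - 1)`
  -- at `T`. With the jump itself this gives `f i` times the growth from `τ i` to `T`.
  have hstep : ∀ i ∈ I, ∫ s in t..T, Real.exp (∫ u in s..T, rho u)
      * (rho s * (if τ i ≤ s then f i else 0)) = f i * (Real.exp (∫ u in τ i..T, rho u) - 1) := by
    intro i hi
    have hi' := hτ i hi
    have hiu : τ i ∈ uIcc t T := by rwa [uIcc_of_le htT]
    have hint : IntervalIntegrable (fun s => Real.exp (∫ u in s..T, rho u)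
      * (rho s * (if τ i ≤ s then f i else 0))) volume t T :=
      (intervalIntegrable_mul_step hr (τ i) (f i)).continuousOn_mul hexp
    rw [← intervalIntegral.integral_add_adjacent_intervals
      (hint.mono_set (uIcc_subset_uIcc left_mem_uIcc hiu))
      (hint.mono_set (uIcc_subset_uIcc hiu right_mem_uIcc))]
    have e1 : ∫ s in t..τ i, Real.exp (∫ u in s..T, rho u)
        * (rho s * (if τ i ≤ s then f i else 0)) = 0 := by
      rw [intervalIntegral.integral_of_le hi'.1, integral_Ioc_eq_integral_Ioo]
      refine setIntegral_eq_zero_of_forall_eq_zero fun s hs => ?_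
      rw [if_neg (not_le.2 hs.2), mul_zero, mul_zero]
    have e2 : ∫ s in τ i..T, Real.exp (∫ u in s..T, rho u)
        * (rho s * (if τ i ≤ s then f i else 0))
        = ∫ s in τ i..T, f i * (Real.exp (∫ u in s..T, rho u) * rho s) := by
      refine intervalIntegral.integral_congr fun s hs => ?_
      rw [uIcc_of_le hi'.2] at hs
      rw [if_pos hs.1]; ring
    rw [e1, e2, intervalIntegral.integral_const_mul, zero_add, integral_exp_mul_rho hi'.2
      (hr.mono_set (uIcc_subset_uIcc hiu right_mem_uIcc))
      (fun s hs => hK s ⟨hi'.1.trans hs.1, hs.2⟩)]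
  have hJ : ∫ s in t..T, Real.exp (∫ u in s..T, rho u) * (rho s * jumpSum I τ f s)
      = ∑ i ∈ I, f i * (Real.exp (∫ u in τ i..T, rho u) - 1) := by
    have e : ∀ s, Real.exp (∫ u in s..T, rho u) * (rho s * jumpSum I τ f s)
        = ∑ i ∈ I, Real.exp (∫ u in s..T, rho u) * (rho s * (if τ i ≤ s then f i else 0)) :=
      fun s => by rw [jumpSum, Finset.mul_sum, Finset.mul_sum]
    simp_rw [e]
    rw [intervalIntegral.integral_finsetSum fun i _ =>
      (intervalIntegrable_mul_step hr (τ i) (f i)).continuousOn_mul hexp]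
    exact Finset.sum_congr rfl hstep
  have hsplit : ∫ s in t..T, Real.exp (∫ u in s..T, rho u) * b s
      = (∫ s in t..T, Real.exp (∫ u in s..T, rho u) * a s)
        + x * (Real.exp (∫ u in t..T, rho u) - 1)
        - ∑ i ∈ I, f i * (Real.exp (∫ u in τ i..T, rho u) - 1) := by
    rw [← integral_exp_mul_rho htT hr hK, ← hJ, ← intervalIntegral.integral_const_mul,
      ← intervalIntegral.integral_add (ha.continuousOn_mul hexp)
        ((hr.continuousOn_mul hexp).const_mul x), ← intervalIntegral.integral_sub
        ((ha.continuousOn_mul hexp).add ((hr.continuousOn_mul hexp).const_mul x))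
        ((intervalIntegrable_mul_jumpSum hr I τ f).continuousOn_mul hexp)]
    congr 1
    ext s
    rw [hb]; ring
  have hjT : jumpSum I τ f T = ∑ i ∈ I, f i :=
    Finset.sum_congr rfl fun i hi => if_pos (hτ i hi).2
  rw [(hX T hTm).2]
  change x + z T - _ = _
  rw [key, hsplit, hjT]
  have : ∑ i ∈ I, f i * (Real.exp (∫ u in τ i..T, rho u) - 1)
      = ∑ i ∈ I, Real.exp (∫ u in τ i..T, rho u) * f i - ∑ i ∈ I, f i := by
    rw [← Finset.sum_sub_distrib]
    exact Finset.sum_congr rfl fun i _ => by ring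
  rw [this]; ring

end JumpODE

/-! ### Interest rates, claim shares and their integrability. -/

theorem measurable_indicator_of_domRestrict {α : Type*} [MeasurableSpace α] {S : Set α} {f : α → ℝ}
    (hS : MeasurableSet S) (hf : Measurable (S.domRestrict f)) : Measurable (S.indicator f) := by
  refine measurable_of_restrict_of_restrict_compl hS ?_ ?_
  · convert! hf using 1
    ext z
    exact indicator_of_mem z.2 f
  · convert! (measurable_const (a := (0 : ℝ))) using 1
    ext z
    exact indicator_of_notMem z.2 f

namespace Market

variable (M : Market)

/-- An interest rate as in the standing assumptions. -/
structure IsRate (rho : ℝ → ℝ) : Prop where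
  meas : Measurable ((Icc 0 M.T).domRestrict rho)
  pos : ∀ s ∈ Icc 0 M.T, 0 < rho s
  bdd : ∃ K, ∀ s ∈ Icc 0 M.T, rho s ≤ K

/-- A part of each claim, measurable in time and size. -/
structure IsClaimShare (f : ℝ → ℝ → ℝ) : Prop where
  meas : Measurable ((Icc 0 M.T ×ˢ Ici 0).domRestrict (Function.uncurry f))
  mem : ∀ s ∈ Icc 0 M.T, ∀ y, 0 ≤ y → 0 ≤ f s y ∧ f s y ≤ y

theorem isRate_rhoI : M.IsRate M.rhoI := ⟨M.rhoI_meas, M.rhoI_pos, M.rhoI_bdd⟩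
theorem isRate_rho1 : M.IsRate M.rho1 := ⟨M.rho1_meas, M.rho1_pos, M.rho1_bdd⟩
theorem isRate_rho2 : M.IsRate M.rho2 := ⟨M.rho2_meas, M.rho2_pos, M.rho2_bdd⟩

/-- The accumulation factor from time `s` to the horizon. -/
noncomputable def growth (rho : ℝ → ℝ) (s : ℝ) : ℝ := Real.exp (∫ u in s..M.T, rho u)

theorem growth_pos (rho : ℝ → ℝ) (s : ℝ) : 0 < M.growth rho s := Real.exp_pos _

variable {M}

namespace IsRate

variable {rho : ℝ → ℝ}

theorem exists_abs_le (h : M.IsRate rho) : ∃ K, ∀ s ∈ Icc 0 M.T, |rho s| ≤ K := by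
  obtain ⟨K, hK⟩ := h.bdd
  exact ⟨K, fun s hs => by rw [abs_of_pos (h.pos s hs)]; exact hK s hs⟩

theorem integrableOn (h : M.IsRate rho) : IntegrableOn rho (Icc 0 M.T) := by
  obtain ⟨K, hK⟩ := h.exists_abs_le
  refine IntegrableOn.of_bound (by simp)
    (aemeasurable_restrict_of_measurable_subtype measurableSet_Icc h.meas).aestronglyMeasurable K ?_
  exact ae_restrict_of_forall_mem measurableSet_Icc hK

theorem intervalIntegrable (h : M.IsRate rho) {s u : ℝ} (hs : s ∈ Icc 0 M.T)
    (hu : u ∈ Icc 0 M.T) : IntervalIntegrable rho volume s u :=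
  (h.integrableOn.mono_set (uIcc_subset_Icc hs hu)).intervalIntegrable

theorem continuousOn_growth (h : M.IsRate rho) : ContinuousOn (M.growth rho) (Icc 0 M.T) := by
  have h1 : ContinuousOn (fun s => ∫ u in (0 : ℝ)..s, rho u) (Icc 0 M.T) := by
    have := intervalIntegral.continuousOn_primitive_interval (μ := volume) (f := rho) (a := 0)
      (b := M.T) (by rw [uIcc_of_le M.T_pos.le]; exact h.integrableOn)
    rwa [uIcc_of_le M.T_pos.le] at this
  have h2 : ContinuousOn (fun s => Real.exp ((∫ u in (0 : ℝ)..M.T, rho u)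
      - ∫ u in (0 : ℝ)..s, rho u)) (Icc 0 M.T) := (continuousOn_const.sub h1).rexp
  refine h2.congr fun s hs => ?_
  unfold growth
  congr 1
  have := intervalIntegral.integral_add_adjacent_intervals
    (h.intervalIntegrable ⟨le_rfl, M.T_pos.le⟩ hs)
    (h.intervalIntegrable hs (IsClaimModel.T_mem M))
  linarith

theorem exists_growth_le (h : M.IsRate rho) : ∃ C, ∀ s ∈ Icc 0 M.T, M.growth rho s ≤ C := by
  obtain ⟨C, hC⟩ := isCompact_Icc.exists_bound_of_continuousOn h.continuousOn_growth
  exact ⟨C, fun s hs => (le_abs_self _).trans (hC s hs)⟩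

theorem measurable_indicator_growth (h : M.IsRate rho) :
    Measurable ((Icc 0 M.T).indicator (M.growth rho)) :=
  measurable_indicator_of_domRestrict measurableSet_Icc
    (continuousOn_iff_continuous_domRestrict.1 h.continuousOn_growth).measurable

end IsRate

namespace IsClaimShare

variable {f : ℝ → ℝ → ℝ}

theorem measurableSet_domain (M : Market) :
    MeasurableSet (Icc 0 M.T ×ˢ Ici 0 : Set (ℝ × ℝ)) := measurableSet_Icc.prod measurableSet_Ici

/-- The extension of the share by zero. -/
noncomputable def _root_.Market.extendZero (M : Market) (f : ℝ → ℝ → ℝ) : ℝ × ℝ → ℝ :=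
  (Icc 0 M.T ×ˢ Ici 0 : Set (ℝ × ℝ)).indicator (Function.uncurry f)

theorem extendZero_of_mem {s y : ℝ} (hs : s ∈ Icc 0 M.T) (hy : 0 ≤ y) :
    M.extendZero f (s, y) = f s y := indicator_of_mem (mk_mem_prod hs (mem_Ici.2 hy)) _

theorem measurable_extendZero (h : M.IsClaimShare f) : Measurable (M.extendZero f) :=
  measurable_indicator_of_domRestrict (measurableSet_domain M) h.meas

theorem extendZero_mem (h : M.IsClaimShare f) (z : ℝ × ℝ) :
    0 ≤ M.extendZero f z ∧ M.extendZero f z ≤ |z.2| := by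
  by_cases hz : z ∈ (Icc 0 M.T ×ˢ Ici 0 : Set (ℝ × ℝ))
  · obtain ⟨s, y⟩ := z
    rw [extendZero_of_mem hz.1 hz.2]
    exact ⟨(h.mem s hz.1 y hz.2).1, ((h.mem s hz.1 y hz.2).2).trans (le_abs_self _)⟩
  · unfold extendZero
    rw [indicator_of_notMem hz]
    exact ⟨le_rfl, abs_nonneg _⟩

theorem ae_extendZero_eq {s : ℝ} (hs : s ∈ Icc 0 M.T) :
    (fun y => M.extendZero f (s, y)) =ᵐ[M.nu] f s :=
  M.ae_nu_pos.mono fun _ hy => extendZero_of_mem hs hy.le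

theorem aestronglyMeasurable (h : M.IsClaimShare f) {s : ℝ} (hs : s ∈ Icc 0 M.T) :
    AEStronglyMeasurable (f s) M.nu :=
  ((h.measurable_extendZero.comp measurable_prodMk_left).aestronglyMeasurable).congr
    (ae_extendZero_eq hs)

theorem integrable (h : M.IsClaimShare f) {s : ℝ} (hs : s ∈ Icc 0 M.T) :
    Integrable (f s) M.nu :=
  M.integrable_of_le_id (h.aestronglyMeasurable hs) (h.mem s hs)

theorem integrable_sq (h : M.IsClaimShare f) {s : ℝ} (hs : s ∈ Icc 0 M.T) :
    Integrable (fun y => f s y ^ 2) M.nu :=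
  M.integrable_sq_of_le_id (h.aestronglyMeasurable hs) (h.mem s hs)

theorem integrable_extendZero (h : M.IsClaimShare f) : Integrable (M.extendZero f) M.intensity := by
  have h1 : Integrable (fun z : ℝ × ℝ => |z.2|) M.intensity := by
    unfold intensity
    exact (M.integrable_id_nu.comp_snd (volume.restrict (Icc 0 M.T))).abs
  refine h1.mono' h.measurable_extendZero.aestronglyMeasurable (ae_of_all _ fun z => ?_)
  rw [Real.norm_of_nonneg (h.extendZero_mem z).1]
  exact (h.extendZero_mem z).2

theorem integrable_extendZero_sq (h : M.IsClaimShare f) :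
    Integrable (fun z => M.extendZero f z ^ 2) M.intensity := by
  have h1 : Integrable (fun z : ℝ × ℝ => z.2 ^ 2) M.intensity := by
    unfold intensity
    exact M.integrable_sq_nu.comp_snd (volume.restrict (Icc 0 M.T))
  refine h1.mono' (h.measurable_extendZero.pow_const 2).aestronglyMeasurable
    (ae_of_all _ fun z => ?_)
  rw [Real.norm_of_nonneg (sq_nonneg _), ← sq_abs z.2]
  exact pow_le_pow_left₀ (h.extendZero_mem z).1 (h.extendZero_mem z).2 2

theorem integrableOn_integral (h : M.IsClaimShare f) :
    IntegrableOn (fun s => ∫ y, f s y ∂M.nu) (Icc 0 M.T) := by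
  refine (h.integrable_extendZero.integral_prod_left).congr ?_
  exact ae_restrict_of_forall_mem measurableSet_Icc fun s hs =>
    integral_congr_ae (ae_extendZero_eq hs)

theorem integrableOn_integral_sq (h : M.IsClaimShare f) :
    IntegrableOn (fun s => ∫ y, f s y ^ 2 ∂M.nu) (Icc 0 M.T) := by
  refine (h.integrable_extendZero_sq.integral_prod_left).congr ?_
  exact ae_restrict_of_forall_mem measurableSet_Icc fun s hs =>
    integral_congr_ae ((ae_extendZero_eq hs).fun_comp (· ^ 2))

end IsClaimShare

/-- The share `f` of the claims after time `t`, valued at the horizon. -/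
noncomputable def accumulated (M : Market) (rho : ℝ → ℝ) (f : ℝ → ℝ → ℝ) (t : ℝ) (z : ℝ × ℝ) : ℝ :=
  (Ioc t M.T).indicator 1 z.1 * (Icc 0 M.T).indicator (M.growth rho) z.1 * M.extendZero f z

section Accumulated

variable {rho : ℝ → ℝ} {f : ℝ → ℝ → ℝ} {t : ℝ}

theorem indicator_growth_nonneg (rho : ℝ → ℝ) (s : ℝ) :
    0 ≤ (Icc 0 M.T).indicator (M.growth rho) s :=
  indicator_nonneg (fun s _ => (M.growth_pos rho s).le) s

theorem accumulated_nonneg (hf : M.IsClaimShare f) (z : ℝ × ℝ) : 0 ≤ M.accumulated rho f t z :=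
  mul_nonneg (mul_nonneg (indicator_nonneg (fun _ _ => zero_le_one) _)
    (indicator_growth_nonneg rho _)) (hf.extendZero_mem z).1

theorem measurable_accumulated (hr : M.IsRate rho) (hf : M.IsClaimShare f) :
    Measurable (M.accumulated rho f t) :=
  (((measurable_one.indicator measurableSet_Ioc).comp measurable_fst).mul
    (hr.measurable_indicator_growth.comp measurable_fst)).mul hf.measurable_extendZero

theorem exists_accumulated_le (hr : M.IsRate rho) (hf : M.IsClaimShare f) :
    ∃ C, 0 ≤ C ∧ ∀ z, M.accumulated rho f t z ≤ C * M.extendZero f z := by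
  obtain ⟨C, hC⟩ := hr.exists_growth_le
  have hC0 : 0 ≤ C := (M.growth_pos rho 0).le.trans (hC 0 ⟨le_rfl, M.T_pos.le⟩)
  refine ⟨C, hC0, fun z => mul_le_mul_of_nonneg_right ?_ (hf.extendZero_mem z).1⟩
  have h1 : (Ioc t M.T).indicator (1 : ℝ → ℝ) z.1 ≤ 1 :=
    indicator_le_self' (fun _ _ => zero_le_one) _
  have h2 : (Icc 0 M.T).indicator (M.growth rho) z.1 ≤ C := indicator_le' hC (fun _ _ => hC0) _
  calc _ ≤ 1 * C := mul_le_mul h1 h2 (indicator_growth_nonneg rho _) zero_le_one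
    _ = C := one_mul C

theorem integrable_accumulated (hr : M.IsRate rho) (hf : M.IsClaimShare f) :
    Integrable (M.accumulated rho f t) M.intensity := by
  obtain ⟨C, -, hC⟩ := exists_accumulated_le (t := t) hr hf
  refine (hf.integrable_extendZero.const_mul C).mono'
    (measurable_accumulated hr hf).aestronglyMeasurable (ae_of_all _ fun z => ?_)
  rw [Real.norm_of_nonneg (accumulated_nonneg hf z)]
  exact hC z

theorem integrable_accumulated_sq (hr : M.IsRate rho) (hf : M.IsClaimShare f) :
    Integrable (fun z => M.accumulated rho f t z ^ 2) M.intensity := by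
  obtain ⟨C, -, hC⟩ := exists_accumulated_le (t := t) hr hf
  refine (hf.integrable_extendZero_sq.const_mul (C ^ 2)).mono'
    ((measurable_accumulated hr hf).pow_const 2).aestronglyMeasurable (ae_of_all _ fun z => ?_)
  rw [Real.norm_of_nonneg (sq_nonneg _), ← mul_pow]
  exact pow_le_pow_left₀ (accumulated_nonneg hf z) (hC z) 2

theorem setIntegral_indicator_Ioc (ht : t ∈ Icc 0 M.T) (F : ℝ → ℝ) :
    ∫ s in Icc 0 M.T, (Ioc t M.T).indicator F s = ∫ s in t..M.T, F s := by
  rw [setIntegral_indicator measurableSet_Ioc, intervalIntegral.integral_of_le ht.2,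
    inter_eq_right.2 (show Ioc t M.T ⊆ Icc 0 M.T from fun s hs => ⟨ht.1.trans hs.1.le, hs.2⟩)]

theorem integral_accumulated (hr : M.IsRate rho) (hf : M.IsClaimShare f) (ht : t ∈ Icc 0 M.T) :
    ∫ z, M.accumulated rho f t z ∂M.intensity
      = ∫ s in t..M.T, M.growth rho s * ∫ y, f s y ∂M.nu := by
  have h := integral_prod _ (show Integrable (M.accumulated rho f t)
    ((volume.restrict (Icc 0 M.T)).prod M.nu) from integrable_accumulated hr hf)
  unfold intensity
  rw [h, ← setIntegral_indicator_Ioc ht]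
  refine setIntegral_congr_fun measurableSet_Icc fun s hs => ?_
  simp only [accumulated]
  rw [integral_const_mul, integral_congr_ae (IsClaimShare.ae_extendZero_eq hs),
    indicator_of_mem hs]
  by_cases hst : s ∈ Ioc t M.T
  · simp [indicator_of_mem hst]
  · simp [indicator_of_notMem hst]

theorem integral_accumulated_sq (hr : M.IsRate rho) (hf : M.IsClaimShare f) (ht : t ∈ Icc 0 M.T) :
    ∫ z, M.accumulated rho f t z ^ 2 ∂M.intensity
      = ∫ s in t..M.T, M.growth rho s ^ 2 * ∫ y, f s y ^ 2 ∂M.nu := by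
  have h := integral_prod _ (show Integrable (fun z => M.accumulated rho f t z ^ 2)
    ((volume.restrict (Icc 0 M.T)).prod M.nu) from integrable_accumulated_sq hr hf)
  unfold intensity
  rw [h, ← setIntegral_indicator_Ioc ht]
  refine setIntegral_congr_fun measurableSet_Icc fun s hs => ?_
  simp only [accumulated, mul_pow]
  have he : ∫ y, M.extendZero f (s, y) ^ 2 ∂M.nu = ∫ y, f s y ^ 2 ∂M.nu :=
    integral_congr_ae ((IsClaimShare.ae_extendZero_eq hs).fun_comp (· ^ 2))
  rw [integral_const_mul, he, indicator_of_mem hs]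
  by_cases hst : s ∈ Ioc t M.T
  · simp [indicator_of_mem hst]
  · simp [indicator_of_notMem hst]

end Accumulated

end Market

/-! ### The mean-variance objective as a time integral. -/

namespace IsClaimModel

variable {M : Market} {Ω : Type*} [MeasurableSpace Ω] {P : Measure Ω} {N : ℝ → Ω → ℕ}
  {Y : ℕ → Ω → ℝ} {rho a : ℝ → ℝ} {f : ℝ → ℝ → ℝ} {t : ℝ}

/-- Makes the index set independent of `s`, so that along a fixed path the surplus equation is an
equation with finitely many given jumps. -/
theorem claimSum_eq_jumpSum (h : IsClaimModel M P N Y) (ht : 0 ≤ t) {s : ℝ} (hs : s ∈ Icc t M.T)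
    (f : ℝ → ℝ → ℝ) (ω : Ω) : claimSum M N Y f t s ω = jumpSum (Finset.Ico (N t ω) (N M.T ω))
      (fun i => arrivalTime M N (i + 1) ω) (fun i => f (arrivalTime M N (i + 1) ω) (Y i ω)) s := by
  have hsT : s ∈ Icc 0 M.T := ⟨ht.trans hs.1, hs.2⟩
  have hle : N s ω ≤ N M.T ω := h.count_mono ω hsT (T_mem M) hs.2
  unfold claimSum jumpSum
  rw [← Finset.sum_filter]
  refine Finset.sum_congr ?_ fun _ _ => rfl
  ext i
  simp only [Finset.mem_Ico, Finset.mem_filter]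
  constructor
  · rintro ⟨h1, h2⟩
    have hi := h2.trans_le hle
    exact ⟨⟨h1, hi⟩, (h.arrivalTime_le_iff hi hsT).2 h2⟩
  · rintro ⟨⟨h1, h2⟩, h3⟩
    exact ⟨h1, (h.arrivalTime_le_iff h2 hsT).1 h3⟩

theorem ae_claim_nonneg (h : IsClaimModel M P N Y) : ∀ᵐ ω ∂P, ∀ i, 0 ≤ Y i ω := by
  rw [ae_all_iff]
  intro i
  have := ae_expMeasure_pos M.beta
  rw [← (h.claim_law i).map_eq] at this
  exact (ae_of_ae_map (h.claim_meas i).aemeasurable this).mono fun ω hω => hω.le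

/-- The surplus at the horizon. -/
theorem surplus_ae_eq (h : IsClaimModel M P N Y) (hr : M.IsRate rho)
    (ha : IntegrableOn a (Icc 0 M.T)) (ht : t ∈ Icc 0 M.T) (x : ℝ) :
    surplus M P N Y rho a f t x M.T =ᵐ[P] fun ω => x * M.growth rho t
      + (∫ s in t..M.T, M.growth rho s * a s) - claimTotal M N Y (M.accumulated rho f t) ω := by
  have hrt := hr.intervalIntegrable ht (T_mem M)
  have hat : IntervalIntegrable a volume t M.T :=
    (ha.mono_set (uIcc_subset_Icc ht (T_mem M))).intervalIntegrable
  obtain ⟨K, hK⟩ := hr.exists_abs_le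
  have hK' : ∀ s ∈ Icc t M.T, |rho s| ≤ K := fun s hs => hK s ⟨ht.1.trans hs.1, hs.2⟩
  have hex : ∃ X, IsSurplus M P N Y rho a f t x X := by
    have := fun ω => exists_jump_solution ht.2 hrt hK' hat (Finset.Ico (N t ω) (N M.T ω))
      (fun i => arrivalTime M N (i + 1) ω) (fun i => f (arrivalTime M N (i + 1) ω) (Y i ω)) x
    choose X hX using this
    refine ⟨fun s ω => X ω s, ae_of_all _ fun ω s hs => ?_⟩
    rw [h.claimSum_eq_jumpSum ht.1 hs]
    exact hX ω s hs
  -- `surplus` is an arbitrary choice that satisfies its equation only because a solution exists. No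
  -- measurability of the chosen process is known; only its value at `T` is used, and that is
  -- determined almost surely.
  have hspec : IsSurplus M P N Y rho a f t x (surplus M P N Y rho a f t x) :=
    Classical.epsilon_spec hex
  filter_upwards [hspec, h.ae_claim_nonneg] with ω hω hY
  have hτ : ∀ i ∈ Finset.Ico (N t ω) (N M.T ω), t < arrivalTime M N (i + 1) ω ∧
      arrivalTime M N (i + 1) ω ∈ Icc 0 M.T := by
    intro i hi
    rw [Finset.mem_Ico] at hi
    refine ⟨not_le.1 fun hle => ?_, (h.arrivalTime_mem hi.2).1⟩
    exact absurd ((h.arrivalTime_le_iff hi.2 ht).1 hle) (not_lt.2 hi.1)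
  have := jump_solution_eq ht.2 hrt hK' hat (Finset.Ico (N t ω) (N M.T ω))
      (fun i => arrivalTime M N (i + 1) ω) (fun i => f (arrivalTime M N (i + 1) ω) (Y i ω))
      (fun i hi => ⟨(hτ i hi).1.le, (hτ i hi).2.2⟩) x
      (X := fun s => surplus M P N Y rho a f t x s ω) fun s hs => by
        rw [← h.claimSum_eq_jumpSum ht.1 hs]
        exact hω s hs
  rw [this]
  congr 1
  unfold claimTotal
  rw [← Finset.sum_subset (s₁ := Finset.Ico (N t ω) (N M.T ω)) (s₂ := Finset.range (N M.T ω))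
    (f := fun i => M.accumulated rho f t (claimPoint M N Y i ω))
    (fun i hi => Finset.mem_range.2 (Finset.mem_Ico.1 hi).2)]
  · refine Finset.sum_congr rfl fun i hi => ?_
    obtain ⟨h1, h2⟩ := hτ i hi
    unfold claimPoint Market.accumulated
    simp only
    rw [Market.IsClaimShare.extendZero_of_mem h2 (hY i), indicator_of_mem h2,
      indicator_of_mem (show _ ∈ Ioc t M.T from ⟨h1, h2.2⟩), Pi.one_apply, one_mul]
    rfl
  · intro i hi hni
    have hi := Finset.mem_range.1 hi
    have hlt : i < N t ω := by
      rw [Finset.mem_Ico, not_and_or] at hni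
      rcases hni with h1 | h1
      · exact not_le.1 h1
      · exact absurd hi h1
    have hle := (h.arrivalTime_le_iff hi ht).2 hlt
    unfold claimPoint Market.accumulated
    simp only
    -- Claims arriving at or before `t`, including at `t` itself, are removed by the indicator of
    -- `(t, T]`.
    rw [indicator_of_notMem (fun hm => absurd hm.1 (not_lt.2 hle)), zero_mul, zero_mul]

/-- The mean-variance objective as a time integral. -/
theorem meanVariance_eq [IsProbabilityMeasure P] (h : IsClaimModel M P N Y) (hr : M.IsRate rho)
    (ha : IntegrableOn a (Icc 0 M.T)) (hf : M.IsClaimShare f) (ht : t ∈ Icc 0 M.T) (γ x : ℝ) :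
    meanVariance M P N Y γ rho a f t x = x * M.growth rho t
      + ∫ s in t..M.T, M.growth rho s * (a s - (∫ y, f s y ∂M.nu)
        - γ * M.growth rho s / 2 * ∫ y, f s y ^ 2 ∂M.nu) := by
  obtain ⟨c1, c2, c3⟩ := h.campbell (Market.measurable_accumulated (t := t) hr hf)
    (Market.accumulated_nonneg hf) (Market.integrable_accumulated hr hf)
    (Market.integrable_accumulated_sq hr hf)
  have hs := h.surplus_ae_eq (f := f) hr ha ht x
  have hsub : uIcc t M.T ⊆ Icc 0 M.T := uIcc_subset_Icc ht (T_mem M)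
  have hg := hr.continuousOn_growth.mono hsub
  have i1 : IntervalIntegrable (fun s => M.growth rho s * a s) volume t M.T :=
    (ha.mono_set hsub).intervalIntegrable.continuousOn_mul hg
  have i2 : IntervalIntegrable (fun s => M.growth rho s * ∫ y, f s y ∂M.nu) volume t M.T :=
    (hf.integrableOn_integral.mono_set hsub).intervalIntegrable.continuousOn_mul hg
  have i3 : IntervalIntegrable (fun s => M.growth rho s ^ 2 * ∫ y, f s y ^ 2 ∂M.nu) volume t M.T :=
    (hf.integrableOn_integral_sq.mono_set hsub).intervalIntegrable.continuousOn_mul (hg.pow 2)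
  unfold meanVariance
  -- Initial value and drift are deterministic and drop out of the variance, so the objective is
  -- additive over time.
  rw [integral_congr_ae hs, variance_congr hs, variance_const_sub c1.aestronglyMeasurable, c3,
    integral_sub (integrable_const _) (c1.integrable one_le_two), c2, integral_const,
    Market.integral_accumulated hr hf ht, Market.integral_accumulated_sq hr hf ht]
  have : (fun s => M.growth rho s * (a s - (∫ y, f s y ∂M.nu)
        - γ * M.growth rho s / 2 * ∫ y, f s y ^ 2 ∂M.nu))
      = fun s => M.growth rho s * a s - M.growth rho s * (∫ y, f s y ∂M.nu)
        - γ / 2 * (M.growth rho s ^ 2 * ∫ y, f s y ^ 2 ∂M.nu) := by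
    ext s; ring
  rw [this, intervalIntegral.integral_sub (i1.sub i2) (i3.const_mul _),
    intervalIntegral.integral_sub i1 i2, intervalIntegral.integral_const_mul]
  simp
  ring

end IsClaimModel

/-! ### From the liminf condition to inequalities at almost every time. -/

section Liminf

theorem liminf_nonneg_of_forall {D : ℝ → ℝ} (h : ∀ ε > 0, 0 ≤ D ε) :
    0 ≤ liminf (fun ε : ℝ => ((1 / ε * D ε : ℝ) : EReal)) (𝓝[>] 0) := by
  refine le_liminf_of_le (by isBoundedDefault) ?_
  filter_upwards [self_mem_nhdsWithin] with ε hε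
  have hε : 0 < ε := hε
  exact_mod_cast mul_nonneg (by positivity) (h ε hε)

theorem integral_sub_integral_ite {T t ε : ℝ} {F G : ℝ → ℝ} (hF : IntegrableOn F (Icc 0 T))
    (hG : IntegrableOn G (Icc 0 T)) (ht : 0 ≤ t) (hε : 0 < ε) (hT : t + ε < T) :
    (∫ s in t..T, F s) - (∫ s in t..T, if t ≤ s ∧ s < t + ε then G s else F s)
      = ∫ s in t..(t + ε), (F s - G s) := by
  have hm : ∀ {u v}, u ∈ Icc 0 T → v ∈ Icc 0 T → uIcc u v ⊆ Icc 0 T :=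
    fun hu hv => uIcc_subset_Icc hu hv
  have m1 : t ∈ Icc 0 T := ⟨ht, by linarith⟩
  have m2 : t + ε ∈ Icc 0 T := ⟨by linarith, hT.le⟩
  have m3 : T ∈ Icc 0 T := ⟨by linarith, le_rfl⟩
  have iF : ∀ {u v}, u ∈ Icc 0 T → v ∈ Icc 0 T → IntervalIntegrable F volume u v :=
    fun hu hv => (hF.mono_set (hm hu hv)).intervalIntegrable
  have iG : ∀ {u v}, u ∈ Icc 0 T → v ∈ Icc 0 T → IntervalIntegrable G volume u v :=
    fun hu hv => (hG.mono_set (hm hu hv)).intervalIntegrable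
  set H := fun s => if t ≤ s ∧ s < t + ε then G s else F s with hH
  -- The deviation lives on `[t, t + ε)`, the interval integral on `(t, t + ε]`; the endpoint is a
  -- null set.
  have e1 : ∀ᵐ s, s ∈ uIoc t (t + ε) → G s = H s := by
    have : ∀ᵐ s : ℝ, s ≠ t + ε := by simp [ae_iff, measure_singleton]
    filter_upwards [this] with s hs hmem
    rw [uIoc_of_le (by linarith)] at hmem
    exact (if_pos ⟨hmem.1.le, lt_of_le_of_ne hmem.2 hs⟩).symm
  have e2 : ∀ s, s ∈ uIoc (t + ε) T → F s = H s := by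
    intro s hmem
    rw [uIoc_of_le hT.le] at hmem
    exact (if_neg fun h => absurd h.2 (not_lt.2 hmem.1.le)).symm
  have iH1 : IntervalIntegrable H volume t (t + ε) :=
    (iG m1 m2).congr_ae ((ae_restrict_iff' measurableSet_uIoc).2 e1)
  have iH2 : IntervalIntegrable H volume (t + ε) T := (iF m2 m3).congr e2
  rw [← intervalIntegral.integral_add_adjacent_intervals (iF m1 m2) (iF m2 m3),
    ← intervalIntegral.integral_add_adjacent_intervals iH1 iH2,
    intervalIntegral.integral_sub (iF m1 m2) (iG m1 m2),
    intervalIntegral.integral_congr_ae e1, intervalIntegral.integral_congr_ae (ae_of_all _ e2)]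
  ring

/-- If perturbing `F` to `G` on short intervals is never profitable, then `G ≤ F` almost
everywhere. -/
theorem ae_le_of_liminf_nonneg {T : ℝ} (hT : 0 < T) {F G : ℝ → ℝ} (hF : IntegrableOn F (Icc 0 T))
    (hG : IntegrableOn G (Icc 0 T))
    (h : ∀ t ∈ Icc 0 T, 0 ≤ liminf (fun ε : ℝ => ((1 / ε * ((∫ s in t..T, F s)
      - (∫ s in t..T, if t ≤ s ∧ s < t + ε then G s else F s)) : ℝ) : EReal)) (𝓝[>] 0)) :
    ∀ᵐ t ∂(volume.restrict (Icc 0 T)), G t ≤ F t := by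
  have hi : IntervalIntegrable (fun s => F s - G s) volume 0 T :=
    ((hF.sub hG).mono_set (uIcc_subset_Icc ⟨le_rfl, hT.le⟩ ⟨hT.le, le_rfl⟩)).intervalIntegrable
  have hne : ∀ᵐ s : ℝ, s ≠ T := by simp [ae_iff, measure_singleton]
  rw [ae_restrict_iff' measurableSet_Icc]
  filter_upwards [hi.ae_hasDerivAt_integral, hne] with t hder htT ht
  have htu : t ∈ uIcc 0 T := by rwa [uIcc_of_le hT.le]
  have hd := hder htu t htu
  have htT : t < T := lt_of_le_of_ne ht.2 htT
  -- Lebesgue differentiation: for almost every `t` the liminf is the limit `F t - G t`.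
  have hlim : Tendsto (fun ε : ℝ => 1 / ε * ∫ s in t..(t + ε), (F s - G s)) (𝓝[>] 0)
      (𝓝 (F t - G t)) := by
    have := hd.tendsto_slope_zero_right
    simpa [smul_eq_mul] using this
  have hev : (fun ε : ℝ => 1 / ε * ∫ s in t..(t + ε), (F s - G s)) =ᶠ[𝓝[>] 0]
      fun ε : ℝ => 1 / ε * ((∫ s in t..T, F s)
        - (∫ s in t..T, if t ≤ s ∧ s < t + ε then G s else F s)) := by
    have h1 : ∀ᶠ ε : ℝ in 𝓝[>] 0, ε < T - t :=
      mem_nhdsWithin_of_mem_nhds (Iio_mem_nhds (by linarith))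
    filter_upwards [self_mem_nhdsWithin, h1] with ε hε hε2
    rw [integral_sub_integral_ite hF hG ht.1 hε (by linarith)]
  have hlim2 := (continuous_coe_real_ereal.tendsto _).comp (hlim.congr' hev)
  have h0 := h t ht
  have h1 := hlim2.liminf_eq
  simp only [Function.comp_def] at h1
  rw [h1] at h0
  have : 0 ≤ F t - G t := by exact_mod_cast h0
  linarith

/-- Interchanges "for every action" and "for almost every time": a countable dense set of actions
costs only a null set, and continuity extends the inequality to `S`. -/
theorem ae_forall_le_of_continuousOn {α Ω : Type*} [TopologicalSpace α]
    [SecondCountableTopology α] [MeasurableSpace Ω] {μ : Measure Ω} {S : Set α}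
    {g : α → Ω → ℝ} {c : Ω → ℝ} (hg : ∀ᵐ t ∂μ, ContinuousOn (fun a => g a t) S)
    (h : ∀ a ∈ S, ∀ᵐ t ∂μ, g a t ≤ c t) : ∀ᵐ t ∂μ, ∀ a ∈ S, g a t ≤ c t := by
  obtain ⟨D, hD, hDd⟩ := TopologicalSpace.exists_countable_dense S
  have h1 : ∀ᵐ t ∂μ, ∀ a ∈ D, g a t ≤ c t := (ae_ball_iff hD).2 fun a _ => h a a.2
  filter_upwards [hg, h1] with t ht1 ht2 a ha
  have hcl : IsClosed {a : S | g a t ≤ c t} :=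
    isClosed_le (continuousOn_iff_continuous_domRestrict.1 ht1) continuous_const
  have : closure D ⊆ {a : S | g a t ≤ c t} := closure_minimal ht2 hcl
  exact this (hDd ⟨a, ha⟩)

end Liminf

/-! ### The insurer: gain rate, optimal treaty, equilibrium. -/

namespace Market

variable {M : Market}

theorem kI_eq (s : ℝ) : M.kI s = M.gammaI * M.growth M.rhoI s := rfl
theorem k1_eq (s : ℝ) : M.k1 s = M.gamma1 * M.growth M.rho1 s := rfl
theorem k2_eq (s : ℝ) : M.k2 s = M.gamma2 * M.growth M.rho2 s := rfl

theorem kI_pos (s : ℝ) : 0 < M.kI s := mul_pos M.gammaI_pos (M.growth_pos _ s)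
theorem k1_pos (s : ℝ) : 0 < M.k1 s := mul_pos M.gamma1_pos (M.growth_pos _ s)
theorem k2_pos (s : ℝ) : 0 < M.k2 s := mul_pos M.gamma2_pos (M.growth_pos _ s)

theorem Admissible1.pos {xi1 : ℝ → ℝ} (h : M.Admissible1 xi1) {s : ℝ} (hs : s ∈ Icc 0 M.T) :
    0 < xi1 s := (mul_pos M.theta_pos M.beta_pos).trans_le (h.2 s hs).1

theorem Admissible2.pos {xi2 : ℝ → ℝ} (h : M.Admissible2 xi2) {s : ℝ} (hs : s ∈ Icc 0 M.T) :
    0 < xi2 s := M.theta_pos.trans_le (h.2 s hs).1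

section Share

variable {l : (ℝ → ℝ → ℝ) × (ℝ → ℝ → ℝ)}

theorem AdmissibleI.share1 (h : M.AdmissibleI l) : M.IsClaimShare l.1 :=
  ⟨h.1, fun s hs y hy => by obtain ⟨h1, h2, h3⟩ := h.2.2 s hs y hy; exact ⟨h1, by linarith⟩⟩

theorem AdmissibleI.share2 (h : M.AdmissibleI l) : M.IsClaimShare l.2 :=
  ⟨h.2.1, fun s hs y hy => by obtain ⟨h1, h2, h3⟩ := h.2.2 s hs y hy; exact ⟨h2, by linarith⟩⟩

theorem AdmissibleI.retained (h : M.AdmissibleI l) :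
    M.IsClaimShare (fun s y => y - l.1 s y - l.2 s y) :=
  ⟨((measurable_snd.comp measurable_subtype_coe).sub h.1).sub h.2.1, fun s hs y hy => by
    obtain ⟨h1, h2, h3⟩ := h.2.2 s hs y hy
    exact ⟨by linarith, by linarith⟩⟩

end Share

theorem integrableOn_bdd_mul {xi F : ℝ → ℝ} {c d : ℝ} (hx : Measurable ((Icc 0 M.T).domRestrict xi))
    (hb : ∀ t ∈ Icc 0 M.T, xi t ∈ Icc c d) (hF : IntegrableOn F (Icc 0 M.T)) :
    IntegrableOn (fun s => xi s * F s) (Icc 0 M.T) := by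
  refine Integrable.bdd_mul (c := max |c| |d|) hF
    (aemeasurable_restrict_of_measurable_subtype measurableSet_Icc hx).aestronglyMeasurable
    (ae_restrict_of_forall_mem measurableSet_Icc fun s hs => ?_)
  exact abs_le_max_abs_abs (hb s hs).1 (hb s hs).2

theorem integrableOn_premium1 {l1 : ℝ → ℝ → ℝ} {xi1 : ℝ → ℝ} (hl : M.IsClaimShare l1)
    (hx : M.Admissible1 xi1) : IntegrableOn (M.premium1 l1 xi1) (Icc 0 M.T) :=
  hl.integrableOn_integral.add (integrableOn_bdd_mul hx.1 hx.2 hl.integrableOn_integral_sq)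

theorem integrableOn_premium2 {l2 : ℝ → ℝ → ℝ} {xi2 : ℝ → ℝ} (hl : M.IsClaimShare l2)
    (hx : M.Admissible2 xi2) : IntegrableOn (M.premium2 l2 xi2) (Icc 0 M.T) := by
  have := hl.integrableOn_integral.add (integrableOn_bdd_mul hx.1 hx.2 hl.integrableOn_integral)
  refine this.congr (ae_of_all _ fun s => ?_)
  simp only [premium2, Pi.add_apply]; ring

theorem IsRate.integrableOn_growth_mul {rho F : ℝ → ℝ} (hr : M.IsRate rho)
    (hF : IntegrableOn F (Icc 0 M.T)) : IntegrableOn (fun s => M.growth rho s * F s) (Icc 0 M.T) :=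
  hF.continuousOn_mul hr.continuousOn_growth isCompact_Icc

theorem integrableOn_gain {rho a : ℝ → ℝ} {f : ℝ → ℝ → ℝ} (hr : M.IsRate rho)
    (ha : IntegrableOn a (Icc 0 M.T)) (hf : M.IsClaimShare f) (γ : ℝ) :
    IntegrableOn (fun s => M.growth rho s * (a s - (∫ y, f s y ∂M.nu)
        - γ * M.growth rho s / 2 * ∫ y, f s y ^ 2 ∂M.nu)) (Icc 0 M.T) := by
  refine hr.integrableOn_growth_mul ((ha.sub hf.integrableOn_integral).sub ?_)
  have := (hr.integrableOn_growth_mul hf.integrableOn_integral_sq).const_mul (γ / 2)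
  refine this.congr (ae_of_all _ fun s => ?_)
  ring

/-- Expected loss rate of the insurer from the claims at time `s`. -/
noncomputable def lossRate (M : Market) (l : (ℝ → ℝ → ℝ) × (ℝ → ℝ → ℝ)) (xi1 xi2 : ℝ → ℝ)
    (s : ℝ) : ℝ := ∫ y, cedingCost (M.kI s) (xi1 s) (xi2 s) y (l.1 s y) (l.2 s y) ∂M.nu

/-- Gain rate of the insurer, valued at the horizon. -/
noncomputable def gainI (M : Market) (l : (ℝ → ℝ → ℝ) × (ℝ → ℝ → ℝ)) (xi1 xi2 : ℝ → ℝ)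
    (s : ℝ) : ℝ := M.growth M.rhoI s * (M.theta * (∫ y, y ∂M.nu) - M.lossRate l xi1 xi2 s)

section Gain

variable {l : (ℝ → ℝ → ℝ) × (ℝ → ℝ → ℝ)} {xi1 xi2 : ℝ → ℝ}

theorem integrable_cedingCost (hl : M.AdmissibleI l) {s : ℝ} (hs : s ∈ Icc 0 M.T) (k x1 x2 : ℝ) :
    Integrable (fun y => cedingCost k x1 x2 y (l.1 s y) (l.2 s y)) M.nu :=
  (((hl.share1.integrable_sq hs).const_mul x1).add ((hl.share2.integrable hs).const_mul x2)).add
    ((hl.retained.integrable_sq hs).const_mul (k / 2))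

/-- The expected claims cancel between premiums and losses. There remain the insurer's own loading,
the loadings paid to the reinsurers and the variance penalty, whose coefficient `gammaI * growth` is
`kI`. The last two make up `cedingCost`. -/
theorem gainI_eq (hl : M.AdmissibleI l) {s : ℝ} (hs : s ∈ Icc 0 M.T) :
    M.gainI l xi1 xi2 s = M.growth M.rhoI s *
      ((M.premiumI - M.premium1 l.1 xi1 s - M.premium2 l.2 xi2 s)
        - (∫ y, (y - l.1 s y - l.2 s y) ∂M.nu)
        - M.gammaI * M.growth M.rhoI s / 2 * ∫ y, (y - l.1 s y - l.2 s y) ^ 2 ∂M.nu) := by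
  have i1 := hl.share1.integrable hs
  have i2 := hl.share2.integrable hs
  have i11 := hl.share1.integrable_sq hs
  have ir := hl.retained.integrable_sq hs
  have i0 := M.integrable_id_nu
  have e1 : ∫ y, (y - l.1 s y - l.2 s y) ∂M.nu
      = (∫ y, y ∂M.nu) - (∫ y, l.1 s y ∂M.nu) - ∫ y, l.2 s y ∂M.nu := by
    have i01 : Integrable (fun y => y - l.1 s y) M.nu := i0.sub i1
    rw [integral_sub i01 i2, integral_sub i0 i1]
  have j : Integrable (fun y => xi1 s * l.1 s y ^ 2 + xi2 s * l.2 s y) M.nu :=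
    (i11.const_mul _).add (i2.const_mul _)
  have e2 : M.lossRate l xi1 xi2 s = xi1 s * (∫ y, l.1 s y ^ 2 ∂M.nu)
      + xi2 s * (∫ y, l.2 s y ∂M.nu)
      + M.kI s / 2 * ∫ y, (y - l.1 s y - l.2 s y) ^ 2 ∂M.nu := by
    unfold lossRate cedingCost
    rw [integral_add j (ir.const_mul _), integral_add (i11.const_mul _) (i2.const_mul _),
      integral_const_mul, integral_const_mul, integral_const_mul]
  unfold gainI premiumI premium1 premium2
  rw [e1, e2, kI_eq]
  ring

theorem integrableOn_gainI (hl : M.AdmissibleI l) (h1 : M.Admissible1 xi1)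
    (h2 : M.Admissible2 xi2) : IntegrableOn (M.gainI l xi1 xi2) (Icc 0 M.T) := by
  have ha : IntegrableOn (fun s => M.premiumI - M.premium1 l.1 xi1 s - M.premium2 l.2 xi2 s)
      (Icc 0 M.T) :=
    ((integrableOn_const (by simp)).sub (integrableOn_premium1 hl.share1 h1)).sub
      (integrableOn_premium2 hl.share2 h2)
  refine (integrableOn_gain M.isRate_rhoI ha hl.retained M.gammaI).congr_fun
    (fun s hs => (gainI_eq hl hs).symm) measurableSet_Icc

theorem objectiveI_eq {Ω : Type*} [MeasurableSpace Ω] {P : Measure Ω} [IsProbabilityMeasure P]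
    {N : ℝ → Ω → ℕ} {Y : ℕ → Ω → ℝ} (h : IsClaimModel M P N Y) (hl : M.AdmissibleI l)
    (h1 : M.Admissible1 xi1) (h2 : M.Admissible2 xi2) {t : ℝ} (ht : t ∈ Icc 0 M.T) (x : ℝ) :
    objectiveI M P N Y t x l xi1 xi2
      = x * M.growth M.rhoI t + ∫ s in t..M.T, M.gainI l xi1 xi2 s := by
  have ha : IntegrableOn (fun s => M.premiumI - M.premium1 l.1 xi1 s - M.premium2 l.2 xi2 s)
      (Icc 0 M.T) :=
    ((integrableOn_const (by simp)).sub (integrableOn_premium1 hl.share1 h1)).sub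
      (integrableOn_premium2 hl.share2 h2)
  unfold objectiveI
  rw [h.meanVariance_eq M.isRate_rhoI ha hl.retained ht]
  congr 1
  refine intervalIntegral.integral_congr fun s hs => ?_
  exact (gainI_eq hl (uIcc_subset_Icc ht (IsClaimModel.T_mem M) hs)).symm

end Gain

/-- The reinsurance strategy that minimizes the loss rate of the insurer. -/
noncomputable def optimalShare (M : Market) (xi1 xi2 : ℝ → ℝ) : (ℝ → ℝ → ℝ) × (ℝ → ℝ → ℝ) :=
  (fun s y => M.kI s / (M.kI s + 2 * xi1 s) * min y (retentionLevel (M.kI s) (xi1 s) (xi2 s)),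
    fun s y => max (y - retentionLevel (M.kI s) (xi1 s) (xi2 s)) 0)

theorem retentionLevel_pos {k x1 x2 : ℝ} (hk : 0 < k) (h1 : 0 < x1) (h2 : 0 < x2) :
    0 < retentionLevel k x1 x2 := by unfold retentionLevel; positivity

theorem share_mem {q d y : ℝ} (hq : q ∈ Icc 0 1) (hd : 0 ≤ d) (hy : 0 ≤ y) :
    0 ≤ q * min y d ∧ 0 ≤ max (y - d) 0 ∧ q * min y d + max (y - d) 0 ≤ y := by
  have h0 : 0 ≤ min y d := le_min hy hd
  refine ⟨mul_nonneg hq.1 h0, le_max_right _ _, ?_⟩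
  have h1 : q * min y d ≤ min y d := mul_le_of_le_one_left h0 hq.2
  have h2 : min y d + max (y - d) 0 = y := by
    rcases le_total y d with h | h
    · rw [min_eq_left h, max_eq_right (by linarith)]; ring
    · rw [min_eq_right h, max_eq_left (by linarith)]; ring
  linarith

theorem quota_mem {k x1 : ℝ} (hk : 0 < k) (h1 : 0 < x1) : k / (k + 2 * x1) ∈ Icc 0 1 :=
  ⟨by positivity, by rw [div_le_one (by positivity)]; linarith⟩

theorem measurable_domRestrict_growth {rho : ℝ → ℝ} (hr : M.IsRate rho) :
    Measurable ((Icc 0 M.T).domRestrict (M.growth rho)) :=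
  (continuousOn_iff_continuous_domRestrict.1 hr.continuousOn_growth).measurable

theorem measurable_domRestrict_kI : Measurable ((Icc 0 M.T).domRestrict M.kI) :=
  (measurable_domRestrict_growth M.isRate_rhoI).const_mul M.gammaI

theorem measurable_domRestrict_k1 : Measurable ((Icc 0 M.T).domRestrict M.k1) :=
  (measurable_domRestrict_growth M.isRate_rho1).const_mul M.gamma1

theorem measurable_domRestrict_k2 : Measurable ((Icc 0 M.T).domRestrict M.k2) :=
  (measurable_domRestrict_growth M.isRate_rho2).const_mul M.gamma2

theorem admissibleI_optimalShare {xi1 xi2 : ℝ → ℝ} (h1 : M.Admissible1 xi1)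
    (h2 : M.Admissible2 xi2) : M.AdmissibleI (M.optimalShare xi1 xi2) := by
  have hp : Measurable (fun z : (Icc 0 M.T ×ˢ Ici 0 : Set (ℝ × ℝ)) =>
      (⟨z.1.1, z.2.1⟩ : Icc 0 M.T)) :=
    (measurable_fst.comp measurable_subtype_coe).subtype_mk
  have hy : Measurable (fun z : (Icc 0 M.T ×ˢ Ici 0 : Set (ℝ × ℝ)) => z.1.2) :=
    measurable_snd.comp measurable_subtype_coe
  have m0 := measurable_domRestrict_kI (M := M).comp hp
  have m1 := h1.1.comp hp
  have m2 := h2.1.comp hp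
  have md : Measurable (fun z : (Icc 0 M.T ×ˢ Ici 0 : Set (ℝ × ℝ)) =>
      retentionLevel (M.kI z.1.1) (xi1 z.1.1) (xi2 z.1.1)) :=
    m2.mul ((m0.const_div 1).add ((m1.const_mul 2).const_div 1))
  refine ⟨(m0.div (m0.add (m1.const_mul 2))).mul (hy.min md), (hy.sub md).max measurable_const,
    fun s hs y hy => ?_⟩
  exact share_mem (quota_mem (kI_pos s) (h1.pos hs))
    (retentionLevel_pos (kI_pos s) (h1.pos hs) (h2.pos hs)).le hy

/-- A time-independent combination of a layered proportional treaty and a stop-loss treaty. -/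
noncomputable def constantShare (z : ℝ × ℝ) : (ℝ → ℝ → ℝ) × (ℝ → ℝ → ℝ) :=
  (fun _ y => z.1 * min y z.2, fun _ y => max (y - z.2) 0)

theorem admissibleI_constantShare {z : ℝ × ℝ} (hz : z ∈ (Icc 0 1 ×ˢ Ici 0 : Set (ℝ × ℝ))) :
    M.AdmissibleI (constantShare z) := by
  have hy : Measurable (fun z : (Icc 0 M.T ×ˢ Ici 0 : Set (ℝ × ℝ)) => z.1.2) :=
    measurable_snd.comp measurable_subtype_coe
  exact ⟨(hy.min measurable_const).const_mul z.1, (hy.sub_const z.2).max measurable_const,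
    fun s _ y hy => share_mem hz.1 hz.2 hy⟩

/-- The closed form shows continuity in the two treaty parameters, as the density argument requires.
-/
theorem integral_cedingCost_constantShare {z : ℝ × ℝ}
    (hz : z ∈ (Icc 0 1 ×ˢ Ici 0 : Set (ℝ × ℝ))) (k x1 x2 : ℝ) :
    ∫ y, cedingCost k x1 x2 y (z.1 * min y z.2) (max (y - z.2) 0) ∂M.nu
      = (x1 * z.1 ^ 2 + k / 2 * (1 - z.1) ^ 2) * (M.lam * (2 / M.beta ^ 2) *
          (1 - Real.exp (-(M.beta * z.2)) * (1 + M.beta * z.2)))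
        + x2 * (M.lam * (Real.exp (-(M.beta * z.2)) / M.beta)) := by
  obtain ⟨q, d⟩ := z
  have hd : 0 ≤ d := hz.2
  have h0 : (0 : ℝ) ∈ Icc 0 M.T := ⟨le_rfl, M.T_pos.le⟩
  have im : Integrable (fun y => min y d ^ 2) M.nu := by
    have := (admissibleI_constantShare (M := M) (z := (1, d))
      ⟨⟨zero_le_one, le_rfl⟩, hz.2⟩).share1.integrable_sq h0
    simpa [constantShare] using this
  have he : ∀ y, cedingCost k x1 x2 y (q * min y d) (max (y - d) 0)
      = (x1 * q ^ 2 + k / 2 * (1 - q) ^ 2) * min y d ^ 2 + x2 * max (y - d) 0 := by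
    intro y
    have h2 : max (y - d) 0 = y - min y d := by
      rcases le_total y d with h | h
      · rw [min_eq_left h, max_eq_right (by linarith)]; ring
      · rw [min_eq_right h, max_eq_left (by linarith)]
    unfold cedingCost
    rw [h2]; ring
  simp only [he]
  rw [integral_add (im.const_mul _) ((M.integrable_excess hd).const_mul _), integral_const_mul,
    integral_const_mul, M.integral_min_sq hd, M.integral_excess hd]

theorem lossRate_optimalShare_le {l : (ℝ → ℝ → ℝ) × (ℝ → ℝ → ℝ)} {xi1 xi2 : ℝ → ℝ}
    (hl : M.AdmissibleI l) (h1 : M.Admissible1 xi1) (h2 : M.Admissible2 xi2) {s : ℝ}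
    (hs : s ∈ Icc 0 M.T) : M.lossRate (M.optimalShare xi1 xi2) xi1 xi2 s ≤ M.lossRate l xi1 xi2 s :=
  integral_mono_ae (integrable_cedingCost (admissibleI_optimalShare h1 h2) hs _ _ _)
    (integrable_cedingCost hl hs _ _ _) (M.ae_nu_pos.mono fun y hy =>
      cedingCost_le (kI_pos s) (h1.pos hs) (hl.2.2 s hs y hy.le).2.1)

theorem ae_eq_optimalShare_of_lossRate_le {l : (ℝ → ℝ → ℝ) × (ℝ → ℝ → ℝ)} {xi1 xi2 : ℝ → ℝ}
    (hl : M.AdmissibleI l) (h1 : M.Admissible1 xi1) (h2 : M.Admissible2 xi2) {s : ℝ}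
    (hs : s ∈ Icc 0 M.T)
    (hle : M.lossRate l xi1 xi2 s ≤ M.lossRate (M.optimalShare xi1 xi2) xi1 xi2 s) :
    ∀ᵐ y ∂M.nu, l.1 s y = (M.optimalShare xi1 xi2).1 s y ∧
      l.2 s y = (M.optimalShare xi1 xi2).2 s y := by
  have io := integrable_cedingCost (admissibleI_optimalShare h1 h2) hs (M.kI s) (xi1 s) (xi2 s)
  have il := integrable_cedingCost hl hs (M.kI s) (xi1 s) (xi2 s)
  have hnn : 0 ≤ᵐ[M.nu] fun y => cedingCost (M.kI s) (xi1 s) (xi2 s) y (l.1 s y) (l.2 s y)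
      - cedingCost (M.kI s) (xi1 s) (xi2 s) y ((M.optimalShare xi1 xi2).1 s y)
        ((M.optimalShare xi1 xi2).2 s y) :=
    M.ae_nu_pos.mono fun y hy => sub_nonneg.2
      (cedingCost_le (kI_pos s) (h1.pos hs) (hl.2.2 s hs y hy.le).2.1)
  have hz := (integral_eq_zero_iff_of_nonneg_ae hnn (il.sub io)).1 (le_antisymm
    (by rw [integral_sub il io]; exact sub_nonpos.2 hle) (integral_nonneg_of_ae hnn))
  filter_upwards [hz, M.ae_nu_pos] with y h0 hy
  exact eq_of_cedingCost_le (kI_pos s) (h1.pos hs) (hl.2.2 s hs y hy.le).2.1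
    (sub_eq_zero.1 h0).le

end Market

section Insurer

variable {M : Market} {Ω : Type*} [MeasurableSpace Ω] {P : Measure Ω} [IsProbabilityMeasure P]
  {N : ℝ → Ω → ℕ} {Y : ℕ → Ω → ℝ} {xi1 xi2 : ℝ → ℝ}

open Market

/-- The strategy maximizes the gain rate at every time, so the difference in the liminf is
nonnegative for each `ε`. -/
theorem isInsurerEquilibrium_optimalShare (h : IsClaimModel M P N Y) (h1 : M.Admissible1 xi1)
    (h2 : M.Admissible2 xi2) :
    IsInsurerEquilibrium M P N Y xi1 xi2 (M.optimalShare xi1 xi2) := by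
  have ho := admissibleI_optimalShare h1 h2
  refine ⟨ho, fun t ht x a1 a2 ha => liminf_nonneg_of_forall fun ε hε => ?_⟩
  have hsub : uIcc t M.T ⊆ Icc 0 M.T := uIcc_subset_Icc ht (IsClaimModel.T_mem M)
  rw [objectiveI_eq h ho h1 h2 ht, objectiveI_eq h (ha ε hε) h1 h2 ht, add_sub_add_left_eq_sub,
    sub_nonneg]
  refine intervalIntegral.integral_mono_on ht.2
    ((integrableOn_gainI (ha ε hε) h1 h2).mono_set hsub).intervalIntegrable
    ((integrableOn_gainI ho h1 h2).mono_set hsub).intervalIntegrable fun s hs => ?_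
  have hs' : s ∈ Icc 0 M.T := ⟨ht.1.trans hs.1, hs.2⟩
  exact mul_le_mul_of_nonneg_left (sub_le_sub_left
    (lossRate_optimalShare_le (ha ε hε) h1 h2 hs') _) (M.growth_pos _ s).le

theorem perturb_admissibleI {l m : (ℝ → ℝ → ℝ) × (ℝ → ℝ → ℝ)} (hl : M.AdmissibleI l)
    {a1 a2 : ℝ → ℝ} (hm : M.AdmissibleI m) (h1 : ∀ s, m.1 s = a1) (h2 : ∀ s, m.2 s = a2)
    (t ε : ℝ) : M.AdmissibleI (perturb t ε a1 l.1, perturb t ε a2 l.2) := by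
  have hS : MeasurableSet {z : (Icc 0 M.T ×ˢ Ici 0 : Set (ℝ × ℝ)) | t ≤ z.1.1 ∧ z.1.1 < t + ε} :=
    (measurable_fst.comp measurable_subtype_coe)
      (measurableSet_Ico (a := t) (b := t + ε))
  refine ⟨?_, ?_, fun s hs y hy => ?_⟩
  · have key : Measurable (fun z : (Icc 0 M.T ×ˢ Ici 0 : Set (ℝ × ℝ)) =>
        if t ≤ z.1.1 ∧ z.1.1 < t + ε then m.1 z.1.1 z.1.2 else l.1 z.1.1 z.1.2) :=
      Measurable.ite hS hm.1 hl.1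
    convert! key using 1
    ext z
    simp only [domRestrict_apply, Function.uncurry, perturb]
    split_ifs
    · rw [h1]
    · rfl
  · have key : Measurable (fun z : (Icc 0 M.T ×ˢ Ici 0 : Set (ℝ × ℝ)) =>
        if t ≤ z.1.1 ∧ z.1.1 < t + ε then m.2 z.1.1 z.1.2 else l.2 z.1.1 z.1.2) :=
      Measurable.ite hS hm.2.1 hl.2.1
    convert! key using 1
    ext z
    simp only [domRestrict_apply, Function.uncurry, perturb]
    split_ifs
    · rw [h2]
    · rfl
  · have e1 := hm.2.2 s hs y hy
    rw [h1, h2] at e1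
    have e2 := hl.2.2 s hs y hy
    simp only [perturb]
    split_ifs
    · exact e1
    · exact e2

theorem gainI_perturb (l : (ℝ → ℝ → ℝ) × (ℝ → ℝ → ℝ)) (z : ℝ × ℝ) (t ε s : ℝ) :
    M.gainI (perturb t ε (fun y => z.1 * min y z.2) l.1,
        perturb t ε (fun y => max (y - z.2) 0) l.2) xi1 xi2 s
      = if t ≤ s ∧ s < t + ε then M.gainI (constantShare z) xi1 xi2 s
          else M.gainI l xi1 xi2 s := by
  unfold gainI lossRate perturb constantShare
  split_ifs with h
  · simp only [if_pos h]
  · simp only [if_neg h]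

theorem continuousOn_gainI_constantShare (M : Market) (xi1 xi2 : ℝ → ℝ) (s : ℝ) : ContinuousOn
    (fun z => M.gainI (constantShare z) xi1 xi2 s) (Icc 0 1 ×ˢ Ici 0 : Set (ℝ × ℝ)) := by
  have h : Continuous (fun z : ℝ × ℝ => (xi1 s * z.1 ^ 2 + M.kI s / 2 * (1 - z.1) ^ 2)
      * (M.lam * (2 / M.beta ^ 2) * (1 - Real.exp (-(M.beta * z.2)) * (1 + M.beta * z.2)))
      + xi2 s * (M.lam * (Real.exp (-(M.beta * z.2)) / M.beta))) := by fun_prop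
  have h' : Continuous (fun z : ℝ × ℝ => M.growth M.rhoI s * (M.theta * (∫ y, y ∂M.nu)
      - ((xi1 s * z.1 ^ 2 + M.kI s / 2 * (1 - z.1) ^ 2)
      * (M.lam * (2 / M.beta ^ 2) * (1 - Real.exp (-(M.beta * z.2)) * (1 + M.beta * z.2)))
      + xi2 s * (M.lam * (Real.exp (-(M.beta * z.2)) / M.beta))))) :=
    continuous_const.mul (continuous_const.sub h)
  refine h'.continuousOn.congr fun z hz => ?_
  simp only [← integral_cedingCost_constantShare (M := M) hz]
  rfl

theorem IsInsurerEquilibrium.gainI_constantShare_le (h : IsClaimModel M P N Y)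
    {l : (ℝ → ℝ → ℝ) × (ℝ → ℝ → ℝ)} (h1 : M.Admissible1 xi1) (h2 : M.Admissible2 xi2)
    (hl : IsInsurerEquilibrium M P N Y xi1 xi2 l) {z : ℝ × ℝ}
    (hz : z ∈ (Icc 0 1 ×ˢ Ici 0 : Set (ℝ × ℝ))) : ∀ᵐ s ∂(volume.restrict (Icc 0 M.T)),
      M.gainI (constantShare z) xi1 xi2 s ≤ M.gainI l xi1 xi2 s := by
  have hm := admissibleI_constantShare (M := M) hz
  refine ae_le_of_liminf_nonneg M.T_pos (integrableOn_gainI hl.1 h1 h2)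
    (integrableOn_gainI hm h1 h2) fun t ht => ?_
  have hp := fun ε => perturb_admissibleI hl.1 (a1 := fun y => z.1 * min y z.2)
    (a2 := fun y => max (y - z.2) 0) hm (fun _ => rfl) (fun _ => rfl) t ε
  have hlim := hl.2 t ht 0 (fun y => z.1 * min y z.2) (fun y => max (y - z.2) 0) fun ε _ => hp ε
  have hD : ∀ ε, objectiveI M P N Y t 0 l xi1 xi2 - objectiveI M P N Y t 0
      (perturb t ε (fun y => z.1 * min y z.2) l.1,
        perturb t ε (fun y => max (y - z.2) 0) l.2) xi1 xi2
      = (∫ s in t..M.T, M.gainI l xi1 xi2 s) - (∫ s in t..M.T, if t ≤ s ∧ s < t + ε then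
        M.gainI (constantShare z) xi1 xi2 s else M.gainI l xi1 xi2 s) := by
    intro ε
    rw [objectiveI_eq h hl.1 h1 h2 ht, objectiveI_eq h (hp ε) h1 h2 ht, add_sub_add_left_eq_sub]
    simp_rw [gainI_perturb]
  simpa only [hD] using hlim

/-- An equilibrium reinsurance strategy coincides almost everywhere with the optimal one. -/
theorem IsInsurerEquilibrium.ae_eq_optimalShare (h : IsClaimModel M P N Y)
    {l : (ℝ → ℝ → ℝ) × (ℝ → ℝ → ℝ)} (h1 : M.Admissible1 xi1) (h2 : M.Admissible2 xi2)
    (hl : IsInsurerEquilibrium M P N Y xi1 xi2 l) :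
    ∀ᵐ s ∂(volume.restrict (Icc 0 M.T)), ∀ᵐ y ∂M.nu,
      l.1 s y = (M.optimalShare xi1 xi2).1 s y ∧ l.2 s y = (M.optimalShare xi1 xi2).2 s y := by
  filter_upwards [ae_forall_le_of_continuousOn
    (ae_of_all _ fun s => continuousOn_gainI_constantShare M xi1 xi2 s)
    (fun z hz => hl.gainI_constantShare_le h h1 h2 hz), ae_restrict_mem measurableSet_Icc]
    with s hall hs
  refine ae_eq_optimalShare_of_lossRate_le hl.1 h1 h2 hs ?_
  -- The treaty fixed in time whose parameters are the optimal ones at `s`. Admitting all parameters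
  -- at once before choosing `s` is what allows this choice.
  have h3 := hall (M.kI s / (M.kI s + 2 * xi1 s), retentionLevel (M.kI s) (xi1 s) (xi2 s))
    ⟨quota_mem (kI_pos s) (h1.pos hs),
      (retentionLevel_pos (kI_pos s) (h1.pos hs) (h2.pos hs)).le⟩
  have h4 := le_of_mul_le_mul_left h3 (M.growth_pos _ s)
  have h5 : M.lossRate (constantShare (M.kI s / (M.kI s + 2 * xi1 s),
      retentionLevel (M.kI s) (xi1 s) (xi2 s))) xi1 xi2 s
      = M.lossRate (M.optimalShare xi1 xi2) xi1 xi2 s := by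
    simp only [lossRate, constantShare, optimalShare]
  rw [← h5]
  exact (sub_le_sub_iff_left _).1 h4

end Insurer

/-! ### Gain rates of the reinsurers under the insurer's response. -/

namespace Market

variable {M : Market} {xi1 xi2 : ℝ → ℝ}

/-- Gain rate of reinsurer 1, valued at the horizon, when the loadings are `x1`, `x2`. -/
noncomputable def gain1 (M : Market) (x1 x2 s : ℝ) : ℝ :=
  M.growth M.rho1 s * (M.lam * (2 / M.beta ^ 2) * payoff1 (M.kI s) (M.k1 s) M.beta x1 x2)

/-- Gain rate of reinsurer 2, valued at the horizon, when the loadings are `x1`, `x2`. -/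
noncomputable def gain2 (M : Market) (x1 x2 s : ℝ) : ℝ :=
  M.growth M.rho2 s * (M.lam / M.beta * payoff2 (M.kI s) (M.k2 s) M.beta x1 x2)

/-- The premium exceeds the expected claims by `xi1 * ∫ l1 ^ 2`, so the rate is `(xi1 - k1 / 2) * ∫
l1 ^ 2`, and the exponential layer moment turns it into `payoff1`. -/
theorem gain1_eq {l1 : ℝ → ℝ → ℝ} (h1 : M.Admissible1 xi1) (h2 : M.Admissible2 xi2) {s : ℝ}
    (hs : s ∈ Icc 0 M.T) (hl : ∀ᵐ y ∂M.nu, l1 s y = (M.optimalShare xi1 xi2).1 s y) :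
    M.growth M.rho1 s * (M.premium1 l1 xi1 s - (∫ y, l1 s y ∂M.nu)
      - M.gamma1 * M.growth M.rho1 s / 2 * ∫ y, l1 s y ^ 2 ∂M.nu)
      = M.gain1 (xi1 s) (xi2 s) s := by
  have hd := (retentionLevel_pos (M.kI_pos s) (h1.pos hs) (h2.pos hs)).le
  have e : ∫ y, l1 s y ^ 2 ∂M.nu = (M.kI s / (M.kI s + 2 * xi1 s)) ^ 2
      * ∫ y, min y (retentionLevel (M.kI s) (xi1 s) (xi2 s)) ^ 2 ∂M.nu := by
    rw [← integral_const_mul]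
    refine integral_congr_ae (hl.mono fun y hy => ?_)
    simp only [hy, optimalShare, mul_pow]
  have e2 : M.beta * retentionLevel (M.kI s) (xi1 s) (xi2 s)
      = M.beta * xi2 s * (1 / M.kI s + 1 / (2 * xi1 s)) := by
    unfold retentionLevel; ring
  unfold premium1 gain1 payoff1
  rw [e, M.integral_min_sq hd, e2, k1_eq]
  ring

theorem gain2_eq {l2 : ℝ → ℝ → ℝ} (h1 : M.Admissible1 xi1) (h2 : M.Admissible2 xi2) {s : ℝ}
    (hs : s ∈ Icc 0 M.T) (hl : ∀ᵐ y ∂M.nu, l2 s y = (M.optimalShare xi1 xi2).2 s y) :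
    M.growth M.rho2 s * (M.premium2 l2 xi2 s - (∫ y, l2 s y ∂M.nu)
      - M.gamma2 * M.growth M.rho2 s / 2 * ∫ y, l2 s y ^ 2 ∂M.nu)
      = M.gain2 (xi1 s) (xi2 s) s := by
  have hd := (retentionLevel_pos (M.kI_pos s) (h1.pos hs) (h2.pos hs)).le
  have e : ∫ y, l2 s y ^ 2 ∂M.nu
      = ∫ y, max (y - retentionLevel (M.kI s) (xi1 s) (xi2 s)) 0 ^ 2 ∂M.nu :=
    integral_congr_ae (hl.mono fun y hy => by simp only [hy, optimalShare])
  have e' : ∫ y, l2 s y ∂M.nu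
      = ∫ y, max (y - retentionLevel (M.kI s) (xi1 s) (xi2 s)) 0 ∂M.nu :=
    integral_congr_ae (hl.mono fun y hy => by simp only [hy, optimalShare])
  have e2 : M.beta * retentionLevel (M.kI s) (xi1 s) (xi2 s)
      = M.beta * (1 / M.kI s + 1 / (2 * xi1 s)) * xi2 s := by
    unfold retentionLevel; ring
  have hβ := M.beta_pos.ne'
  unfold premium2 gain2 payoff2
  rw [e, e', M.integral_excess hd, M.integral_excess_sq hd, e2, k2_eq]
  generalize Real.exp (-(M.beta * (1 / M.kI s + 1 / (2 * xi1 s)) * xi2 s)) = w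
  field_simp
  ring

theorem integrableOn_gain1 (h1 : M.Admissible1 xi1) (h2 : M.Admissible2 xi2) :
    IntegrableOn (fun s => M.gain1 (xi1 s) (xi2 s) s) (Icc 0 M.T) := by
  have ho := (admissibleI_optimalShare h1 h2).share1
  exact (integrableOn_gain M.isRate_rho1 (integrableOn_premium1 ho h1) ho M.gamma1).congr_fun
    (fun s hs => gain1_eq h1 h2 hs (ae_of_all _ fun _ => rfl)) measurableSet_Icc

theorem integrableOn_gain2 (h1 : M.Admissible1 xi1) (h2 : M.Admissible2 xi2) :
    IntegrableOn (fun s => M.gain2 (xi1 s) (xi2 s) s) (Icc 0 M.T) := by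
  have ho := (admissibleI_optimalShare h1 h2).share2
  exact (integrableOn_gain M.isRate_rho2 (integrableOn_premium2 ho h2) ho M.gamma2).congr_fun
    (fun s hs => gain2_eq h1 h2 hs (ae_of_all _ fun _ => rfl)) measurableSet_Icc

theorem intervalIntegral_congr_of_ae_restrict {f g : ℝ → ℝ} {t : ℝ} (ht : t ∈ Icc 0 M.T)
    (h : ∀ᵐ s ∂(volume.restrict (Icc 0 M.T)), f s = g s) :
    ∫ s in t..M.T, f s = ∫ s in t..M.T, g s := by
  refine intervalIntegral.integral_congr_ae ?_
  filter_upwards [(ae_restrict_iff' measurableSet_Icc).1 h] with s hs hst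
  exact hs (uIcc_subset_Icc ht (IsClaimModel.T_mem M) (uIoc_subset_uIcc hst))

end Market

section Reinsurers

variable {M : Market} {Ω : Type*} [MeasurableSpace Ω] {P : Measure Ω} [IsProbabilityMeasure P]
  {N : ℝ → Ω → ℕ} {Y : ℕ → Ω → ℝ} {xi1 xi2 : ℝ → ℝ}
  {L : (ℝ → ℝ) → (ℝ → ℝ) → (ℝ → ℝ → ℝ) × (ℝ → ℝ → ℝ)}

open Market

/-- `L` may react to a deviation at all times, but any response agrees with `optimalShare` outside a
null set. Hence the objective depends on the two loadings alone. -/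
theorem objective1_response (h : IsClaimModel M P N Y) (hL : IsInsurerResponse M P N Y L)
    (h1 : M.Admissible1 xi1) (h2 : M.Admissible2 xi2) {t : ℝ} (ht : t ∈ Icc 0 M.T) (x : ℝ) :
    objective1 M P N Y t x (L xi1 xi2).1 xi1
      = x * M.growth M.rho1 t + ∫ s in t..M.T, M.gain1 (xi1 s) (xi2 s) s := by
  have hl := hL xi1 xi2 h1 h2
  unfold objective1
  rw [h.meanVariance_eq M.isRate_rho1 (integrableOn_premium1 hl.1.share1 h1) hl.1.share1 ht]
  congr 1
  refine intervalIntegral_congr_of_ae_restrict ht ?_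
  filter_upwards [hl.ae_eq_optimalShare h h1 h2, ae_restrict_mem measurableSet_Icc] with s hs hsI
  exact gain1_eq h1 h2 hsI (hs.mono fun _ h => h.1)

theorem objective2_response (h : IsClaimModel M P N Y) (hL : IsInsurerResponse M P N Y L)
    (h1 : M.Admissible1 xi1) (h2 : M.Admissible2 xi2) {t : ℝ} (ht : t ∈ Icc 0 M.T) (x : ℝ) :
    objective2 M P N Y t x (L xi1 xi2).2 xi2
      = x * M.growth M.rho2 t + ∫ s in t..M.T, M.gain2 (xi1 s) (xi2 s) s := by
  have hl := hL xi1 xi2 h1 h2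
  unfold objective2
  rw [h.meanVariance_eq M.isRate_rho2 (integrableOn_premium2 hl.1.share2 h2) hl.1.share2 ht]
  congr 1
  refine intervalIntegral_congr_of_ae_restrict ht ?_
  filter_upwards [hl.ae_eq_optimalShare h h1 h2, ae_restrict_mem measurableSet_Icc] with s hs hsI
  exact gain2_eq h1 h2 hsI (hs.mono fun _ h => h.2)

end Reinsurers

/-! ### Equilibria of a scalar control problem, covering both reinsurers. -/

section ScalarControl

/-- Measurable controls on `[0, T]` with values in `[c, d]`. -/
def IsControl (T c d : ℝ) (xi : ℝ → ℝ) : Prop :=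
  Measurable ((Icc 0 T).domRestrict xi) ∧ ∀ t ∈ Icc 0 T, xi t ∈ Icc c d

variable {T c d : ℝ} {F : ℝ → ℝ → ℝ} {J : ℝ → ℝ → (ℝ → ℝ) → ℝ} {K : ℝ → ℝ} {xi : ℝ → ℝ}

theorem isControl_const {a : ℝ} (ha : a ∈ Icc c d) : IsControl T c d (fun _ => a) :=
  ⟨measurable_const, fun _ _ => ha⟩

theorem IsControl.perturb (hxi : IsControl T c d xi) {a : ℝ} (ha : a ∈ Icc c d) (t ε : ℝ) :
    IsControl T c d (perturb t ε a xi) := by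
  have hS : MeasurableSet {z : Icc 0 T | t ≤ z.1 ∧ z.1 < t + ε} :=
    measurable_subtype_coe (measurableSet_Ico (a := t) (b := t + ε))
  constructor
  · have key : Measurable (fun z : Icc 0 T => if t ≤ z.1 ∧ z.1 < t + ε then a else xi z.1) :=
      Measurable.ite hS measurable_const hxi.1
    exact key
  · intro s hs
    simp only [_root_.perturb]
    split_ifs
    · exact ha
    · exact hxi.2 s hs

theorem liminf_nonneg_of_pointwise (hF : ∀ xi, IsControl T c d xi →
      IntegrableOn (fun s => F (xi s) s) (Icc 0 T))
    (hJ : ∀ xi, IsControl T c d xi → ∀ t ∈ Icc 0 T, ∀ x,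
      J t x xi = x * K t + ∫ s in t..T, F (xi s) s)
    (hxi : IsControl T c d xi) (hmax : ∀ s ∈ Icc 0 T, ∀ a ∈ Icc c d, F a s ≤ F (xi s) s)
    {t : ℝ} (ht : t ∈ Icc 0 T) (x a : ℝ) (ha : ∀ ε > 0, IsControl T c d (perturb t ε a xi)) :
    0 ≤ liminf (fun ε : ℝ => ((1 / ε * (J t x xi - J t x (perturb t ε a xi)) : ℝ) : EReal))
      (𝓝[>] 0) := by
  refine liminf_nonneg_of_forall fun ε hε => ?_
  have hT : T ∈ Icc 0 T := ⟨ht.1.trans ht.2, le_rfl⟩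
  have hsub : uIcc t T ⊆ Icc 0 T := uIcc_subset_Icc ht hT
  rw [hJ _ hxi t ht, hJ _ (ha ε hε) t ht, add_sub_add_left_eq_sub, sub_nonneg]
  refine intervalIntegral.integral_mono_on ht.2
    ((hF _ (ha ε hε)).mono_set hsub).intervalIntegrable
    ((hF _ hxi).mono_set hsub).intervalIntegrable fun s hs => ?_
  have hs' : s ∈ Icc 0 T := ⟨ht.1.trans hs.1, hs.2⟩
  exact hmax s hs' _ ((ha ε hε).2 s hs')

theorem ae_pointwise_of_liminf_nonneg (hT : 0 < T) (hF : ∀ xi, IsControl T c d xi →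
      IntegrableOn (fun s => F (xi s) s) (Icc 0 T))
    (hJ : ∀ xi, IsControl T c d xi → ∀ t ∈ Icc 0 T, ∀ x,
      J t x xi = x * K t + ∫ s in t..T, F (xi s) s)
    (hcont : ∀ᵐ s ∂(volume.restrict (Icc 0 T)), ContinuousOn (fun a => F a s) (Icc c d))
    (hxi : IsControl T c d xi)
    (h : ∀ t ∈ Icc 0 T, ∀ x a : ℝ, (∀ ε > 0, IsControl T c d (perturb t ε a xi)) →
      0 ≤ liminf (fun ε : ℝ => ((1 / ε * (J t x xi - J t x (perturb t ε a xi)) : ℝ) : EReal))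
        (𝓝[>] 0)) :
    ∀ᵐ s ∂(volume.restrict (Icc 0 T)), ∀ a ∈ Icc c d, F a s ≤ F (xi s) s := by
  refine ae_forall_le_of_continuousOn hcont fun a ha => ?_
  refine ae_le_of_liminf_nonneg hT (hF _ hxi) (hF _ (isControl_const ha)) fun t ht => ?_
  have hlim := h t ht 0 a fun ε _ => hxi.perturb ha t ε
  have hD : ∀ ε, J t 0 xi - J t 0 (perturb t ε a xi) = (∫ s in t..T, F (xi s) s)
      - (∫ s in t..T, if t ≤ s ∧ s < t + ε then F a s else F (xi s) s) := by
    intro ε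
    rw [hJ _ hxi t ht, hJ _ (hxi.perturb ha t ε) t ht, add_sub_add_left_eq_sub]
    have : ∀ s, F (perturb t ε a xi s) s
        = if t ≤ s ∧ s < t + ε then F a s else F (xi s) s := by
      intro s
      simp only [perturb]
      split_ifs <;> rfl
    simp_rw [this]
  simpa only [hD] using hlim

end ScalarControl

/-! ### The functions `h1` and `h2`, the equilibrium loadings and their measurability. -/

namespace Market

variable {M : Market}

/-- With `z = β * y * (1 / kI + 1 / (2 * x))`, the equation `h1 x = y` says that `z` is the preimage
of `k1 / x` under `G`. The form `slope1 = 0` avoids the inverse of `G` and the partial domain of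
`h1`. -/
theorem h1_iff (t : ℝ) {x y : ℝ} (hx : 0 < x) (hy : 0 < y) :
    (x ∈ M.h1Domain t ∧ M.h1 t x = y) ↔ slope1 (M.kI t) (M.k1 t) M.beta x y = 0 := by
  have hk := M.kI_pos t
  have hk1 := M.k1_pos t
  have hβ := M.beta_pos
  have hinj : InjOn (M.G t) (Ioi 0) := (gFun_eFun_strictAntiOn (div_pos hk1 hk)).injOn
  unfold slope1
  constructor
  · rintro ⟨⟨-, himg⟩, hxy⟩
    have hz : 0 < M.GInv t (M.k1 t / x) := Function.invFunOn_mem himg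
    have hG : M.G t (M.GInv t (M.k1 t / x)) = M.k1 t / x := Function.invFunOn_eq himg
    have hzy : M.beta * y * (1 / M.kI t + 1 / (2 * x)) = M.GInv t (M.k1 t / x) := by
      rw [← hxy, h1]; field_simp; ring
    rw [hzy, sub_eq_zero]
    exact hG.symm
  · intro h
    have hz : 0 < M.beta * y * (1 / M.kI t + 1 / (2 * x)) := by positivity
    have hG : M.G t (M.beta * y * (1 / M.kI t + 1 / (2 * x))) = M.k1 t / x :=
      (sub_eq_zero.1 h).symm
    refine ⟨⟨hx, _, hz, hG⟩, ?_⟩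
    have : M.GInv t (M.k1 t / x) = M.beta * y * (1 / M.kI t + 1 / (2 * x)) := by
      rw [← hG]; exact hinj.leftInvOn_invFunOn hz
    rw [h1, this]; field_simp; ring

theorem injOn_G (M : Market) (t : ℝ) : InjOn (M.G t) (Ioi 0) :=
  (gFun_eFun_strictAntiOn (div_pos (M.k1_pos t) (M.kI_pos t))).injOn

theorem h1_pos (t : ℝ) {x : ℝ} (hx : x ∈ M.h1Domain t) : 0 < M.h1 t x := by
  have hz : 0 < M.GInv t (M.k1 t / x) := Function.invFunOn_mem hx.2
  have hx0 := hx.1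
  have := M.kI_pos t
  have := M.beta_pos
  unfold h1
  positivity

theorem bijOn_h1 (M : Market) (t : ℝ) : BijOn (M.h1 t) (M.h1Domain t) (Ioi 0) := by
  refine ⟨fun x hx => h1_pos t hx, fun x hx x' hx' heq => ?_, fun y hy => ?_⟩
  · have hy := h1_pos t hx
    exact (slope1_strictAntiOn (M.kI_pos t) (M.k1_pos t) M.beta_pos hy).injOn hx.1 hx'.1
      (((h1_iff t hx.1 hy).1 ⟨hx, rfl⟩).trans ((h1_iff t hx'.1 hy).1 ⟨hx', heq.symm⟩).symm)
  · obtain ⟨x, hx, h⟩ := exists_slope1_eq_zero (M.kI_pos t) (M.k1_pos t) M.beta_pos hy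
    obtain ⟨h3, h4⟩ := (h1_iff t hx hy).2 h
    exact ⟨x, h3, h4⟩

theorem h1Inv_spec (t : ℝ) {y : ℝ} (hy : 0 < y) :
    0 < M.h1Inv t y ∧ slope1 (M.kI t) (M.k1 t) M.beta (M.h1Inv t y) y = 0 := by
  have himg : y ∈ M.h1 t '' M.h1Domain t := (bijOn_h1 M t).surjOn hy
  have hm : M.h1Inv t y ∈ M.h1Domain t := Function.invFunOn_mem himg
  have he : M.h1 t (M.h1Inv t y) = y := Function.invFunOn_eq himg
  exact ⟨hm.1, (h1_iff t hm.1 hy).1 ⟨hm, he⟩⟩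

/-- The loading of reinsurer 1 in the unconstrained equilibrium. -/
noncomputable def xi1Bar (M : Market) (t : ℝ) : ℝ := Classical.choose
  (exists_slope1_bestReply2_eq_zero (M.kI_pos t) (M.k1_pos t) (M.k2_pos t) M.beta_pos)

theorem xi1Bar_spec (M : Market) (t : ℝ) : 0 < M.xi1Bar t ∧
    slope1 (M.kI t) (M.k1 t) M.beta (M.xi1Bar t) (bestReply2 (M.kI t) (M.k2 t) M.beta (M.xi1Bar t))
      = 0 :=
  Classical.choose_spec
    (exists_slope1_bestReply2_eq_zero (M.kI_pos t) (M.k1_pos t) (M.k2_pos t) M.beta_pos)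

/-- The loading of reinsurer 2 in the unconstrained equilibrium. -/
noncomputable def xi2Bar (M : Market) (t : ℝ) : ℝ := M.h2 t (M.xi1Bar t)

/-- By `h1_iff`, and because `h2` unfolds to `bestReply2`, such an equilibrium is a zero of `slope1`
along the graph of `bestReply2`, where `slope1` is strictly decreasing. -/
theorem isUnconstrainedEquilibrium_iff (t c1 c2 : ℝ) :
    M.IsUnconstrainedEquilibrium t c1 c2 ↔ c1 = M.xi1Bar t ∧ c2 = M.xi2Bar t := by
  obtain ⟨hb, hb0⟩ := M.xi1Bar_spec t
  constructor
  · rintro ⟨hd, hpos, e1, e2⟩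
    have h0 := (h1_iff t hd.1 hpos).1 ⟨hd, e1.symm⟩
    have hc : c1 = M.xi1Bar t := by
      refine (slope1_bestReply2_strictAntiOn (M.kI_pos t) (M.k1_pos t) (M.k2_pos t)
        M.beta_pos).injOn hd.1 hb ?_
      refine Eq.trans ?_ hb0.symm
      rw [← h0, e2]
      rfl
    exact ⟨hc, by rw [e2, hc]; rfl⟩
  · rintro ⟨rfl, rfl⟩
    have hpos : 0 < M.xi2Bar t := bestReply2_pos (M.kI_pos t) (M.k2_pos t) M.beta_pos hb
    obtain ⟨h3, h4⟩ := (h1_iff t hb hpos).2 hb0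
    exact ⟨h3, hpos, h4.symm, rfl⟩

section Measurability

variable {α : Type*} [MeasurableSpace α]

/-- For a root `r` of a decreasing function the superlevel set `{x < r}` is `{0 < s x}`, so
measurability of the function at each fixed `x` passes to its root. -/
theorem measurable_of_lt_iff {r : α → ℝ} {s : ℝ → α → ℝ} (hs : ∀ x, 0 < x → Measurable (s x))
    (hr : ∀ a, 0 < r a) (hiff : ∀ x, 0 < x → ∀ a, x < r a ↔ 0 < s x a) : Measurable r := by
  refine measurable_of_Ioi fun x => ?_
  rcases le_or_gt x 0 with hx | hx
  · have : r ⁻¹' Ioi x = univ := eq_univ_of_forall fun a => hx.trans_lt (hr a)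
    rw [this]; exact MeasurableSet.univ
  · have : r ⁻¹' Ioi x = s x ⁻¹' Ioi 0 := by
      ext a; exact hiff x hx a
    rw [this]; exact hs x hx measurableSet_Ioi

theorem measurable_slope1_comp {k k1 y : α → ℝ} (β x : ℝ) (hk : Measurable k)
    (hk1 : Measurable k1) (hy : Measurable y) :
    Measurable (fun a => slope1 (k a) (k1 a) β x (y a)) := by
  have he : Measurable eFun := by unfold eFun; fun_prop
  unfold slope1
  refine (hk1.div_const x).sub (continuous_gFun.measurable.comp
    ((hk1.div hk).prodMk (he.comp ?_)))
  exact (hy.const_mul β).mul ((hk.const_div 1).add_const _)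

theorem measurable_bestReply2_comp {k k2 x : α → ℝ} (β : ℝ) (hk : Measurable k)
    (hk2 : Measurable k2) (hx : Measurable x) :
    Measurable (fun a => bestReply2 (k a) (k2 a) β (x a)) := by
  unfold bestReply2
  exact (hk.div_const β).mul (((hk2.div hk).const_add 1).sub (hk.div (hk.add (hx.const_mul 2))))

theorem lt_root_iff {k k1 β : ℝ} (hk : 0 < k) (hk1 : 0 < k1) (hβ : 0 < β) {x x₀ y : ℝ}
    (hx : 0 < x) (hx₀ : 0 < x₀) (hy : 0 < y) (h₀ : slope1 k k1 β x₀ y = 0) :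
    x < x₀ ↔ 0 < slope1 k k1 β x y := by
  rw [← h₀]
  exact ((slope1_strictAntiOn hk hk1 hβ hy).lt_iff_gt hx₀ hx).symm

theorem measurable_xi1Bar : Measurable ((Icc 0 M.T).domRestrict M.xi1Bar) := by
  refine measurable_of_lt_iff (s := fun x (t : Icc 0 M.T) => slope1 (M.kI t) (M.k1 t) M.beta x
    (bestReply2 (M.kI t) (M.k2 t) M.beta x)) (fun x _ => ?_) (fun t => (M.xi1Bar_spec t).1) ?_
  · exact measurable_slope1_comp _ _ measurable_domRestrict_kI measurable_domRestrict_k1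
      (measurable_bestReply2_comp _ measurable_domRestrict_kI measurable_domRestrict_k2
        measurable_const)
  · intro x hx t
    have h := (slope1_bestReply2_strictAntiOn (M.kI_pos t) (M.k1_pos t) (M.k2_pos t)
      M.beta_pos).lt_iff_gt (M.xi1Bar_spec t).1 hx
    rw [(M.xi1Bar_spec t).2] at h
    exact h.symm

theorem measurable_h2_comp {xi : ℝ → ℝ} (hx : Measurable ((Icc 0 M.T).domRestrict xi)) :
    Measurable ((Icc 0 M.T).domRestrict fun t => M.h2 t (xi t)) :=
  measurable_bestReply2_comp M.beta measurable_domRestrict_kI measurable_domRestrict_k2 hx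

theorem measurable_xi2Bar : Measurable ((Icc 0 M.T).domRestrict M.xi2Bar) :=
  measurable_h2_comp measurable_xi1Bar

theorem measurable_h1Inv_comp {xi : ℝ → ℝ} (hx : Measurable ((Icc 0 M.T).domRestrict xi))
    (hpos : ∀ t, 0 < xi t) :
    Measurable ((Icc 0 M.T).domRestrict fun t => M.h1Inv t (xi t)) := by
  refine measurable_of_lt_iff (s := fun x (t : Icc 0 M.T) => slope1 (M.kI t) (M.k1 t) M.beta x
    (xi t)) (fun x _ => ?_) (fun t => (h1Inv_spec t.1 (hpos t)).1) ?_
  · exact measurable_slope1_comp _ _ measurable_domRestrict_kI measurable_domRestrict_k1 hx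
  · intro x hx t
    exact lt_root_iff (M.kI_pos t) (M.k1_pos t) M.beta_pos hx (h1Inv_spec t.1 (hpos t)).1
      (hpos t) (h1Inv_spec t.1 (hpos t)).2

end Measurability

theorem theta_beta_le (M : Market) : M.theta * M.beta ≤ M.eta * M.beta :=
  mul_le_mul_of_nonneg_right M.theta_le_eta M.beta_pos.le

theorem clamp_mem {a b u : ℝ} (hab : a ≤ b) : max a (min u b) ∈ Icc a b :=
  ⟨le_max_left _ _, max_le hab (min_le_right _ _)⟩

theorem xi2Star_mem (b1 b2 : ℝ → ℝ) (t : ℝ) : M.xi2Star b1 b2 t ∈ Icc M.theta M.eta := by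
  unfold xi2Star
  split_ifs <;> exact clamp_mem M.theta_le_eta

theorem xi2Star_pos (b1 b2 : ℝ → ℝ) (t : ℝ) : 0 < M.xi2Star b1 b2 t :=
  M.theta_pos.trans_le (xi2Star_mem b1 b2 t).1

theorem admissible2_xi2Star : M.Admissible2 (M.xi2Star M.xi1Bar M.xi2Bar) := by
  refine ⟨?_, fun t _ => xi2Star_mem _ _ t⟩
  have hlt (a : ℝ) : MeasurableSet {t : Icc 0 M.T | M.xi1Bar t < a} :=
    measurable_xi1Bar measurableSet_Iio
  have hle (a : ℝ) : MeasurableSet {t : Icc 0 M.T | M.xi1Bar t ≤ a} :=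
    measurable_xi1Bar measurableSet_Iic
  have hc (f : ℝ → ℝ) (hf : Measurable ((Icc 0 M.T).domRestrict f)) :
      Measurable (fun t : Icc 0 M.T => max M.theta (min (f t) M.eta)) :=
    measurable_const.max (hf.min measurable_const)
  have hconst (a : ℝ) := hc (fun t => M.h2 t a) (measurable_h2_comp measurable_const)
  exact Measurable.ite (hlt (M.theta * M.beta)) (hconst _)
    (Measurable.ite (hle (M.eta * M.beta)) (hc M.xi2Bar measurable_xi2Bar) (hconst _))

theorem admissible1_xi1Star : M.Admissible1 (M.xi1Star M.xi1Bar M.xi2Bar) :=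
  ⟨measurable_const.max ((measurable_h1Inv_comp admissible2_xi2Star.1
    fun t => xi2Star_pos _ _ t).min measurable_const), fun _ _ => clamp_mem M.theta_beta_le⟩

/-- One half of the mutual best reply. The other half is the definition of `xi1Star`. -/
theorem xi2Star_eq (t : ℝ) : M.xi2Star M.xi1Bar M.xi2Bar t = max M.theta (min
    (bestReply2 (M.kI t) (M.k2 t) M.beta (M.xi1Star M.xi1Bar M.xi2Bar t)) M.eta) :=
  constrained_fixed_point (M.kI_pos t) (M.k1_pos t) (M.k2_pos t) M.beta_pos
    (mul_pos M.theta_pos M.beta_pos) M.theta_beta_le M.theta_pos M.theta_le_eta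
    (fun _ hy => h1Inv_spec t hy) (M.xi1Bar_spec t).1 (M.xi1Bar_spec t).2 rfl

/-- Weak inequality would give the equilibrium property; strictness identifies every equilibrium
with the truncated peak. -/
theorem gain1_lt {x y : ℝ} (t : ℝ) (hy : 0 < y)
    (hx : x ∈ Icc (M.theta * M.beta) (M.eta * M.beta))
    (hne : x ≠ max (M.theta * M.beta) (min (M.h1Inv t y) (M.eta * M.beta))) :
    M.gain1 x y t
      < M.gain1 (max (M.theta * M.beta) (min (M.h1Inv t y) (M.eta * M.beta))) y t := by
  obtain ⟨h1, h2⟩ := h1Inv_spec (M := M) t hy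
  obtain ⟨u1, u2⟩ := payoff1_unimodal (M.kI_pos t) (M.k1_pos t) M.beta_pos h1 hy h2
  have := lt_of_unimodal u1 u2 (mul_pos M.theta_pos M.beta_pos) hx hne
  have hl := M.lam_pos
  have hβ := M.beta_pos
  exact mul_lt_mul_of_pos_left (mul_lt_mul_of_pos_left this (by positivity)) (M.growth_pos _ t)

theorem gain2_lt {x y : ℝ} (t : ℝ) (hx : 0 < x) (hy : y ∈ Icc M.theta M.eta)
    (hne : y ≠ max M.theta (min (bestReply2 (M.kI t) (M.k2 t) M.beta x) M.eta)) :
    M.gain2 x y t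
      < M.gain2 x (max M.theta (min (bestReply2 (M.kI t) (M.k2 t) M.beta x) M.eta)) t := by
  obtain ⟨u1, u2⟩ := payoff2_unimodal (M.kI_pos t) (M.k2_pos t) M.beta_pos hx
  have := lt_of_unimodal u1 u2 M.theta_pos hy hne
  have hl := M.lam_pos
  have hβ := M.beta_pos
  exact mul_lt_mul_of_pos_left (mul_lt_mul_of_pos_left this (by positivity)) (M.growth_pos _ t)

theorem continuousOn_gain1 {y : ℝ} (t : ℝ) (hy : 0 < y) :
    ContinuousOn (fun x => M.gain1 x y t) (Icc (M.theta * M.beta) (M.eta * M.beta)) := by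
  refine continuousOn_const.mul (continuousOn_const.mul fun x hx => ?_)
  exact (hasDerivAt_payoff1 (M.kI_pos t) (M.k1_pos t) M.beta_pos
    ((mul_pos M.theta_pos M.beta_pos).trans_le hx.1) hy).continuousAt.continuousWithinAt

theorem continuous_gain2 (x t : ℝ) : Continuous (fun y => M.gain2 x y t) := by
  unfold gain2 payoff2; fun_prop

end Market

/-! ### The premium game and the main theorem. -/

section PremiumGame

variable {M : Market} {Ω : Type*} [MeasurableSpace Ω] {P : Measure Ω} [IsProbabilityMeasure P]
  {N : ℝ → Ω → ℕ} {Y : ℕ → Ω → ℝ} {xi1 xi2 : ℝ → ℝ}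
  {L : (ℝ → ℝ) → (ℝ → ℝ) → (ℝ → ℝ → ℝ) × (ℝ → ℝ → ℝ)}

open Market

theorem exists_insurerResponse (h : IsClaimModel M P N Y) : ∃ L, IsInsurerResponse M P N Y L :=
  ⟨M.optimalShare, fun _ _ h1 h2 => isInsurerEquilibrium_optimalShare h h1 h2⟩

theorem isEquilibrium1_of_bestReply (h : IsClaimModel M P N Y) (hL : IsInsurerResponse M P N Y L)
    (h1 : M.Admissible1 xi1) (h2 : M.Admissible2 xi2) (hbest : ∀ t ∈ Icc 0 M.T,
      xi1 t = max (M.theta * M.beta) (min (M.h1Inv t (xi2 t)) (M.eta * M.beta))) :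
    IsEquilibrium1 M P N Y L xi2 xi1 := by
  refine ⟨h1, fun t ht x a ha => liminf_nonneg_of_pointwise
    (F := fun a s => M.gain1 a (xi2 s) s) (J := fun t x xi => objective1 M P N Y t x (L xi xi2).1 xi)
    (fun xi hxi => integrableOn_gain1 hxi h2)
    (fun xi hxi t ht x => objective1_response h hL hxi h2 ht x) h1 ?_ ht x a ha⟩
  intro s hs a ha
  rw [hbest s hs]
  by_cases hne : a = max (M.theta * M.beta) (min (M.h1Inv s (xi2 s)) (M.eta * M.beta))
  · rw [← hne]
  · exact (gain1_lt s (h2.pos hs) ha hne).le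

theorem isEquilibrium2_of_bestReply (h : IsClaimModel M P N Y) (hL : IsInsurerResponse M P N Y L)
    (h1 : M.Admissible1 xi1) (h2 : M.Admissible2 xi2) (hbest : ∀ t ∈ Icc 0 M.T,
      xi2 t = max M.theta (min (bestReply2 (M.kI t) (M.k2 t) M.beta (xi1 t)) M.eta)) :
    IsEquilibrium2 M P N Y L xi1 xi2 := by
  refine ⟨h2, fun t ht x a ha => liminf_nonneg_of_pointwise
    (F := fun a s => M.gain2 (xi1 s) a s) (J := fun t x xi => objective2 M P N Y t x (L xi1 xi).2 xi)
    (fun xi hxi => integrableOn_gain2 h1 hxi)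
    (fun xi hxi t ht x => objective2_response h hL h1 hxi ht x) h2 ?_ ht x a ha⟩
  intro s hs a ha
  rw [hbest s hs]
  by_cases hne : a = max M.theta (min (bestReply2 (M.kI s) (M.k2 s) M.beta (xi1 s)) M.eta)
  · rw [← hne]
  · exact (gain2_lt s (h1.pos hs) ha hne).le

theorem IsEquilibrium1.ae_eq (h : IsClaimModel M P N Y) (hL : IsInsurerResponse M P N Y L)
    (h2 : M.Admissible2 xi2) (he : IsEquilibrium1 M P N Y L xi2 xi1) :
    ∀ᵐ t ∂(volume.restrict (Icc 0 M.T)),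
      xi1 t = max (M.theta * M.beta) (min (M.h1Inv t (xi2 t)) (M.eta * M.beta)) := by
  have hmem := ae_restrict_mem (μ := volume) (measurableSet_Icc (a := (0 : ℝ)) (b := M.T))
  have := ae_pointwise_of_liminf_nonneg M.T_pos
    (F := fun a s => M.gain1 a (xi2 s) s) (J := fun t x xi => objective1 M P N Y t x (L xi xi2).1 xi)
    (fun xi hxi => integrableOn_gain1 hxi h2)
    (fun xi hxi t ht x => objective1_response h hL hxi h2 ht x)
    (hmem.mono fun s hs => continuousOn_gain1 s (h2.pos hs)) he.1 he.2
  filter_upwards [this, hmem] with s hs hsI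
  by_contra hne
  exact absurd (gain1_lt s (h2.pos hsI) (he.1.2 s hsI) hne)
    (not_lt.2 (hs _ (clamp_mem M.theta_beta_le)))

theorem IsEquilibrium2.ae_eq (h : IsClaimModel M P N Y) (hL : IsInsurerResponse M P N Y L)
    (h1 : M.Admissible1 xi1) (he : IsEquilibrium2 M P N Y L xi1 xi2) :
    ∀ᵐ t ∂(volume.restrict (Icc 0 M.T)),
      xi2 t = max M.theta (min (bestReply2 (M.kI t) (M.k2 t) M.beta (xi1 t)) M.eta) := by
  have hmem := ae_restrict_mem (μ := volume) (measurableSet_Icc (a := (0 : ℝ)) (b := M.T))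
  have := ae_pointwise_of_liminf_nonneg M.T_pos
    (F := fun a s => M.gain2 (xi1 s) a s) (J := fun t x xi => objective2 M P N Y t x (L xi1 xi).2 xi)
    (fun xi hxi => integrableOn_gain2 h1 hxi)
    (fun xi hxi t ht x => objective2_response h hL h1 hxi ht x)
    (ae_of_all _ fun s => (continuous_gain2 _ s).continuousOn) he.1 he.2
  filter_upwards [this, hmem] with s hs hsI
  by_contra hne
  exact absurd (gain2_lt s (h1.pos hsI) (he.1.2 s hsI) hne)
    (not_lt.2 (hs _ (clamp_mem M.theta_le_eta)))

end PremiumGame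

theorem proposition4p3 (M : Market) {Ω : Type*} [MeasurableSpace Ω] (P : Measure Ω)
    [IsProbabilityMeasure P] (N : ℝ → Ω → ℕ) (Y : ℕ → Ω → ℝ) (hNY : IsClaimModel M P N Y) :
    -- the inverse functions in the formulas are well defined
    (∀ t ∈ Icc 0 M.T, InjOn (M.G t) (Ioi 0) ∧ BijOn (M.h1 t) (M.h1Domain t) (Ioi 0)) ∧
    -- the insurer has an equilibrium response to all admissible premium strategies
    (∃ L, IsInsurerResponse M P N Y L) ∧
    -- the unconstrained equilibrium exists uniquely and yields the constrained one
    ∃ b1 b2 : ℝ → ℝ,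
      (∀ t ∈ Icc 0 M.T, ∀ c1 c2 : ℝ,
        M.IsUnconstrainedEquilibrium t c1 c2 ↔ c1 = b1 t ∧ c2 = b2 t) ∧
      ∀ L, IsInsurerResponse M P N Y L →
        IsPremiumEquilibrium M P N Y L (M.xi1Star b1 b2) (M.xi2Star b1 b2) ∧
        ∀ xi1 xi2 : ℝ → ℝ, IsPremiumEquilibrium M P N Y L xi1 xi2 →
          ∀ᵐ t ∂(volume.restrict (Icc 0 M.T)),
            xi1 t = M.xi1Star b1 b2 t ∧ xi2 t = M.xi2Star b1 b2 t := by
  refine ⟨fun t _ => ⟨M.injOn_G t, M.bijOn_h1 t⟩, exists_insurerResponse hNY, M.xi1Bar, M.xi2Bar,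
    fun t _ c1 c2 => Market.isUnconstrainedEquilibrium_iff t c1 c2, fun L hL => ⟨⟨?_, ?_⟩, ?_⟩⟩
  · exact isEquilibrium1_of_bestReply hNY hL Market.admissible1_xi1Star Market.admissible2_xi2Star
      fun t _ => rfl
  · exact isEquilibrium2_of_bestReply hNY hL Market.admissible1_xi1Star Market.admissible2_xi2Star
      fun t _ => Market.xi2Star_eq t
  · intro xi1 xi2 he
    filter_upwards [he.1.ae_eq hNY hL he.2.1, he.2.ae_eq hNY hL he.1.1] with t e1 e2
    -- At almost every time both the given pair and the formula are mutual best replies, and there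
    -- is only one such pair.
    exact constrained_fixed_point_unique (M.kI_pos t) (M.k1_pos t) (M.k2_pos t) M.beta_pos
      (mul_pos M.theta_pos M.beta_pos) M.theta_pos M.theta_le_eta
      (fun y hy => Market.h1Inv_spec t hy) e1 e2 rfl (Market.xi2Star_eq t)
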